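/- Let $r\ge 2$. For $u=(u_2,\dots,u_r)\in\mathbb C^{r-1}$ and a scale $\Lambda$, consider the Seiberg--Witten curve $$C_u:\quad \Lambda^r\left(w+\tfrac1w\right)=P(z)=z^r+u_2z^{r-2}+u_3z^{r-3}+\cdots+u_r,\qquad y=\Lambda^r\left(w-\tfrac1w\right),\quad y^2=P(z)^2-4\Lambda^{2r},$$ with the meromorphic differential $dS=-\frac1{2\pi}z\frac{dw}{w}=-\frac{1}{2\pi}\frac{zP'(z)\,dz}{y}$. Suppose first that $\Lambda>0$, that $u$ is real, and that all solutions $z_\alpha^\pm$ of $P(z_\alpha^{\pm})=\pm2\Lambda^r$ ($1\le\alpha\le r$) are real and distinct, numbered so that $z_1^+>z_1^->z_2^->z_2^+>z_3^+>z_3^->\cdots$. Let $A_\alpha$ be the counterclockwise cycle around the cut between $z_\alpha^-$ and $z_\alpha^+$ on the sheet where $y=\sqrt{P^2-4\Lambda^{2r}}$ is approximated by $P$. For $2\le\beta\le r$ let $C_\beta$ be the cycle that runs on this sheet along the real segment from $z_{\beta-1}^{\pm}$ to $z_\beta^{\pm}$ (sign $+$ for $\beta$ odd, $-$ for $\beta$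 even) and returns along the other sheet, and let $B_\alpha=\sum_{\beta=2}^\alpha C_\beta$. Put $$a_\alpha=\int_{A_\alpha}dS,\qquad a^D_\alpha=2\pi\sqrt{-1}\int_{B_\alpha}dS\qquad(\alpha=2,\dots,r).$$ Take $(a,\Lambda)$ with $a=(a_2,\dots,a_r)$ as coordinates instead of $(u,\Lambda)$. Let $V\subset\mathbb C^{r-1}\times\mathbb C$ be a connected open set which, for some $b^0\in\mathbb R^{r-1}$ and $\varepsilon>0$, contains all points $(-\sqrt{-1}\,b,\Lambda)$ with $b\in\mathbb R^{r-1}$, $\max_\alpha|b_\alpha-b^0_\alpha|<\varepsilon$, $0<\Lambda<\varepsilon$. Let $u_p=u_p(a,\Lambda)$ and $a^D_\alpha=a^D_\alpha(a,\Lambda)$ be holomorphic functions on $V$ such that, at each of these real points, the curve with parameters $u(a,\Lambda)$ and $\Lambda$ is of the above real type, has $A$-periods $a_\alpha$, and has dual periods $a^D_\alpha(a,\Lambda)$ (so on the rest of $V$ they are given by analytic continuation). Let $\mathcal F_0=\mathcal F_0(a;\Lambda)$ be the Seiberg--Witten prepotential, that is, a holomorphic function on $V$ with $$a^D_\alpha=-\frac{\partial\mathcal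 F_0}{\partial a_\alpha}\quad(\alpha=2,\dots,r),\qquad \Bigl(\sum_{\alpha=2}^r a_\alpha\frac{\partial}{\partial a_\alpha}+\Lambda\frac{\partial}{\partial\Lambda}\Bigr)\mathcal F_0=2\mathcal F_0,$$ normalized (to exclude the remaining freedom of adding a constant multiple of $\Lambda^2$) by the requirement that for each fixed $a=-\sqrt{-1}\,b$ with $\max_\alpha|b_\alpha-b^0_\alpha|<\varepsilon$ and all sufficiently small $\Lambda>0$, $\mathcal F_0(a;\Lambda)=c\log\Lambda+h(\Lambda^{2r})$ with a constant $c$ and a function $h$ holomorphic near $0$, where $c$ and $h$ may depend on $a$. Then, on $V$, $$\Lambda\frac{\partial\mathcal F_0}{\partial\Lambda}=-2r\,u_2,$$ where $\partial/\partial\Lambda$ is taken at fixed $a$. -/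

import Mathlib

open scoped Topology

namespace SeibergWitten

noncomputable section

/-- The polynomial `P(z) = z ^ r + u_2 z ^ (r - 2) + ⋯ + u_r`; the entry of `u` with index `i`
is the coefficient `u_{i + 2}`. -/
def swPoly (r : ℕ) (u : Fin (r - 1) → ℂ) : Polynomial ℂ :=
  Polynomial.X ^ r +
    ∑ i : Fin (r - 1), Polynomial.C (u i) * Polynomial.X ^ (r - 2 - (i : ℕ))

/-- The function `y = √(P ^ 2 - 4 Λ ^ (2 r)) = Λ ^ r (w - 1 / w)` on the sheet of the curve
`Λ ^ r (w + 1 / w) = P(z)` on which it is approximated by `P`. With the principal square root it is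
holomorphic off the set where `P` takes values in the segment `[-2 Λ ^ r, 2 Λ ^ r]`. When all branch
points are real, that set is the union of the `r` cuts. -/
def swY (r : ℕ) (u : Fin (r - 1) → ℂ) (Λ z : ℂ) : ℂ :=
  (swPoly r u).eval z * Complex.sqrt (1 - 4 * Λ ^ (2 * r) / (swPoly r u).eval z ^ 2)

/-- On that sheet `y` satisfies the equation of the hyperelliptic curve. -/
theorem swY_sq (r : ℕ) (u : Fin (r - 1) → ℂ) (Λ z : ℂ) (hz : (swPoly r u).eval z ≠ 0) :
    swY r u Λ z ^ 2 = (swPoly r u).eval z ^ 2 - 4 * Λ ^ (2 * r) := by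
  have h : ∀ x : ℂ, Complex.sqrt x ^ 2 = x := fun x => by
    rw [Complex.sqrt, ← Complex.cpow_nat_mul]
    norm_num
  rw [swY, mul_pow, h]
  field_simp

/-- The coefficient of `dz` in the Seiberg-Witten differential
`dS = -(1 / 2π) z dw / w = -(1 / 2π) z P'(z) dz / y`. -/
def swForm (r : ℕ) (u : Fin (r - 1) → ℂ) (Λ z : ℂ) : ℂ :=
  -(1 / (2 * (Real.pi : ℂ))) * (z * (swPoly r u).derivative.eval z / swY r u Λ z)

/-- The cycle `C_β` passes through two branch points of the same sign: the minus sign for even `β`,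
the plus sign for odd `β`. -/
def gapEnd (zp zm : ℕ → ℝ) (β α : ℕ) : ℝ := if Even β then zm α else zp α

/-- All branch points are real, `Λ > 0`, and `zp α = z_α⁺`, `zm α = z_α⁻` (for `1 ≤ α ≤ r`) are the
solutions of `P = 2 Λ ^ r` and `P = -2 Λ ^ r`, numbered so that
`z_1⁺ > z_1⁻ > z_2⁻ > z_2⁺ > z_3⁺ > z_3⁻ > ⋯`. -/
structure IsRealBranchPoints (r : ℕ) (u : Fin (r - 1) → ℂ) (Λ : ℝ) (zp zm : ℕ → ℝ) : Prop where
  coeff_real : ∀ i, (u i).im = 0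
  scale_pos : 0 < Λ
  eval_plus : ∀ α ∈ Finset.Icc 1 r, (swPoly r u).eval (zp α : ℂ) = 2 * (Λ : ℂ) ^ r
  eval_minus : ∀ α ∈ Finset.Icc 1 r, (swPoly r u).eval (zm α : ℂ) = -(2 * (Λ : ℂ) ^ r)
  cut_odd : ∀ α ∈ Finset.Icc 1 r, Odd α → zm α < zp α
  cut_even : ∀ α ∈ Finset.Icc 1 r, Even α → zp α < zm α
  gap : ∀ β ∈ Finset.Icc 2 r, gapEnd zp zm β β < gapEnd zp zm β (β - 1)

/-- The circle with real centre `c` and radius `ρ` encircles the cut between `z_α⁻` and `z_α⁺`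
and none of the other cuts. -/
def EncirclesCut (r : ℕ) (zp zm : ℕ → ℝ) (α : ℕ) (c ρ : ℝ) : Prop :=
  |zp α - c| < ρ ∧ |zm α - c| < ρ ∧
    ∀ β ∈ Finset.Icc 1 r, β ≠ α → ρ < |zp β - c| ∧ ρ < |zm β - c|

/-- `v = ∫_{A_α} dS`, where `A_α` is represented by any counterclockwise circle, on the sheet where
`y` is approximated by `P`, around the cut between `z_α⁻` and `z_α⁺`. -/
def IsAPeriod (r : ℕ) (u : Fin (r - 1) → ℂ) (Λ : ℝ) (zp zm : ℕ → ℝ) (α : ℕ) (v : ℂ) : Prop :=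
  ∀ c ρ : ℝ, EncirclesCut r zp zm α c ρ → (∮ z in C((c : ℂ), ρ), swForm r u (Λ : ℂ) z) = v

/-- `∫_{C_β} dS`. The cycle `C_β` is the segment from the end of the cut `β - 1` to the end of the
cut `β` on the sheet where `y` is approximated by `P`, followed by its image under the hyperelliptic
involution run backwards. The involution changes the sign of `dS`, hence the factor `2`. -/
def gapPeriod (r : ℕ) (u : Fin (r - 1) → ℂ) (Λ : ℝ) (zp zm : ℕ → ℝ) (β : ℕ) : ℂ :=
  2 * ∫ x in (gapEnd zp zm β (β - 1))..(gapEnd zp zm β β), swForm r u (Λ : ℂ) (x : ℂ)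

/-- `a^D_α = 2π√(-1) ∫_{B_α} dS`, where `B_α = C_2 + ⋯ + C_α`. -/
def dualPeriod (r : ℕ) (u : Fin (r - 1) → ℂ) (Λ : ℝ) (zp zm : ℕ → ℝ) (α : ℕ) : ℂ :=
  2 * (Real.pi : ℂ) * Complex.I * ∑ β ∈ Finset.Icc 2 α, gapPeriod r u Λ zp zm β

/-- The point `(a, Λ)` with `√(-1) a_α = b_α` real and `Λ` real. The entry with index `j` is the
coordinate `a_{j + 2}`. -/
def realPoint {r : ℕ} (b : Fin (r - 1) → ℝ) (Λ : ℝ) : (Fin (r - 1) → ℂ) × ℂ :=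
  (fun j => -Complex.I * (b j : ℂ), (Λ : ℂ))

/-- `V` is a connected domain in the space of `(a, Λ)`, `a = (a_2, …, a_r)`, and `u`, `aD` are the
functions `u_p(a, Λ)` and `a^D_α(a, Λ)` on it: they are holomorphic on `V`, and on the real points
of `V` with `√(-1) a` within `ε` of `b₀` and `0 < Λ < ε` all branch points of the curve with
parameters `u(a, Λ)` are real, its periods over the `A`-cycles are `a`, and `aD` is given by its
periods over the `B`-cycles. Elsewhere on `V` they are the analytic continuations. -/
structure IsSWBranch (r : ℕ) (V : Set ((Fin (r - 1) → ℂ) × ℂ))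
    (u aD : (Fin (r - 1) → ℂ) × ℂ → Fin (r - 1) → ℂ) (b₀ : Fin (r - 1) → ℝ) (ε : ℝ) : Prop where
  isOpen : IsOpen V
  isConnected : IsConnected V
  analytic_u : AnalyticOnNhd ℂ u V
  analytic_aD : AnalyticOnNhd ℂ aD V
  radius_pos : 0 < ε
  real_mem : ∀ b : Fin (r - 1) → ℝ, dist b b₀ < ε → ∀ Λ : ℝ, 0 < Λ → Λ < ε → realPoint b Λ ∈ V
  real_periods : ∀ b : Fin (r - 1) → ℝ, dist b b₀ < ε → ∀ Λ : ℝ, 0 < Λ → Λ < ε →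
    ∃ zp zm : ℕ → ℝ,
      IsRealBranchPoints r (u (realPoint b Λ)) Λ zp zm ∧
      ∀ j : Fin (r - 1),
        IsAPeriod r (u (realPoint b Λ)) Λ zp zm ((j : ℕ) + 2) ((realPoint b Λ).1 j) ∧
        aD (realPoint b Λ) j = dualPeriod r (u (realPoint b Λ)) Λ zp zm ((j : ℕ) + 2)

/-- The partial derivative `∂F / ∂a_{j + 2}` at fixed `Λ`. -/
def partialA {r : ℕ} (F : (Fin (r - 1) → ℂ) × ℂ → ℂ) (p : (Fin (r - 1) → ℂ) × ℂ)
    (j : Fin (r - 1)) : ℂ :=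
  fderiv ℂ F p (Pi.single j 1, 0)

/-- The partial derivative `∂F / ∂Λ` at fixed `a`. -/
def partialScale {r : ℕ} (F : (Fin (r - 1) → ℂ) × ℂ → ℂ) (p : (Fin (r - 1) → ℂ) × ℂ) : ℂ :=
  fderiv ℂ F p (0, 1)

/-- `F` is the Seiberg-Witten prepotential: a holomorphic function of `(a, Λ)` with
`a^D_α = -∂F / ∂a_α`, homogeneous of degree `2`. These two conditions leave the freedom of adding
`k Λ ^ 2` with `k` constant; it is removed by the requirement that, for fixed `a` and small `Λ`,
`F` is a power series in `Λ ^ (2 r)` up to a multiple of `log Λ`. -/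
structure IsPrepotential (r : ℕ) (V : Set ((Fin (r - 1) → ℂ) × ℂ))
    (aD : (Fin (r - 1) → ℂ) × ℂ → Fin (r - 1) → ℂ) (b₀ : Fin (r - 1) → ℝ) (ε : ℝ)
    (F : (Fin (r - 1) → ℂ) × ℂ → ℂ) : Prop where
  analytic : AnalyticOnNhd ℂ F V
  gradient : ∀ p ∈ V, ∀ j, aD p j = -partialA F p j
  euler : ∀ p ∈ V, (∑ j, p.1 j * partialA F p j) + p.2 * partialScale F p = 2 * F p
  scale_expansion : ∀ b : Fin (r - 1) → ℝ, dist b b₀ < ε →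
    ∃ (c : ℂ) (h : ℂ → ℂ), AnalyticAt ℂ h 0 ∧
      ∀ᶠ Λ : ℝ in 𝓝[>] 0,
        F (realPoint b Λ) = c * (Real.log Λ : ℂ) + h ((Λ : ℂ) ^ (2 * r))

end

end SeibergWitten

/-!
Let `G = Λ ∂F/∂Λ + 2 r u_2`. The Euler relation and `a^D = -∂F/∂a` give
`G = 2 F + ∑ a_α a^D_α + 2 r u_2`, the function `defect` below. It is holomorphic on `V`, and the
points with `√(-1) a` and `Λ` real form a totally real subspace of maximal dimension, so by the
identity theorem (`eqOn_zero_of_realPoint`) it suffices that `G` vanishes at the real points. This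
follows from three facts.

*At the real points `G` is independent of `a`* (`IsPrepotential.fderiv_defect_horizontal`). The
derivative of `z P'(z) / y` along a variation `Q = δP` at fixed `Λ` is `z (Q / y)'`, which differs
from `-Q / y` by an exact form; hence the variations of the periods are the periods of the
holomorphic differential `-Q dz / y`, up to the factor of `dS` (`hasDerivAt_cellIntegral`). The
Riemann bilinear relation between `z P' dz / y`, which has double poles at the two points at
infinity, and `Q dz / y` (`IsBranchSeq.bilinear`) expresses `∑ (a δa^D - a^D δa)` through the leading
coefficient of `Q`, which is `δu_2`. Together with `δF = -∑ a^D δa` this is `δG = 0`.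

*At the real points `G` is homogeneous of degree `2`* (`IsPrepotential.fderiv_defect_ray`). Along
`(a, Λ)` itself the variation of the curve and the one given by rescaling `z` have the same
`A`-periods. They differ by a holomorphic differential without `A`-periods, that is, by a polynomial
of degree at most `r - 2` with a zero on each of the `r - 1` cuts concerned, so they agree
(`IsBranchSeq.eq_zero_of_cutPeriod_eq_zero`). Therefore `a^D` has degree `1` and `u_2` has degree
`2`. With the first fact, `G = k Λ ^ 2` for fixed `a`.

*The constant `k` vanishes* (`IsPrepotential.defect_realPoint_eq_zero`). The number `√(-1) a_α` is
the mean of `z` over the cut `α` for the probability density `|P'| / (π √(4 Λ ^ (2 r) - P ^ 2))`, and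
for fixed `a` the cuts shrink like `Λ ^ r`; hence `u_2` is a constant up to `O(Λ ^ 3)`
(`exists_abs_coeff_add_le`). For `r = 2` the size of the cuts alone gives only `O(Λ ^ 2)`, and the
second moment of a cut is needed (`IsBranchSeq.abs_coeff_zero_add_sq_le`). By the expansion of `F` in
`Λ ^ (2 r)`, also `Λ ∂F/∂Λ` is a constant up to `O(Λ ^ 3)`
(`IsPrepotential.exists_norm_scale_sub_le`). This leaves no room for a term `k Λ ^ 2`.

All periods are computed on the upper half-plane. There `y` is the product `rootProd` of the
principal square roots of `z - s_k` over the `2 r` branch points `s_1 > s_2 > ⋯`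
(`IsBranchSeq.sheetRoot_eq_rootProd`). On the cell between `s_(k + 1)` and `s_k` its boundary value is
`i ^ k` times a positive function, so that every period becomes a real integral `cellIntegral` over a
cell (`IsAPeriod.eq_cutPeriod`, `dualPeriod_eq_gapSum`). Conversely a cell integral is one component
of an integral over a semicircle that avoids the branch points
(`re_I_pow_mul_semicircleIntegral`), and in that form it can be differentiated under the integral
sign. The bilinear relation is Cauchy's theorem for `(∫ Q / y) · z P' / y` on a large half-disc, with
singularities of the type of a reciprocal square root on the boundary
(`HasBoundaryValues.semicircleIntegral_eq`).
-/

open Polynomial Filter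

namespace SeibergWitten

/-! ### The principal square root near the real axis -/

theorem csqrt_sq (z : ℂ) : z.sqrt ^ 2 = z := by
  rw [Complex.sqrt, ← Complex.cpow_nat_mul]
  norm_num

theorem norm_csqrt (z : ℂ) : ‖z.sqrt‖ = √‖z‖ := by
  rw [eq_comm, Real.sqrt_eq_iff_mul_self_eq (norm_nonneg _) (norm_nonneg _), ← norm_mul, ← sq,
    csqrt_sq]

theorem csqrt_re_nonneg (z : ℂ) : 0 ≤ z.sqrt.re := by
  rw [Complex.sqrt, Complex.cpow_inv_two_re]
  positivity

theorem csqrt_of_im_nonneg {z : ℂ} (hz : 0 ≤ z.im) :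
    z.sqrt = √((‖z‖ + z.re) / 2) + √((‖z‖ - z.re) / 2) * Complex.I := by
  rw [Complex.sqrt_eq_real_add_ite, if_pos hz, one_mul]

theorem csqrt_ofReal (x : ℝ) :
    (x : ℂ).sqrt = Complex.I ^ (if x < 0 then 1 else 0) * (√|x| : ℝ) := by
  rw [csqrt_of_im_nonneg (by simp)]
  split_ifs with h
  · have h1 : (‖(x : ℂ)‖ + (x : ℂ).re) / 2 = 0 := by simp [abs_of_neg h]
    have h2 : (‖(x : ℂ)‖ - (x : ℂ).re) / 2 = |x| := by simp [abs_of_neg h]; ring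
    rw [h1, h2]
    simp [mul_comm]
  · simp [abs_of_nonneg (not_lt.mp h)]

/-- The principal square root is continuous up to the negative real axis from above. -/
theorem tendsto_csqrt_radial (x : ℝ) :
    Tendsto (fun δ : ℝ => ((x : ℂ) + δ * Complex.I).sqrt) (𝓝[>] 0) (𝓝 (x : ℂ).sqrt) := by
  rw [csqrt_of_im_nonneg (z := (x : ℂ)) (by simp)]
  have h : ContinuousAt (fun δ : ℝ => (√((‖(x : ℂ) + δ * Complex.I‖ +
      ((x : ℂ) + δ * Complex.I).re) / 2) : ℂ) + √((‖(x : ℂ) + δ * Complex.I‖ -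
      ((x : ℂ) + δ * Complex.I).re) / 2) * Complex.I) 0 := by
    fun_prop
  have h' := h.tendsto.mono_left (nhdsWithin_le_nhds (s := Set.Ioi 0))
  simp only [Complex.ofReal_zero, zero_mul, add_zero] at h'
  refine h'.congr' ?_
  filter_upwards [self_mem_nhdsWithin] with δ hδ
  rw [csqrt_of_im_nonneg (z := (x : ℂ) + δ * Complex.I) (by simpa using (Set.mem_Ioi.mp hδ).le)]

theorem csqrt_conj {z : ℂ} (hz : z ∈ Complex.slitPlane) :
    ((starRingEnd ℂ) z).sqrt = (starRingEnd ℂ) z.sqrt := by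
  rw [Complex.sqrt, Complex.sqrt, Complex.conj_cpow _ _ (Complex.slitPlane_arg_ne_pi hz), map_inv₀,
    map_ofNat]

/-! ### The square root of a product over the branch points -/

/-- The branch of `√∏ (z - s k)`, `1 ≤ k ≤ n`, on the closed upper half-plane that is the product of
the principal square roots of the factors. -/
noncomputable def rootProd (s : ℕ → ℝ) (n : ℕ) (z : ℂ) : ℂ :=
  ∏ k ∈ Finset.Icc 1 n, (z - s k).sqrt

/-- The number of points among `s 1, …, s n` to the right of `x`. -/
noncomputable def countAbove (s : ℕ → ℝ) (n : ℕ) (x : ℝ) : ℕ :=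
  ((Finset.Icc 1 n).filter fun k => x < s k).card

/-- The point `x` lies in the cell number `k` of the complement of `s 1 > s 2 > ⋯ > s n`, that is
strictly between `s (k + 1)` and `s k`; the cells `0` and `n` are half-lines. -/
def InCell (s : ℕ → ℝ) (n k : ℕ) (x : ℝ) : Prop :=
  k ≤ n ∧ (1 ≤ k → x < s k) ∧ (k < n → s (k + 1) < x)

theorem rootProd_sq (s : ℕ → ℝ) (n : ℕ) (z : ℂ) :
    rootProd s n z ^ 2 = ∏ k ∈ Finset.Icc 1 n, (z - s k) := by
  simp [rootProd, ← Finset.prod_pow, csqrt_sq]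

theorem norm_rootProd (s : ℕ → ℝ) (n : ℕ) (z : ℂ) :
    ‖rootProd s n z‖ = ∏ k ∈ Finset.Icc 1 n, √‖z - s k‖ := by
  simp [rootProd, norm_csqrt]

theorem rootProd_ne_zero_iff (s : ℕ → ℝ) (n : ℕ) (z : ℂ) :
    rootProd s n z ≠ 0 ↔ ∀ k ∈ Finset.Icc 1 n, z ≠ s k := by
  rw [← pow_ne_zero_iff two_ne_zero, rootProd_sq, Finset.prod_ne_zero_iff]
  simp [sub_eq_zero]

theorem rootProd_ne_zero_of_im_pos (s : ℕ → ℝ) (n : ℕ) {z : ℂ} (hz : 0 < z.im) :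
    rootProd s n z ≠ 0 := by
  rw [rootProd_ne_zero_iff]
  rintro k - rfl
  simp at hz

theorem differentiableAt_rootProd (s : ℕ → ℝ) (n : ℕ) {z : ℂ} (hz : 0 < z.im) :
    DifferentiableAt ℂ (rootProd s n) z := by
  unfold rootProd
  refine DifferentiableAt.fun_finsetProd fun k _ => ?_
  have h : z - s k ∈ Complex.slitPlane := Or.inr (by simpa using hz.ne')
  exact DifferentiableAt.comp (f := fun w : ℂ => w - s k) z (Complex.differentiableAt_sqrt h)
    (by fun_prop)

theorem tendsto_rootProd_radial (s : ℕ → ℝ) (n : ℕ) (x : ℝ) :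
    Tendsto (fun δ : ℝ => rootProd s n ((x : ℂ) + δ * Complex.I)) (𝓝[>] 0)
      (𝓝 (rootProd s n x)) := by
  unfold rootProd
  refine tendsto_finsetProd _ fun k _ => ?_
  have := tendsto_csqrt_radial (x - s k)
  push_cast at this
  exact this.congr fun δ => by ring_nf

/-- Moving a point upwards increases its distance from every real point. -/
theorem norm_rootProd_le_of_re_eq (s : ℕ → ℝ) (n : ℕ) {z w : ℂ} (hre : z.re = w.re)
    (him : |z.im| ≤ |w.im|) : ‖rootProd s n z‖ ≤ ‖rootProd s n w‖ := by
  simp only [norm_rootProd]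
  refine Finset.prod_le_prod (fun k _ => Real.sqrt_nonneg _) fun k _ => Real.sqrt_le_sqrt ?_
  rw [Complex.norm_eq_sqrt_sq_add_sq, Complex.norm_eq_sqrt_sq_add_sq]
  refine Real.sqrt_le_sqrt ?_
  have := sq_le_sq.mpr him
  simp [hre]
  exact this

/-- On the real axis `rootProd` is the power of `i` that counts the branch points above `x`, times a
positive function. -/
theorem rootProd_ofReal (s : ℕ → ℝ) (n : ℕ) (x : ℝ) :
    rootProd s n x =
      Complex.I ^ countAbove s n x * (√|∏ k ∈ Finset.Icc 1 n, (x - s k)| : ℝ) := by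
  have h : ∀ k, ((x : ℂ) - s k).sqrt = Complex.I ^ (if x < s k then 1 else 0) * (√|x - s k| : ℝ) :=
    fun k => by
      rw [← Complex.ofReal_sub, csqrt_ofReal]
      simp [sub_neg]
  rw [rootProd, Finset.prod_congr rfl fun k _ => h k, Finset.prod_mul_distrib,
    Finset.prod_pow_eq_pow_sum, countAbove, Finset.card_filter, Finset.abs_prod,
    Real.sqrt_prod _ fun i _ => abs_nonneg _, Complex.ofReal_prod]

theorem prod_sub_eq_neg_one_pow (s : ℕ → ℝ) (n : ℕ) (x : ℝ) :
    ∏ k ∈ Finset.Icc 1 n, (x - s k) =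
      (-1) ^ countAbove s n x * |∏ k ∈ Finset.Icc 1 n, (x - s k)| := by
  have h : ∀ k, x - s k = (-1) ^ (if x < s k then 1 else 0) * |x - s k| := fun k => by
    split_ifs with h
    · rw [abs_of_neg (sub_neg.mpr h)]; ring
    · rw [abs_of_nonneg (sub_nonneg.mpr (not_lt.mp h))]; ring
  conv_lhs => rw [Finset.prod_congr rfl fun k _ => h k]
  rw [Finset.prod_mul_distrib, Finset.prod_pow_eq_pow_sum, countAbove, Finset.card_filter,
    Finset.abs_prod]

theorem countAbove_antitone (s : ℕ → ℝ) (n : ℕ) : Antitone (countAbove s n) := fun x y h =>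
  Finset.card_le_card fun k hk => by
    simp only [Finset.mem_filter] at hk ⊢
    exact ⟨hk.1, h.trans_lt hk.2⟩

theorem countAbove_le (s : ℕ → ℝ) (n : ℕ) (x : ℝ) : countAbove s n x ≤ n :=
  (Finset.card_filter_le _ _).trans (by simp)

theorem InCell.countAbove_eq {s : ℕ → ℝ} {n k : ℕ} {x : ℝ} (hs : StrictAntiOn s (Set.Icc 1 n))
    (h : InCell s n k x) : countAbove s n x = k := by
  have : ((Finset.Icc 1 n).filter fun j => x < s j) = Finset.Icc 1 k := by
    ext j
    simp only [Finset.mem_filter, Finset.mem_Icc]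
    constructor
    · rintro ⟨⟨h1, h2⟩, h3⟩
      refine ⟨h1, ?_⟩
      by_contra! hk
      have := hs.antitoneOn ⟨by omega, by omega⟩ ⟨h1, h2⟩ (show k + 1 ≤ j by omega)
      exact absurd (h.2.2 (by omega)) (not_lt.mpr (h3.le.trans this))
    · rintro ⟨h1, h2⟩
      have h3 := h.1
      have := hs.antitoneOn ⟨h1, by omega⟩ ⟨by omega, h3⟩ h2
      exact ⟨⟨h1, by omega⟩, (h.2.1 (by omega)).trans_le this⟩
  simp [countAbove, this]

theorem inCell_countAbove {s : ℕ → ℝ} {n : ℕ} {x : ℝ} (hs : StrictAntiOn s (Set.Icc 1 n))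
    (hx : ∀ k ∈ Finset.Icc 1 n, x ≠ s k) : InCell s n (countAbove s n x) x := by
  have key : ∀ m ≤ n, (∃ k, InCell s n k x) ∨ (1 ≤ m → x < s m) := by
    intro m
    induction m with
    | zero => intro _; right; omega
    | succ m ih =>
      intro hm
      rcases ih (by omega) with h | h
      · exact Or.inl h
      · rcases lt_or_gt_of_ne (hx (m + 1) (by simp; omega)) with h' | h'
        · exact Or.inr fun _ => h'
        · exact Or.inl ⟨m, by omega, h, fun _ => h'⟩
  rcases key n le_rfl with ⟨k, hk⟩ | h
  · rwa [hk.countAbove_eq hs]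
  · have : InCell s n n x := ⟨le_rfl, h, fun h => absurd h (lt_irrefl _)⟩
    rwa [this.countAbove_eq hs]

theorem InCell.ne {s : ℕ → ℝ} {n k : ℕ} {x : ℝ} (hs : StrictAntiOn s (Set.Icc 1 n))
    (h : InCell s n k x) : ∀ j ∈ Finset.Icc 1 n, x ≠ s j := by
  intro j hj
  rw [Finset.mem_Icc] at hj
  rcases le_or_gt j k with hjk | hjk
  · have := hs.antitoneOn ⟨hj.1, hj.2⟩ ⟨by omega, h.1⟩ hjk
    exact ((h.2.1 (by omega)).trans_le this).ne
  · have := hs.antitoneOn ⟨by omega, by omega⟩ ⟨hj.1, hj.2⟩ (show k + 1 ≤ j from hjk)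
    exact (this.trans_lt (h.2.2 (by omega))).ne'

theorem InCell.rootProd_ne_zero {s : ℕ → ℝ} {n k : ℕ} {x : ℝ} (hs : StrictAntiOn s (Set.Icc 1 n))
    (h : InCell s n k x) : rootProd s n x ≠ 0 := by
  rw [rootProd_ne_zero_iff]
  exact_mod_cast h.ne hs

/-! ### Polynomials with real branch points -/

theorem monic_eq_prod_of_roots {p : ℝ[X]} (hp : p.Monic) (S : Finset ℕ) (e : ℕ → ℝ)
    (he : Set.InjOn e S) (hroot : ∀ k ∈ S, p.eval (e k) = 0) (hdeg : p.natDegree = S.card) :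
    p = ∏ k ∈ S, (X - C (e k)) := by
  have hdvd : ∏ k ∈ S, (X - C (e k)) ∣ p := by
    refine Finset.prod_dvd_of_coprime (fun i hi j hj hij => ?_) fun k hk =>
      dvd_iff_isRoot.mpr (hroot k hk)
    exact Polynomial.isCoprime_X_sub_C_of_isUnit_sub
      (sub_ne_zero.mpr fun h => hij (he hi hj h)).isUnit
  refine (Polynomial.eq_of_monic_of_dvd_of_natDegree_le (monic_prod_of_monic _ _ fun k _ =>
    monic_X_sub_C _) hp hdvd ?_)
  rw [hdeg, natDegree_prod_of_monic _ _ fun k _ => monic_X_sub_C _]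
  simp

/-- The values of a monic real polynomial `p` of degree `r` at `2 r` points `s 1 > ⋯ > s (2 r)` are
`T, -T, -T, T, T, -T, …`, so that these are all the solutions of `p = ± T`. -/
structure IsBranchSeq (r : ℕ) (p : ℝ[X]) (T : ℝ) (s : ℕ → ℝ) : Prop where
  monic : p.Monic
  natDegree : p.natDegree = r
  pos : 0 < T
  anti : StrictAntiOn s (Set.Icc 1 (2 * r))
  val : ∀ k ∈ Finset.Icc 1 (2 * r), p.eval (s k) = (-1) ^ (k / 2) * T

namespace IsBranchSeq

variable {r : ℕ} {p : ℝ[X]} {T : ℝ} {s : ℕ → ℝ}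

theorem sq_sub_eq_prod (h : IsBranchSeq r p T s) (hr : 1 ≤ r) :
    p ^ 2 - C (T ^ 2) = ∏ k ∈ Finset.Icc 1 (2 * r), (X - C (s k)) := by
  have hd : (p ^ 2).natDegree = 2 * r := by rw [h.monic.natDegree_pow, h.natDegree]
  have hlt : (C (T ^ 2)).degree < (p ^ 2).degree := by
    rw [degree_eq_natDegree (h.monic.pow 2).ne_zero, hd]
    exact degree_C_le.trans_lt (by exact_mod_cast (by omega : 0 < 2 * r))
  refine monic_eq_prod_of_roots ((h.monic.pow 2).sub_of_left hlt) _ _ ?_ ?_ ?_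
  · simpa using h.anti.injOn
  · intro k hk
    simp only [eval_sub, eval_pow, h.val k hk, eval_C, mul_pow, ← pow_mul]
    rw [mul_comm (k / 2), pow_mul]
    simp
  · rw [natDegree_sub_C, hd]
    simp

end IsBranchSeq

end SeibergWitten

namespace SeibergWitten

/-! ### Integrability of the reciprocal square root -/

/-- Two reciprocal square roots with different centres are never large at the same point, which
reduces the integrability of their product to that of a single one. -/
theorem inv_sqrt_mul_inv_sqrt_le {a b : ℝ} (hab : a ≠ b) (x : ℝ) :
    (√|x - a|)⁻¹ * (√|x - b|)⁻¹ ≤ (√(|a - b| / 2))⁻¹ * ((√|x - a|)⁻¹ + (√|x - b|)⁻¹) := by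
  have hpos : 0 < |a - b| / 2 := by have := abs_pos.mpr (sub_ne_zero.mpr hab); positivity
  have h3 : |a - b| ≤ |x - a| + |x - b| := by
    have := abs_sub_le a x b
    rwa [abs_sub_comm a x] at this
  have key : ∀ y z : ℝ, |a - b| / 2 ≤ y → y⁻¹.sqrt * (√z)⁻¹ ≤ (√(|a - b| / 2))⁻¹ * (√z)⁻¹ := by
    intro y z hy
    rw [Real.sqrt_inv]
    gcongr
  rcases le_total (|x - a|) (|x - b|) with h | h
  · have := key |x - b| |x - a| (by linarith)
    rw [Real.sqrt_inv] at this
    have h2 : 0 ≤ (√(|a - b| / 2))⁻¹ * (√|x - b|)⁻¹ := by positivity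
    linarith
  · have := key |x - a| |x - b| (by linarith)
    rw [Real.sqrt_inv] at this
    have h2 : 0 ≤ (√(|a - b| / 2))⁻¹ * (√|x - a|)⁻¹ := by positivity
    linarith

/-- A product of reciprocal square roots with distinct singularities is dominated by their sum. -/
theorem exists_prod_inv_sqrt_le (s : ℕ → ℝ) (S : Finset ℕ) (hs : Set.InjOn s S) :
    ∃ C : ℝ, 0 ≤ C ∧ ∀ x : ℝ,
      ∏ k ∈ S, (√|x - s k|)⁻¹ ≤ C * (1 + ∑ k ∈ S, (√|x - s k|)⁻¹) := by
  induction S using Finset.induction_on with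
  | empty => exact ⟨1, zero_le_one, fun x => by simp⟩
  | insert a S ha ih =>
    obtain ⟨C, hC, hle⟩ := ih (hs.mono (by simp))
    have hne : ∀ k ∈ S, s a ≠ s k := fun k hk h => by
      have := hs (by simp) (by simp [hk]) h
      exact ha (this ▸ hk)
    let D : ℕ → ℝ := fun k => (√(|s a - s k| / 2))⁻¹
    have hD : ∀ k, 0 ≤ D k := fun k => by positivity
    have hDs : ∀ k ∈ S, D k ≤ ∑ j ∈ S, D j := fun k hk =>
      Finset.single_le_sum (fun j _ => hD j) hk
    have hDn : 0 ≤ ∑ j ∈ S, D j := Finset.sum_nonneg fun j _ => hD j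
    refine ⟨C * (1 + ∑ k ∈ S, D k + S.card * ∑ k ∈ S, D k), by positivity, fun x => ?_⟩
    rw [Finset.prod_insert ha, Finset.sum_insert ha]
    set A := (√|x - s a|)⁻¹
    have hA : 0 ≤ A := by positivity
    set B := ∑ k ∈ S, (√|x - s k|)⁻¹ with hB
    have hBn : 0 ≤ B := Finset.sum_nonneg fun j _ => by positivity
    have h1 : A * B ≤ S.card * (∑ k ∈ S, D k) * A + (∑ k ∈ S, D k) * B := by
      have h2 : ∀ k ∈ S, A * (√|x - s k|)⁻¹ ≤ (∑ k ∈ S, D k) * A + (∑ k ∈ S, D k) *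
          (√|x - s k|)⁻¹ := fun k hk => by
        refine (inv_sqrt_mul_inv_sqrt_le (hne k hk) x).trans ?_
        rw [← mul_add]
        exact mul_le_mul_of_nonneg_right (hDs k hk) (by positivity)
      calc A * B = ∑ k ∈ S, A * (√|x - s k|)⁻¹ := by rw [hB, Finset.mul_sum]
        _ ≤ _ := Finset.sum_le_sum h2
        _ = _ := by
          rw [Finset.sum_add_distrib, Finset.sum_const, nsmul_eq_mul, hB,
            ← Finset.mul_sum S (fun k => (√|x - s k|)⁻¹) (∑ k ∈ S, D k)]
          ring
    calc A * ∏ k ∈ S, (√|x - s k|)⁻¹ ≤ A * (C * (1 + B)) := by gcongr; exact hle x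
      _ = C * (A + A * B) := by ring
      _ ≤ C * (A + (S.card * (∑ k ∈ S, D k) * A + (∑ k ∈ S, D k) * B)) := by gcongr
      _ ≤ _ := by
        rw [mul_assoc C]
        refine mul_le_mul_of_nonneg_left ?_ hC
        have : 0 ≤ (S.card : ℝ) * ∑ k ∈ S, D k := by positivity
        nlinarith [mul_nonneg hDn hA, mul_nonneg this hBn, mul_nonneg hDn hBn]

theorem intervalIntegrable_inv_sqrt_abs (c a b : ℝ) :
    IntervalIntegrable (fun x : ℝ => (√|x - c|)⁻¹) MeasureTheory.volume a b := by
  have h : IntervalIntegrable (fun x : ℝ => (x : ℂ) ^ (-(2⁻¹ : ℂ))) MeasureTheory.volume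
      (a - c) (b - c) := intervalIntegral.intervalIntegrable_cpow' (by norm_num)
  have h2 := (h.comp_sub_right c).norm
  simp only [sub_add_cancel] at h2
  refine h2.congr fun x _ => ?_
  simp only [Complex.cpow_neg, norm_inv]
  rw [← Complex.sqrt, norm_csqrt, Complex.norm_real, Real.norm_eq_abs]

theorem intervalIntegrable_inv_norm_rootProd {s : ℕ → ℝ} {n : ℕ} (hs : Set.InjOn s (Set.Icc 1 n))
    (a b : ℝ) :
    IntervalIntegrable (fun x : ℝ => ‖rootProd s n x‖⁻¹) MeasureTheory.volume a b := by
  obtain ⟨C, hC, hle⟩ := exists_prod_inv_sqrt_le s (Finset.Icc 1 n) (by simpa using hs)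
  have hn : ∀ x : ℝ, ‖rootProd s n x‖⁻¹ = ∏ k ∈ Finset.Icc 1 n, (√|x - s k|)⁻¹ := fun x => by
    rw [norm_rootProd, Finset.prod_inv_distrib]
    congr 1
    refine Finset.prod_congr rfl fun k _ => ?_
    rw [← Complex.ofReal_sub, Complex.norm_real, Real.norm_eq_abs]
  have hm : Measurable fun x : ℝ => ‖rootProd s n x‖⁻¹ := by
    simp only [hn]
    fun_prop
  have hdom : IntervalIntegrable (fun x : ℝ => C * (1 + ∑ k ∈ Finset.Icc 1 n, (√|x - s k|)⁻¹))
      MeasureTheory.volume a b := by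
    refine IntervalIntegrable.const_mul (IntervalIntegrable.add intervalIntegrable_const ?_) C
    have := IntervalIntegrable.sum (Finset.Icc 1 n) fun k _ =>
      intervalIntegrable_inv_sqrt_abs (s k) a b
    rwa [Finset.sum_fn] at this
  refine hdom.mono_fun hm.aestronglyMeasurable (.of_forall fun x => ?_)
  beta_reduce
  rw [norm_inv, norm_norm, hn]
  exact (hle x).trans (le_abs_self _)

/-! ### Holomorphic functions on the half-plane with boundary values -/

/-- A holomorphic function on the upper half-plane, given with its boundary values on the real axis:
near the real points `s 1, …, s n` it may blow up like a reciprocal square root, and at every other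
real point it has a limit from above. -/
structure HasBoundaryValues (s : ℕ → ℝ) (n : ℕ) (φ : ℂ → ℂ) : Prop where
  diff : DifferentiableOn ℂ φ {z | 0 < z.im}
  bound : ∀ M : ℝ, ∃ C : ℝ, ∀ z : ℂ, 0 < z.im → ‖z‖ ≤ M → ‖φ z‖ ≤ C * ‖rootProd s n z‖⁻¹
  radial : ∀ x : ℝ, rootProd s n x ≠ 0 →
    Tendsto (fun δ : ℝ => φ ((x : ℂ) + δ * Complex.I)) (𝓝[>] 0) (𝓝 (φ x))

/-- The integral over the upper half of a circle, run counterclockwise. -/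
noncomputable def semicircleIntegral (c ρ : ℝ) (φ : ℂ → ℂ) : ℂ :=
  ∫ θ in (0 : ℝ)..Real.pi, circleMap 0 ρ θ * Complex.I * φ (circleMap c ρ θ)

theorem isOpen_upperHalf : IsOpen {z : ℂ | 0 < z.im} :=
  isOpen_lt continuous_const Complex.continuous_im

theorem convex_upperHalf : Convex ℝ {z : ℂ | 0 < z.im} := convex_halfSpace_im_gt 0

theorem exists_primitive_upperHalf {φ : ℂ → ℂ} (h : DifferentiableOn ℂ φ {z | 0 < z.im}) :
    ∃ Ψ : ℂ → ℂ, ∀ z : ℂ, 0 < z.im → HasDerivAt Ψ (φ z) z := by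
  obtain ⟨g, hg⟩ := convex_upperHalf.exists_forall_hasDerivWithinAt h
  exact ⟨g, fun z hz => (hg z hz).hasDerivAt (isOpen_upperHalf.mem_nhds hz)⟩

theorem circleMap_im (c ρ θ : ℝ) : (circleMap c ρ θ).im = ρ * Real.sin θ := by
  simp [circleMap, Complex.exp_ofReal_mul_I_im]

theorem circleMap_re (c ρ θ : ℝ) : (circleMap c ρ θ).re = c + ρ * Real.cos θ := by
  simp [circleMap, Complex.exp_ofReal_mul_I_re]

theorem circleMap_im_nonneg {c ρ θ : ℝ} (hρ : 0 < ρ) (hθ : θ ∈ Set.Icc 0 Real.pi) :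
    0 ≤ (circleMap c ρ θ).im := by
  rw [circleMap_im]
  exact mul_nonneg hρ.le (Real.sin_nonneg_of_mem_Icc hθ)

theorem circleMap_im_pos {c ρ θ : ℝ} (hρ : 0 < ρ) (hθ : θ ∈ Set.Ioo 0 Real.pi) :
    0 < (circleMap c ρ θ).im := by
  rw [circleMap_im]
  exact mul_pos hρ (Real.sin_pos_of_mem_Ioo hθ)

theorem tendsto_add_mul_I (z : ℂ) :
    Tendsto (fun δ : ℝ => z + δ * Complex.I) (𝓝[>] 0) (𝓝 z) := by
  have : ContinuousAt (fun δ : ℝ => z + δ * Complex.I) 0 := by fun_prop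
  simpa using this.tendsto.mono_left (nhdsWithin_le_nhds (s := Set.Ioi 0))

/-- The fundamental theorem of calculus along a semicircle whose ends lie on the real axis, for a
primitive that is only known to have limits from above there. -/
theorem semicircleIntegral_eq_sub {c ρ : ℝ} (hρ : 0 < ρ) {φ Ψ : ℂ → ℂ} {A B : ℂ} {C : ℝ}
    (hφ : ContinuousOn φ {z | 0 < z.im})
    (hΨ : ∀ z : ℂ, 0 < z.im → HasDerivAt Ψ (φ z) z)
    (hbd : ∀ θ ∈ Set.Icc 0 Real.pi, ∀ δ ∈ Set.Ioo (0 : ℝ) 1,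
      ‖φ (circleMap c ρ θ + δ * Complex.I)‖ ≤ C)
    (hA : Tendsto (fun δ : ℝ => Ψ (((c - ρ : ℝ) : ℂ) + δ * Complex.I)) (𝓝[>] 0) (𝓝 A))
    (hB : Tendsto (fun δ : ℝ => Ψ (((c + ρ : ℝ) : ℂ) + δ * Complex.I)) (𝓝[>] 0) (𝓝 B)) :
    semicircleIntegral c ρ φ = A - B := by
  -- Push the contour up by `δ` into the open half-plane and let `δ` tend to zero.
  let f : ℝ → ℝ → ℂ := fun δ θ =>
    circleMap 0 ρ θ * Complex.I * φ (circleMap c ρ θ + δ * Complex.I)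
  have him : ∀ δ : ℝ, 0 < δ → ∀ θ ∈ Set.Icc 0 Real.pi,
      0 < (circleMap c ρ θ + δ * Complex.I).im := by
    intro δ hδ θ hθ
    have := circleMap_im_nonneg (c := c) hρ hθ
    simp only [Complex.add_im, Complex.mul_im, Complex.ofReal_re, Complex.I_im, Complex.ofReal_im,
      Complex.I_re]
    linarith
  have hpi : Set.uIcc 0 Real.pi = Set.Icc 0 Real.pi := Set.uIcc_of_le Real.pi_pos.le
  have hcont : ∀ δ : ℝ, 0 < δ → ContinuousOn (f δ) (Set.uIcc 0 Real.pi) := by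
    intro δ hδ
    rw [hpi]
    refine ContinuousOn.mul (by fun_prop) (hφ.comp (by fun_prop) fun θ hθ => him δ hδ θ hθ)
  have hftc : ∀ δ : ℝ, 0 < δ → ∫ θ in (0 : ℝ)..Real.pi, f δ θ =
      Ψ (((c - ρ : ℝ) : ℂ) + δ * Complex.I) - Ψ (((c + ρ : ℝ) : ℂ) + δ * Complex.I) := by
    intro δ hδ
    have h := intervalIntegral.integral_eq_sub_of_hasDerivAt
      (f := fun θ : ℝ => Ψ (circleMap c ρ θ + δ * Complex.I)) (f' := f δ) (a := 0) (b := Real.pi)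
      (fun θ hθ => ?_) (hcont δ hδ).intervalIntegrable
    · rw [h]
      simp [circleMap, sub_eq_add_neg]
    · rw [hpi] at hθ
      have h1 : HasDerivAt (fun θ : ℝ => circleMap c ρ θ + δ * Complex.I)
          (circleMap 0 ρ θ * Complex.I) θ := (hasDerivAt_circleMap c ρ θ).add_const _
      have := HasDerivAt.scomp (h := fun θ : ℝ => circleMap c ρ θ + δ * Complex.I) θ
        (hΨ _ (him δ hδ θ hθ)) h1
      simpa [f, Function.comp_def, mul_comm] using this
  have hlim : Tendsto (fun δ : ℝ => ∫ θ in (0 : ℝ)..Real.pi, f δ θ) (𝓝[>] 0)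
      (𝓝 (semicircleIntegral c ρ φ)) := by
    refine intervalIntegral.tendsto_integral_filter_of_dominated_convergence
      (fun _ => |ρ| * C) ?_ ?_ intervalIntegrable_const ?_
    · filter_upwards [self_mem_nhdsWithin] with δ hδ
      rw [Set.uIoc_of_le Real.pi_pos.le]
      exact (hcont δ hδ).intervalIntegrable.aestronglyMeasurable
    · filter_upwards [Ioo_mem_nhdsGT (zero_lt_one' ℝ)] with δ hδ
      refine .of_forall fun θ hθ => ?_
      rw [Set.uIoc_of_le Real.pi_pos.le] at hθ
      simp only [f, norm_mul, norm_circleMap_zero, Complex.norm_I, mul_one]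
      exact mul_le_mul_of_nonneg_left (hbd θ ⟨hθ.1.le, hθ.2⟩ δ hδ) (abs_nonneg _)
    · have hne : ∀ᵐ θ : ℝ, θ ≠ Real.pi := MeasureTheory.Measure.ae_ne _ _
      filter_upwards [hne] with θ hne hθ
      rw [Set.uIoc_of_le Real.pi_pos.le] at hθ
      have hp := circleMap_im_pos (c := c) hρ ⟨hθ.1, lt_of_le_of_ne hθ.2 hne⟩
      exact (((hφ.continuousAt (isOpen_upperHalf.mem_nhds hp)).tendsto).comp
        (tendsto_add_mul_I _)).const_mul _
  refine tendsto_nhds_unique hlim ((hA.sub hB).congr' ?_)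
  filter_upwards [self_mem_nhdsWithin] with δ hδ
  exact (hftc δ hδ).symm

theorem abs_le_max_abs_of_mem_uIoc {a b x : ℝ} (h : x ∈ Set.uIoc a b) : |x| ≤ max |a| |b| := by
  rcases Set.mem_uIoc.mp h with h | h
  · exact abs_le_max_abs_abs h.1.le h.2
  · rw [max_comm]
    exact abs_le_max_abs_abs h.1.le h.2

namespace HasBoundaryValues

variable {s : ℕ → ℝ} {n : ℕ} {φ : ℂ → ℂ}

theorem ae_rootProd_ne_zero (s : ℕ → ℝ) (n : ℕ) :
    ∀ᵐ x : ℝ, rootProd s n x ≠ 0 := by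
  have : {x : ℝ | ¬ rootProd s n x ≠ 0} ⊆ ((Finset.Icc 1 n).image s : Set ℝ) := by
    intro x hx
    simp only [rootProd_ne_zero_iff, not_forall, not_not, Set.mem_ofPred_eq] at hx
    obtain ⟨k, hk, h⟩ := hx
    exact Finset.mem_coe.mpr (Finset.mem_image.mpr ⟨k, hk, by exact_mod_cast h.symm⟩)
  exact MeasureTheory.measure_mono_null this (Finset.measure_zero _ _)

theorem bound_re (h : HasBoundaryValues s n φ) (M M' : ℝ) :
    ∃ C : ℝ, 0 ≤ C ∧ ∀ x δ : ℝ, |x| ≤ M → 0 < δ → δ ≤ M' → rootProd s n x ≠ 0 →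
      ‖φ (x + δ * Complex.I)‖ ≤ C * ‖rootProd s n x‖⁻¹ := by
  obtain ⟨C, hC⟩ := h.bound (M + M')
  refine ⟨|C|, abs_nonneg _, fun x δ hx hδ hδ' hY => ?_⟩
  have hn : ‖(x : ℂ) + δ * Complex.I‖ ≤ M + M' := by
    refine (norm_add_le _ _).trans ?_
    simp only [Complex.norm_real, Real.norm_eq_abs, norm_mul, Complex.norm_I, mul_one]
    rw [abs_of_pos hδ]
    exact add_le_add hx hδ'
  have hle : ‖rootProd s n x‖ ≤ ‖rootProd s n ((x : ℂ) + δ * Complex.I)‖ :=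
    norm_rootProd_le_of_re_eq s n (by simp) (by simp)
  refine (hC _ (by simpa using hδ) hn).trans ?_
  have := norm_pos_iff.mpr hY
  gcongr
  exact le_abs_self C

theorem norm_boundary_le (h : HasBoundaryValues s n φ) (M : ℝ) :
    ∃ C : ℝ, ∀ x : ℝ, |x| ≤ M → rootProd s n x ≠ 0 → ‖φ x‖ ≤ C * ‖rootProd s n x‖⁻¹ := by
  obtain ⟨C, -, hC⟩ := h.bound_re M 1
  refine ⟨C, fun x hx hY => le_of_tendsto (h.radial x hY).norm ?_⟩
  filter_upwards [Ioo_mem_nhdsGT (zero_lt_one' ℝ)] with δ hδ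
  exact hC x δ hx hδ.1 hδ.2.le hY

theorem continuous_horizontal (h : HasBoundaryValues s n φ) {δ : ℝ} (hδ : 0 < δ) :
    Continuous fun x : ℝ => φ (x + δ * Complex.I) := by
  rw [← continuousOn_univ]
  exact h.diff.continuousOn.comp (by fun_prop) fun x _ => by simpa using hδ

theorem aestronglyMeasurable (h : HasBoundaryValues s n φ) :
    MeasureTheory.AEStronglyMeasurable (fun x : ℝ => φ x) MeasureTheory.volume := by
  refine aestronglyMeasurable_of_tendsto_ae (u := 𝓝[>] (0 : ℝ))
    (f := fun (δ : ℝ) (x : ℝ) => if 0 < δ then φ ((x : ℂ) + δ * Complex.I) else 0) ?_ ?_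
  · intro δ
    by_cases hδ : 0 < δ
    · simpa [hδ] using (h.continuous_horizontal hδ).aestronglyMeasurable
    · simpa [hδ] using MeasureTheory.aestronglyMeasurable_const
  · filter_upwards [ae_rootProd_ne_zero s n] with x hx
    refine (h.radial x hx).congr' ?_
    filter_upwards [self_mem_nhdsWithin] with δ hδ
    exact (if_pos (Set.mem_Ioi.mp hδ)).symm

theorem intervalIntegrable (h : HasBoundaryValues s n φ) (hs : Set.InjOn s (Set.Icc 1 n))
    (a b : ℝ) : IntervalIntegrable (fun x : ℝ => φ x) MeasureTheory.volume a b := by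
  obtain ⟨C, hC⟩ := h.norm_boundary_le (max |a| |b|)
  refine ((intervalIntegrable_inv_norm_rootProd hs a b).const_mul C).mono_fun'
    h.aestronglyMeasurable.restrict ?_
  rw [Filter.EventuallyLE, MeasureTheory.ae_restrict_iff' measurableSet_uIoc]
  filter_upwards [ae_rootProd_ne_zero s n] with x hx hmem
  exact hC x (abs_le_max_abs_of_mem_uIoc hmem) hx

/-- Horizontal integrals converge to the integral of the boundary values. -/
theorem tendsto_horizontal (h : HasBoundaryValues s n φ) (hs : Set.InjOn s (Set.Icc 1 n))
    (a b : ℝ) :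
    Tendsto (fun δ : ℝ => ∫ x in a..b, φ (x + δ * Complex.I)) (𝓝[>] 0)
      (𝓝 (∫ x in a..b, φ (x : ℂ))) := by
  obtain ⟨C, -, hC⟩ := h.bound_re (max |a| |b|) 1
  refine intervalIntegral.tendsto_integral_filter_of_dominated_convergence
      (fun x => C * ‖rootProd s n x‖⁻¹) ?_ ?_
      ((intervalIntegrable_inv_norm_rootProd hs a b).const_mul C) ?_
  · filter_upwards [self_mem_nhdsWithin] with δ hδ
    exact (h.continuous_horizontal hδ).aestronglyMeasurable
  · filter_upwards [Ioo_mem_nhdsGT (zero_lt_one' ℝ)] with δ hδ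
    filter_upwards [ae_rootProd_ne_zero s n] with x hx hmem
    exact hC x δ (abs_le_max_abs_of_mem_uIoc hmem) hδ.1 hδ.2.le hx
  · filter_upwards [ae_rootProd_ne_zero s n] with x hx _
    exact h.radial x hx

theorem integral_horizontal {Ψ : ℂ → ℂ} (h : HasBoundaryValues s n φ)
    (hΨ : ∀ z : ℂ, 0 < z.im → HasDerivAt Ψ (φ z) z) {δ : ℝ} (hδ : 0 < δ) (a b : ℝ) :
    ∫ x in a..b, φ (x + δ * Complex.I) = Ψ (b + δ * Complex.I) - Ψ (a + δ * Complex.I) := by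
  refine intervalIntegral.integral_eq_sub_of_hasDerivAt
    (f := fun x : ℝ => Ψ (x + δ * Complex.I)) (fun x _ => ?_)
    (h.continuous_horizontal hδ).continuousOn.intervalIntegrable
  have h1 : HasDerivAt (fun x : ℝ => (x : ℂ) + δ * Complex.I) 1 x :=
    (Complex.ofRealCLM.hasDerivAt (x := x)).add_const _
  have := HasDerivAt.scomp (h := fun x : ℝ => (x : ℂ) + δ * Complex.I) x
    (hΨ (x + δ * Complex.I) (by simpa using hδ)) h1
  simpa [Function.comp_def] using this

theorem hasDerivAt_vertical {Ψ : ℂ → ℂ} (hΨ : ∀ z : ℂ, 0 < z.im → HasDerivAt Ψ (φ z) z) (x : ℝ)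
    {δ : ℝ} (hδ : 0 < δ) :
    HasDerivAt (fun δ : ℝ => Ψ (x + δ * Complex.I)) (Complex.I * φ (x + δ * Complex.I)) δ := by
  have h1 : HasDerivAt (fun δ : ℝ => (x : ℂ) + δ * Complex.I) Complex.I δ := by
    simpa using ((Complex.ofRealCLM.hasDerivAt (x := δ)).mul_const Complex.I).const_add (x : ℂ)
  have := HasDerivAt.scomp (h := fun δ : ℝ => (x : ℂ) + δ * Complex.I) δ
    (hΨ (x + δ * Complex.I) (by simpa using hδ)) h1
  simpa [Function.comp_def] using this

theorem exists_tendsto_primitive {Ψ : ℂ → ℂ} (h : HasBoundaryValues s n φ)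
    (hΨ : ∀ z : ℂ, 0 < z.im → HasDerivAt Ψ (φ z) z) {x : ℝ} (hx : rootProd s n x ≠ 0) :
    ∃ A : ℂ, Tendsto (fun δ : ℝ => Ψ (x + δ * Complex.I)) (𝓝[>] 0) (𝓝 A) := by
  obtain ⟨C, -, hC⟩ := h.bound_re |x| 1
  have hlip : LipschitzOnWith (Real.toNNReal (C * ‖rootProd s n x‖⁻¹))
      (fun δ : ℝ => Ψ (x + δ * Complex.I)) (Set.Ioo 0 1) := by
    refine (convex_Ioo 0 1).lipschitzOnWith_of_nnnorm_hasDerivWithin_le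
      (fun δ hδ => (hasDerivAt_vertical hΨ x hδ.1).hasDerivWithinAt) fun δ hδ => ?_
    rw [← NNReal.coe_le_coe, coe_nnnorm, norm_mul, Complex.norm_I, one_mul]
    exact (hC x δ le_rfl hδ.1 hδ.2.le hx).trans (Real.le_coe_toNNReal _)
  have hc : Cauchy (map (fun δ : ℝ => Ψ (x + δ * Complex.I)) (𝓝[>] 0)) := by
    have hle : 𝓝[>] (0 : ℝ) ≤ 𝓟 (Set.Ioo 0 1) :=
      le_principal_iff.mpr (Ioo_mem_nhdsGT (zero_lt_one' ℝ))
    exact (cauchy_nhds.mono nhdsWithin_le_nhds).map_of_le hlip.uniformContinuousOn hle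
  exact cauchy_map_iff_exists_tendsto.mp hc

/-- A function with boundary values has a primitive with boundary values; the primitive is bounded
on bounded sets, and on the boundary it is a primitive as well. -/
theorem exists_primitive (h : HasBoundaryValues s n φ) (hs : Set.InjOn s (Set.Icc 1 n)) :
    ∃ Φ : ℂ → ℂ, (∀ z : ℂ, 0 < z.im → HasDerivAt Φ (φ z) z) ∧
      (∀ x : ℝ, rootProd s n x ≠ 0 →
        Tendsto (fun δ : ℝ => Φ ((x : ℂ) + δ * Complex.I)) (𝓝[>] 0) (𝓝 (Φ x))) ∧
      ∀ x y : ℝ, rootProd s n x ≠ 0 → rootProd s n y ≠ 0 →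
        ∫ t in x..y, φ (t : ℂ) = Φ y - Φ x := by
  obtain ⟨Ψ, hΨ⟩ := exists_primitive_upperHalf h.diff
  choose! A hA using fun (x : ℝ) => h.exists_tendsto_primitive hΨ (x := x)
  let Φ : ℂ → ℂ := fun z => if 0 < z.im then Ψ z else A z.re
  have hΦ : ∀ z : ℂ, 0 < z.im → Φ z = Ψ z := fun z hz => if_pos hz
  have hΦr : ∀ x : ℝ, Φ x = A x := fun x => by simp [Φ]
  refine ⟨Φ, fun z hz => (hΨ z hz).congr_of_eventuallyEq ?_, fun x hx => ?_, fun x y hx hy => ?_⟩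
  · filter_upwards [isOpen_upperHalf.mem_nhds hz] with w hw using hΦ w hw
  · rw [hΦr]
    refine (hA x hx).congr' ?_
    filter_upwards [self_mem_nhdsWithin] with δ hδ
    rw [hΦ _ (by simpa using hδ)]
  · rw [hΦr, hΦr]
    refine tendsto_nhds_unique (h.tendsto_horizontal hs x y) (((hA y hy).sub (hA x hx)).congr' ?_)
    filter_upwards [self_mem_nhdsWithin] with δ hδ
    exact (h.integral_horizontal hΨ hδ x y).symm

/-- A primitive is bounded on bounded sets because the singularities are integrable. -/
theorem exists_norm_primitive_le {Φ : ℂ → ℂ} (h : HasBoundaryValues s n φ)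
    (hs : Set.InjOn s (Set.Icc 1 n)) (hΦ : ∀ z : ℂ, 0 < z.im → HasDerivAt Φ (φ z) z) (M : ℝ) :
    ∃ C : ℝ, 0 ≤ C ∧ ∀ z : ℂ, 0 < z.im → ‖z‖ ≤ M → ‖Φ z‖ ≤ C := by
  rcases le_or_gt M 0 with hM | hM
  · refine ⟨0, le_rfl, fun z hz hzM => ?_⟩
    have := norm_le_zero_iff.mp (hzM.trans hM)
    simp [this] at hz
  obtain ⟨x₀, hx₀⟩ := (ae_rootProd_ne_zero s n).exists
  obtain ⟨C₁, hC₁, h₁⟩ := h.bound_re |x₀| M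
  obtain ⟨C₂, hC₂, h₂⟩ := h.bound_re (max |x₀| M) M
  let I₀ := ∫ t in (-(max |x₀| M))..(max |x₀| M), C₂ * ‖rootProd s n t‖⁻¹
  have hvert : ∀ δ : ℝ, 0 < δ → δ ≤ M →
      ‖Φ (x₀ + δ * Complex.I)‖ ≤ ‖Φ (x₀ + M * Complex.I)‖ + C₁ * ‖rootProd s n x₀‖⁻¹ * M := by
    intro δ hδ hδM
    have := (convex_Ioc 0 M).norm_image_sub_le_of_norm_hasDerivWithin_le
      (f := fun δ : ℝ => Φ (x₀ + δ * Complex.I)) (C := C₁ * ‖rootProd s n x₀‖⁻¹)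
      (fun t ht => (hasDerivAt_vertical hΦ x₀ ht.1).hasDerivWithinAt)
      (fun t ht => by
        rw [norm_mul, Complex.norm_I, one_mul]
        exact h₁ x₀ t le_rfl ht.1 ht.2 hx₀) (x := M) (y := δ) ⟨hM, le_rfl⟩ ⟨hδ, hδM⟩
    have h3 : ‖δ - M‖ ≤ M := by rw [Real.norm_eq_abs, abs_le]; constructor <;> linarith
    have h4 : ‖Φ (x₀ + δ * Complex.I)‖ ≤ ‖Φ (x₀ + M * Complex.I)‖ +
        ‖Φ (x₀ + δ * Complex.I) - Φ (x₀ + M * Complex.I)‖ := norm_le_insert' _ _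
    refine h4.trans (add_le_add le_rfl (this.trans ?_))
    gcongr
  refine ⟨‖Φ (x₀ + M * Complex.I)‖ + C₁ * ‖rootProd s n x₀‖⁻¹ * M + I₀, ?_, fun z hz hzM => ?_⟩
  · have : 0 ≤ I₀ := intervalIntegral.integral_nonneg
      (by have := le_max_right |x₀| M; linarith) fun t _ => by positivity
    positivity
  have him : z.im ≤ M := (le_abs_self _).trans ((Complex.abs_im_le_norm z).trans hzM)
  have hre : |z.re| ≤ M := (Complex.abs_re_le_norm z).trans hzM
  have hz' : Φ z = Φ (x₀ + z.im * Complex.I) + ∫ t in x₀..z.re, φ (t + z.im * Complex.I) := by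
    rw [h.integral_horizontal hΦ hz, Complex.re_add_im]
    ring
  rw [hz']
  refine (norm_add_le _ _).trans (add_le_add (hvert _ hz him) ?_)
  have hsub : Set.uIoc x₀ z.re ⊆ Set.uIoc (-(max |x₀| M)) (max |x₀| M) := by
    rw [Set.uIoc_of_le (a := -(max |x₀| M)) (by have := le_max_right |x₀| M; linarith)]
    intro t ht
    have a1 := le_max_left |x₀| M
    have a2 := hre.trans (le_max_right |x₀| M)
    have b1 := abs_le.mp a1
    have b2 := abs_le.mp a2
    rcases Set.mem_uIoc.mp ht with ht | ht
    · exact ⟨by linarith, by linarith⟩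
    · exact ⟨by linarith, by linarith⟩
  rw [intervalIntegral.norm_intervalIntegral_eq]
  refine (MeasureTheory.norm_integral_le_of_norm_le (μ := MeasureTheory.volume.restrict _)
    ((intervalIntegrable_inv_norm_rootProd hs x₀ z.re).const_mul C₂).def' ?_).trans ?_
  · rw [MeasureTheory.ae_restrict_iff' measurableSet_uIoc]
    filter_upwards [ae_rootProd_ne_zero s n] with t ht hmem
    refine h₂ t _ ((abs_le_max_abs_of_mem_uIoc hmem).trans ?_) hz him ht
    exact max_le_max le_rfl hre
  · have hle : -(max |x₀| M) ≤ max |x₀| M := by have := le_max_right |x₀| M; linarith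
    simp only [I₀]
    rw [intervalIntegral.integral_of_le hle, ← Set.uIoc_of_le hle]
    refine MeasureTheory.setIntegral_mono_set ?_ ?_ (hsub.eventuallyLE)
    · exact ((intervalIntegrable_inv_norm_rootProd hs _ _).const_mul C₂).def'
    · exact .of_forall fun t => by simp only [Pi.zero_apply]; positivity

/-- A primitive is locally bounded up to the real axis, so the product with it is no more singular
than `ψ`. -/
theorem mul_primitive {Φ ψ : ℂ → ℂ} (h : HasBoundaryValues s n φ) (hψ : HasBoundaryValues s n ψ)
    (hs : Set.InjOn s (Set.Icc 1 n)) (hΦ : ∀ z : ℂ, 0 < z.im → HasDerivAt Φ (φ z) z)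
    (hr : ∀ x : ℝ, rootProd s n x ≠ 0 →
        Tendsto (fun δ : ℝ => Φ ((x : ℂ) + δ * Complex.I)) (𝓝[>] 0) (𝓝 (Φ x))) :
    HasBoundaryValues s n fun z => Φ z * ψ z where
  diff := DifferentiableOn.mul (fun z hz => (hΦ z hz).differentiableAt.differentiableWithinAt)
    hψ.diff
  bound M := by
    obtain ⟨C, hC0, hC⟩ := h.exists_norm_primitive_le hs hΦ M
    obtain ⟨D, hD⟩ := hψ.bound M
    refine ⟨C * D, fun z hz hzM => ?_⟩
    rw [norm_mul, mul_assoc]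
    exact mul_le_mul (hC z hz hzM) (hD z hz hzM) (norm_nonneg _) hC0
  radial x hx := (hr x hx).mul (hψ.radial x hx)

end HasBoundaryValues

/-- On a closed semicircle whose ends are not branch points, and above it, `rootProd` is bounded
away from zero. -/
theorem exists_le_norm_rootProd (s : ℕ → ℝ) (n : ℕ) {c ρ : ℝ} (hρ : 0 < ρ)
    (h₁ : rootProd s n ((c - ρ : ℝ) : ℂ) ≠ 0) (h₂ : rootProd s n ((c + ρ : ℝ) : ℂ) ≠ 0) :
    ∃ m : ℝ, 0 < m ∧ ∀ θ ∈ Set.Icc 0 Real.pi, ∀ δ : ℝ, 0 ≤ δ →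
      m ≤ ‖rootProd s n (circleMap c ρ θ + δ * Complex.I)‖ := by
  have hcont : ContinuousOn (fun θ : ℝ => ‖rootProd s n (circleMap c ρ θ)‖) (Set.Icc 0 Real.pi) := by
    simp only [norm_rootProd]
    fun_prop
  obtain ⟨θ₀, hθ₀, hmin⟩ := isCompact_Icc.exists_isMinOn ⟨0, by simp [Real.pi_pos.le]⟩ hcont
  have hne : rootProd s n (circleMap c ρ θ₀) ≠ 0 := by
    rcases eq_or_lt_of_le hθ₀.1 with h | h
    · rw [← h]
      simpa [circleMap] using h₂
    rcases eq_or_lt_of_le hθ₀.2 with h' | h'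
    · rw [h']
      simpa [circleMap, sub_eq_add_neg] using h₁
    exact rootProd_ne_zero_of_im_pos _ _ (circleMap_im_pos hρ ⟨h, h'⟩)
  refine ⟨_, norm_pos_iff.mpr hne, fun θ hθ δ hδ => (hmin hθ).trans ?_⟩
  have h0 := circleMap_im_nonneg (c := c) hρ hθ
  refine norm_rootProd_le_of_re_eq s n (by simp) ?_
  simp only [Complex.add_im, Complex.mul_im, Complex.ofReal_re, Complex.I_im, Complex.ofReal_im,
      Complex.I_re]
  rw [abs_of_nonneg h0, abs_of_nonneg (by linarith)]
  linarith

/-- Cauchy's theorem for a half-disc: a semicircular contour can be flattened onto the real axis. -/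
theorem HasBoundaryValues.semicircleIntegral_eq {s : ℕ → ℝ} {n : ℕ} {φ : ℂ → ℂ}
    (h : HasBoundaryValues s n φ) (hs : Set.InjOn s (Set.Icc 1 n)) {c ρ : ℝ} (hρ : 0 < ρ)
    (h₁ : rootProd s n ((c - ρ : ℝ) : ℂ) ≠ 0) (h₂ : rootProd s n ((c + ρ : ℝ) : ℂ) ≠ 0) :
    semicircleIntegral c ρ φ = -∫ x in (c - ρ)..(c + ρ), φ (x : ℂ) := by
  obtain ⟨Φ, hΦ, hr, hint⟩ := h.exists_primitive hs
  obtain ⟨m, hm, hmle⟩ := exists_le_norm_rootProd s n hρ h₁ h₂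
  obtain ⟨C, hC⟩ := h.bound (|c| + |ρ| + 1)
  rw [hint _ _ h₁ h₂, neg_sub]
  refine semicircleIntegral_eq_sub (C := |C| * m⁻¹) hρ h.diff.continuousOn hΦ (fun θ hθ δ hδ => ?_)
    (hr _ h₁) (hr _ h₂)
  have h0 := circleMap_im_nonneg (c := c) hρ hθ
  have hn : ‖circleMap c ρ θ + δ * Complex.I‖ ≤ |c| + |ρ| + 1 := by
    rw [circleMap]
    refine (norm_add_le _ _).trans (add_le_add ((norm_add_le _ _).trans ?_) ?_)
    · simp
    · simp [abs_of_pos hδ.1, hδ.2.le]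
  refine (hC _ (by simp; linarith [hδ.1]) hn).trans ?_
  have := hmle θ hθ δ hδ.1.le
  gcongr
  exact le_abs_self C

/-- The quotient of a real polynomial by the square root over the branch points. -/
noncomputable def polyQuot (s : ℕ → ℝ) (n : ℕ) (N : ℝ[X]) (z : ℂ) : ℂ :=
  aeval z N / rootProd s n z

theorem hasBoundaryValues_polyQuot (s : ℕ → ℝ) (n : ℕ) (N : ℝ[X]) :
    HasBoundaryValues s n (polyQuot s n N) where
  diff z hz := (N.differentiableAt_aeval.div (differentiableAt_rootProd s n hz)
    (rootProd_ne_zero_of_im_pos s n hz)).differentiableWithinAt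
  bound M := by
    obtain ⟨C, hC⟩ := (isCompact_closedBall (0 : ℂ) M).exists_bound_of_continuousOn
      (f := fun z : ℂ => aeval z N) (N.continuous_aeval.continuousOn)
    refine ⟨C, fun z _ hzM => ?_⟩
    rw [polyQuot, norm_div, div_eq_mul_inv]
    exact mul_le_mul_of_nonneg_right (hC z (by simpa using hzM)) (by positivity)
  radial x hx := ((N.continuous_aeval.tendsto _).comp (tendsto_add_mul_I _)).div
    (tendsto_rootProd_radial s n x) hx

end SeibergWitten

namespace SeibergWitten

/-! ### Integrals over the cells between consecutive branch points -/

/-- The real integrand `N / √|∏ (x - s k)|`. -/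
noncomputable def realQuot (s : ℕ → ℝ) (n : ℕ) (N : ℝ[X]) (x : ℝ) : ℝ :=
  N.eval x / √|∏ k ∈ Finset.Icc 1 n, (x - s k)|

/-- The integral of `N / √|∏ (x - s j)|` over the cell between `s (k + 1)` and `s k`. -/
noncomputable def cellIntegral (s : ℕ → ℝ) (n k : ℕ) (N : ℝ[X]) : ℝ :=
  ∫ x in (s (k + 1))..(s k), realQuot s n N x

theorem aeval_ofReal_eq (N : ℝ[X]) (x : ℝ) : aeval (x : ℂ) N = ((N.eval x : ℝ) : ℂ) := by
  rw [show (x : ℂ) = algebraMap ℝ ℂ x from rfl, aeval_algebraMap_apply]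
  simp

theorem polyQuot_ofReal (s : ℕ → ℝ) (n : ℕ) (N : ℝ[X]) (x : ℝ) :
    polyQuot s n N x = (-Complex.I) ^ countAbove s n x * (realQuot s n N x : ℝ) := by
  rw [polyQuot, rootProd_ofReal, aeval_ofReal_eq, realQuot, ← Complex.inv_I, inv_pow]
  push_cast
  rw [div_mul_eq_div_div, div_eq_mul_inv _ (Complex.I ^ _)]
  ring

theorem integral_congr_Ioo {E : Type*} [NormedAddCommGroup E] [NormedSpace ℝ E] {f g : ℝ → E}
    {a b : ℝ} (hab : a ≤ b) (h : ∀ x ∈ Set.Ioo a b, f x = g x) :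
    ∫ x in a..b, f x = ∫ x in a..b, g x := by
  refine intervalIntegral.integral_congr_ae ?_
  filter_upwards [MeasureTheory.Measure.ae_ne MeasureTheory.volume b] with x hx hmem
  rw [Set.uIoc_of_le hab] at hmem
  exact h x ⟨hmem.1, lt_of_le_of_ne hmem.2 hx⟩

theorem intervalIntegrable_realQuot {s : ℕ → ℝ} {n : ℕ} (hs : Set.InjOn s (Set.Icc 1 n))
    (N : ℝ[X]) (a b : ℝ) :
    IntervalIntegrable (realQuot s n N) MeasureTheory.volume a b := by
  have h := ((hasBoundaryValues_polyQuot s n N).intervalIntegrable hs a b).norm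
  refine h.mono_fun ?_ (.of_forall fun x => ?_)
  · have : Measurable (realQuot s n N) := by
      unfold realQuot
      exact N.continuous.measurable.div (by fun_prop)
    exact this.aestronglyMeasurable
  · simp [polyQuot_ofReal]

theorem integral_polyQuot_of_inCell {s : ℕ → ℝ} {n k : ℕ} (hs : StrictAntiOn s (Set.Icc 1 n))
    (N : ℝ[X]) {a b : ℝ} (hab : a ≤ b) (h : ∀ x ∈ Set.Ioo a b, InCell s n k x) :
    ∫ x in a..b, polyQuot s n N (x : ℂ) = (-Complex.I) ^ k * (∫ x in a..b, realQuot s n N x : ℝ) := by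
  rw [integral_congr_Ioo hab fun x hx => by
    rw [polyQuot_ofReal, (h x hx).countAbove_eq hs], intervalIntegral.integral_const_mul,
    intervalIntegral.integral_ofReal]

theorem inCell_of_mem_Ioo {s : ℕ → ℝ} {n k : ℕ} (hk : k ≤ n) {x : ℝ}
    (hx : x ∈ Set.Ioo (s (k + 1)) (s k)) : InCell s n k x :=
  ⟨hk, fun _ => hx.2, fun _ => hx.1⟩

/-- The component along `(-i) ^ k` of an integral from one neighbouring cell of the cell `k` to the
other is the integral over the cell `k`. -/
theorem re_I_pow_mul_integral {s : ℕ → ℝ} {n m : ℕ} (hs : StrictAntiOn s (Set.Icc 1 n))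
    (N : ℝ[X]) {x y : ℝ} (hx : InCell s n (m + 2) x) (hy : InCell s n m y) :
    (Complex.I ^ (m + 1) * ∫ t in x..y, polyQuot s n N (t : ℂ)).re =
      cellIntegral s n (m + 1) N := by
  have hn := hx.1
  have hi := fun a b => (hasBoundaryValues_polyQuot s n N).intervalIntegrable hs.injOn a b
  have h1 : x < s (m + 2) := hx.2.1 (by omega)
  have h2 : s (m + 2) < s (m + 1) := hs ⟨by omega, by omega⟩ ⟨by omega, by omega⟩ (by omega)
  have h3 : s (m + 1) < y := hy.2.2 (by omega)
  rw [← intervalIntegral.integral_add_adjacent_intervals (hi x (s (m + 1))) (hi _ y),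
    ← intervalIntegral.integral_add_adjacent_intervals (hi x (s (m + 2))) (hi _ (s (m + 1))),
    integral_polyQuot_of_inCell hs N h1.le fun t ht =>
      ⟨hn, fun _ => ht.2, fun h => (hx.2.2 h).trans ht.1⟩,
    integral_polyQuot_of_inCell hs N h2.le fun t ht => inCell_of_mem_Ioo (by omega) ht,
    integral_polyQuot_of_inCell hs N h3.le fun t ht =>
      ⟨by omega, fun h => ht.2.trans (hy.2.1 h), fun _ => ht.1⟩]
  have hI : ∀ j : ℕ, Complex.I ^ j * (-Complex.I) ^ j = 1 := fun j => by
    rw [← mul_pow]; simp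
  have e1 : Complex.I ^ (m + 1) * (-Complex.I) ^ (m + 2) = -Complex.I := by
    rw [pow_succ (-Complex.I), ← mul_assoc, hI, one_mul]
  have e2 : Complex.I ^ (m + 1) * (-Complex.I) ^ m = Complex.I := by
    rw [pow_succ, mul_right_comm, hI, one_mul]
  rw [mul_add, mul_add, ← mul_assoc, ← mul_assoc, ← mul_assoc, e1, e2, hI, cellIntegral]
  simp

/-- A cell integral as one component of an integral over a semicircle that keeps away from the branch
points; the components of the two neighbouring cells are orthogonal to it. -/
theorem re_I_pow_mul_semicircleIntegral {s : ℕ → ℝ} {n m : ℕ} (hs : StrictAntiOn s (Set.Icc 1 n))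
    (N : ℝ[X]) {c ρ : ℝ} (hρ : 0 < ρ) (hx : InCell s n (m + 2) (c - ρ))
    (hy : InCell s n m (c + ρ)) :
    (Complex.I ^ (m + 1) * semicircleIntegral c ρ (polyQuot s n N)).re =
      -cellIntegral s n (m + 1) N := by
  rw [(hasBoundaryValues_polyQuot s n N).semicircleIntegral_eq hs.injOn hρ
    (hx.rootProd_ne_zero hs) (hy.rootProd_ne_zero hs), mul_neg, Complex.neg_re,
    re_I_pow_mul_integral hs N hx hy]

/-! ### Behaviour at infinity -/

/-- The filter of points of the upper half-plane that tend to infinity. -/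
noncomputable def upperInfty : Filter ℂ := Bornology.cobounded ℂ ⊓ 𝓟 {z | 0 < z.im}

theorem eventually_im_pos : ∀ᶠ z in upperInfty, 0 < z.im :=
  mem_inf_of_right (mem_principal_self _)

theorem tendsto_inv_upperInfty : Tendsto (fun z : ℂ => z⁻¹) upperInfty (𝓝 0) :=
  (tendsto_inv₀_cobounded (α := ℂ)).mono_left inf_le_left

theorem eventually_ne_zero_upperInfty : ∀ᶠ z in upperInfty, z ≠ 0 :=
  eventually_im_pos.mono fun z hz h => by simp [h] at hz

theorem tendsto_aeval_div_pow (N : ℝ[X]) {m : ℕ} (hm : N.natDegree ≤ m) :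
    Tendsto (fun z : ℂ => aeval z N / z ^ m) upperInfty (𝓝 (N.coeff m : ℂ)) := by
  have h : Tendsto (fun z : ℂ => ∑ i ∈ Finset.range (m + 1), (N.coeff i : ℂ) * z⁻¹ ^ (m - i))
      upperInfty (𝓝 (∑ i ∈ Finset.range (m + 1), (N.coeff i : ℂ) * 0 ^ (m - i))) :=
    tendsto_finsetSum _ fun i _ => (tendsto_inv_upperInfty.pow _).const_mul _
  have h0 : ∑ i ∈ Finset.range (m + 1), (N.coeff i : ℂ) * 0 ^ (m - i) = N.coeff m := by
    rw [Finset.sum_range_succ, Finset.sum_eq_zero]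
    · simp
    · intro i hi
      rw [Finset.mem_range] at hi
      rw [zero_pow (by omega), mul_zero]
  rw [h0] at h
  refine h.congr' ?_
  filter_upwards [eventually_ne_zero_upperInfty] with z hz
  rw [aeval_eq_sum_range' (Nat.lt_succ_of_le hm), Finset.sum_div]
  refine Finset.sum_congr rfl fun i hi => ?_
  rw [Finset.mem_range] at hi
  rw [inv_pow, ← div_eq_mul_inv, Complex.real_smul, mul_div_assoc]
  rw [show m = (m - i) + i by omega, pow_add, Nat.add_sub_cancel]
  field_simp

theorem tendsto_csqrt_sub_div (a : ℝ) :
    Tendsto (fun z : ℂ => (z - a).sqrt / z.sqrt) upperInfty (𝓝 1) := by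
  rw [tendsto_iff_norm_sub_tendsto_zero]
  have h : Tendsto (fun z : ℂ => |a| * ‖z⁻¹‖) upperInfty (𝓝 0) := by
    simpa using tendsto_inv_upperInfty.norm.const_mul |a|
  refine squeeze_zero' (.of_forall fun _ => norm_nonneg _) ?_ h
  filter_upwards [eventually_im_pos, eventually_ne_zero_upperInfty] with z hz hz0
  have hs0 : z.sqrt ≠ 0 := by
    intro h; have := csqrt_sq z; rw [h] at this; exact hz0 (by simpa using this.symm)
  have hquad : ∀ w : ℂ, 0 ≤ w.im → 0 ≤ w.sqrt.im := fun w hw => by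
    rw [csqrt_of_im_nonneg hw]; simp; positivity
  -- Both roots lie in the first quadrant, so their sum is at least as long as either of them.
  have hle : ‖z.sqrt‖ ≤ ‖(z - a).sqrt + z.sqrt‖ := by
    rw [Complex.norm_eq_sqrt_sq_add_sq, Complex.norm_eq_sqrt_sq_add_sq]
    refine Real.sqrt_le_sqrt ?_
    have h1 := csqrt_re_nonneg z
    have h2 := csqrt_re_nonneg (z - a)
    have h3 := hquad z hz.le
    have h4 := hquad (z - a) (by simpa using hz.le)
    simp only [Complex.add_re, Complex.add_im]
    gcongr <;> linarith
  have hmul : ((z - a).sqrt - z.sqrt) * ((z - a).sqrt + z.sqrt) = -a := by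
    have := csqrt_sq z
    have := csqrt_sq (z - a)
    linear_combination csqrt_sq (z - a) - csqrt_sq z
  have hn := congrArg norm hmul
  rw [norm_mul, norm_neg, Complex.norm_real, Real.norm_eq_abs] at hn
  have hspos := norm_pos_iff.mpr hs0
  rw [div_sub_one hs0, norm_div, norm_inv, div_le_iff₀ hspos]
  have hzz : ‖z.sqrt‖ * ‖z.sqrt‖ = ‖z‖ := by rw [← norm_mul, ← sq, csqrt_sq]
  rw [← hn, ← hzz]
  have : ‖(z - a).sqrt - z.sqrt‖ * ‖z.sqrt‖ ≤
      ‖(z - a).sqrt - z.sqrt‖ * ‖(z - a).sqrt + z.sqrt‖ := by gcongr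
  field_simp
  exact this

theorem tendsto_rootProd_div (s : ℕ → ℝ) (r : ℕ) :
    Tendsto (fun z : ℂ => rootProd s (2 * r) z / z ^ r) upperInfty (𝓝 1) := by
  have h := tendsto_finsetProd (Finset.Icc 1 (2 * r)) fun k _ => tendsto_csqrt_sub_div (s k)
  rw [Finset.prod_const_one] at h
  refine h.congr fun z => ?_
  rw [Finset.prod_div_distrib, Finset.prod_const, rootProd]
  simp [pow_mul, csqrt_sq]

/-- A polynomial of degree at most `r - 2` over the square root decays like `coeff / z ^ 2`. -/
theorem tendsto_sq_mul_polyQuot (s : ℕ → ℝ) {r : ℕ} (hr : 2 ≤ r) {N : ℝ[X]}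
    (hN : N.natDegree ≤ r - 2) :
    Tendsto (fun z : ℂ => z ^ 2 * polyQuot s (2 * r) N z) upperInfty
      (𝓝 (N.coeff (r - 2) : ℂ)) := by
  have h := (tendsto_aeval_div_pow N hN).div (tendsto_rootProd_div s r) one_ne_zero
  rw [div_one] at h
  refine h.congr' ?_
  filter_upwards [eventually_ne_zero_upperInfty, eventually_im_pos] with z hz him
  have := rootProd_ne_zero_of_im_pos s (2 * r) him
  obtain ⟨m, rfl⟩ : ∃ m, r = m + 2 := ⟨r - 2, by omega⟩
  simp only [polyQuot, Pi.div_apply, Nat.add_sub_cancel]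
  field_simp
  ring

theorem tendsto_mul_polyQuot (s : ℕ → ℝ) {r : ℕ} (hr : 2 ≤ r) {N : ℝ[X]}
    (hN : N.natDegree ≤ r - 2) :
    Tendsto (fun z : ℂ => z * polyQuot s (2 * r) N z) upperInfty (𝓝 0) := by
  have h := tendsto_inv_upperInfty.mul (tendsto_sq_mul_polyQuot s hr hN)
  rw [zero_mul] at h
  refine h.congr' ?_
  filter_upwards [eventually_ne_zero_upperInfty] with z hz
  field_simp

theorem IsBranchSeq.rootProd_sq {r : ℕ} {p : ℝ[X]} {T : ℝ} {s : ℕ → ℝ}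
    (h : IsBranchSeq r p T s) (hr : 1 ≤ r) (z : ℂ) :
    rootProd s (2 * r) z ^ 2 = aeval z p ^ 2 - (T : ℂ) ^ 2 := by
  rw [SeibergWitten.rootProd_sq]
  have := congrArg (aeval z) (h.sq_sub_eq_prod hr)
  simpa [map_prod] using this.symm

/-- The terms `z ^ r` cancel by Euler's relation, the terms `z ^ (r - 1)` vanish. -/
theorem natDegree_X_mul_derivative_sub_le {r : ℕ} {p : ℝ[X]} (hr : 2 ≤ r)
    (hd : p.natDegree = r) (hc : p.coeff (r - 1) = 0) :
    (X * derivative p - C (r : ℝ) * p).natDegree ≤ r - 2 := by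
  rw [natDegree_le_iff_coeff_eq_zero]
  intro m hm
  obtain ⟨m, rfl⟩ : ∃ k, m = k + 1 := ⟨m - 1, by omega⟩
  rw [coeff_sub, coeff_X_mul, coeff_derivative, coeff_C_mul]
  rcases lt_trichotomy (m + 1) r with h | h | h
  · have : m + 1 = r - 1 := by omega
    rw [this, hc]; simp
  · rw [← h]; push_cast; ring
  · rw [coeff_eq_zero_of_natDegree_lt (by omega)]; simp

/-- The differential `z p'(z) dz / y` is `r dz` up to terms without a residue at infinity. -/
theorem IsBranchSeq.tendsto_mul_polyQuot_sub {r : ℕ} {p : ℝ[X]} {T : ℝ} {s : ℕ → ℝ}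
    (h : IsBranchSeq r p T s) (hr : 2 ≤ r) (hc : p.coeff (r - 1) = 0) :
    Tendsto (fun z : ℂ => z * (polyQuot s (2 * r) (X * derivative p) z - r)) upperInfty (𝓝 0) := by
  have h1 := tendsto_mul_polyQuot s hr
    (natDegree_X_mul_derivative_sub_le hr h.natDegree hc)
  have hp : Tendsto (fun z : ℂ => aeval z p / z ^ r) upperInfty (𝓝 1) := by
    have := tendsto_aeval_div_pow p h.natDegree.le
    rwa [show p.coeff r = 1 by rw [← h.natDegree]; exact h.monic] at this
  have hY := tendsto_rootProd_div s r
  have h2 : Tendsto (fun z : ℂ => (r : ℂ) * (T : ℂ) ^ 2 * (z⁻¹) ^ (2 * r - 1) /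
      ((aeval z p / z ^ r + rootProd s (2 * r) z / z ^ r) * (rootProd s (2 * r) z / z ^ r)))
      upperInfty (𝓝 ((r : ℂ) * (T : ℂ) ^ 2 * 0 ^ (2 * r - 1) / ((1 + 1) * 1))) :=
    ((tendsto_inv_upperInfty.pow _).const_mul _).div ((hp.add hY).mul hY) (by norm_num)
  rw [zero_pow (by omega), mul_zero, zero_div] at h2
  have h3 := h1.add h2
  rw [add_zero] at h3
  refine h3.congr' ?_
  have hne : ∀ᶠ z in upperInfty, aeval z p / z ^ r + rootProd s (2 * r) z / z ^ r ≠ 0 := by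
    refine (hp.add hY).eventually_ne ?_
    norm_num
  filter_upwards [eventually_ne_zero_upperInfty, eventually_im_pos, hne] with z hz him hne
  have hY0 := rootProd_ne_zero_of_im_pos s (2 * r) him
  have hsum : aeval z p + rootProd s (2 * r) z ≠ 0 := by
    rw [← add_div] at hne
    exact (div_ne_zero_iff.mp hne).1
  have hsq := h.rootProd_sq (by omega) z
  have e1 : z⁻¹ ^ (2 * r - 1) = z / (z ^ r * z ^ r) := by
    rw [← pow_add, show r + r = (2 * r - 1) + 1 by omega, pow_succ, inv_pow]
    field_simp
  have e2 : (r : ℂ) * (T : ℂ) ^ 2 * z⁻¹ ^ (2 * r - 1) /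
      ((aeval z p / z ^ r + rootProd s (2 * r) z / z ^ r) * (rootProd s (2 * r) z / z ^ r)) =
      z * r * (T : ℂ) ^ 2 / ((aeval z p + rootProd s (2 * r) z) * rootProd s (2 * r) z) := by
    rw [e1, ← add_div]
    field_simp
  have e3 : (T : ℂ) ^ 2 / (aeval z p + rootProd s (2 * r) z) = aeval z p - rootProd s (2 * r) z := by
    rw [div_eq_iff hsum]
    linear_combination hsq
  rw [e2, ← div_div, mul_div_assoc, e3, polyQuot, polyQuot]
  simp only [map_sub, map_mul, aeval_X, aeval_C]
  field_simp
  simp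
  ring

theorem tendsto_circleMap_upperInfty {θ : ℝ} (hθ : θ ∈ Set.Ioo 0 Real.pi) :
    Tendsto (fun R : ℝ => circleMap 0 R θ) atTop upperInfty := by
  refine tendsto_inf.mpr ⟨?_, ?_⟩
  · rw [← tendsto_norm_atTop_iff_cobounded]
    simp only [norm_circleMap_zero]
    exact tendsto_abs_atTop_atTop
  · rw [tendsto_principal]
    filter_upwards [eventually_gt_atTop 0] with R hR
    have := circleMap_im_pos (c := 0) hR hθ
    simpa using this

theorem exists_radius_of_eventually {P : ℂ → Prop} (h : ∀ᶠ z in upperInfty, P z) :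
    ∃ R₀ : ℝ, 0 < R₀ ∧ ∀ z : ℂ, 0 < z.im → R₀ ≤ ‖z‖ → P z := by
  rw [upperInfty, eventually_inf_principal, ← comap_norm_atTop, eventually_comap] at h
  obtain ⟨R₀, hR⟩ := eventually_atTop.mp h
  exact ⟨max R₀ 1, by positivity, fun z hz hzR => hR _ ((le_max_left _ _).trans hzR) z rfl hz⟩

/-- A large semicircle picks up `π i` times the coefficient of `1 / z`. -/
theorem tendsto_semicircleIntegral {φ : ℂ → ℂ} {L : ℂ} (hφ : ContinuousOn φ {z | 0 < z.im})
    (h : Tendsto (fun z => z * φ z) upperInfty (𝓝 L)) :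
    Tendsto (fun R : ℝ => semicircleIntegral 0 R φ) atTop (𝓝 (Real.pi * Complex.I * L)) := by
  have hL : (Real.pi : ℂ) * Complex.I * L = ∫ _ in (0 : ℝ)..Real.pi, Complex.I * L := by
    rw [intervalIntegral.integral_const]
    simp [mul_assoc]
  rw [hL]
  have hne : ∀ᵐ θ : ℝ, θ ≠ Real.pi := MeasureTheory.Measure.ae_ne _ _
  have hb : ∀ᶠ z in upperInfty, ‖z * φ z‖ < ‖L‖ + 1 := h.norm.eventually_lt_const (by linarith)
  obtain ⟨R₀, hR₀, hbd⟩ := exists_radius_of_eventually hb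
  refine intervalIntegral.tendsto_integral_filter_of_dominated_convergence
    (fun _ => ‖L‖ + 1) ?_ ?_ intervalIntegrable_const ?_
  · filter_upwards [eventually_gt_atTop 0] with R hR
    rw [Set.uIoc_of_le Real.pi_pos.le, ← MeasureTheory.Measure.restrict_congr_set
      MeasureTheory.Ioo_ae_eq_Ioc]
    refine ContinuousOn.aestronglyMeasurable ?_ measurableSet_Ioo
    refine ContinuousOn.mul (by fun_prop) (hφ.comp (by fun_prop) fun θ hθ => ?_)
    have := circleMap_im_pos (c := 0) hR hθ
    simpa using this
  · filter_upwards [eventually_ge_atTop R₀] with R hR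
    filter_upwards [hne] with θ hne hθ
    rw [Set.uIoc_of_le Real.pi_pos.le] at hθ
    have hp := circleMap_im_pos (c := 0) (hR₀.trans_le hR) ⟨hθ.1, lt_of_le_of_ne hθ.2 hne⟩
    have := (hbd (circleMap 0 R θ) (by simpa using hp)
      (by rw [norm_circleMap_zero]; exact hR.trans (le_abs_self _))).le
    rw [mul_right_comm, norm_mul, Complex.norm_I, mul_one, Complex.ofReal_zero]
    exact this
  · filter_upwards [hne] with θ hne hθ
    rw [Set.uIoc_of_le Real.pi_pos.le] at hθ
    have := (h.comp (tendsto_circleMap_upperInfty ⟨hθ.1, lt_of_le_of_ne hθ.2 hne⟩)).const_mul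
      Complex.I
    refine this.congr fun R => ?_
    simp only [Function.comp, Complex.ofReal_zero]
    ring

end SeibergWitten

namespace SeibergWitten

theorem intervalIntegrable_semicircle {c ρ C : ℝ} (hρ : 0 < ρ) {φ : ℂ → ℂ}
    (hφ : ContinuousOn φ {z | 0 < z.im})
    (hC : ∀ θ ∈ Set.Ioo 0 Real.pi, ‖φ (circleMap c ρ θ)‖ ≤ C) :
    IntervalIntegrable (fun θ : ℝ => circleMap 0 ρ θ * Complex.I * φ (circleMap c ρ θ))
      MeasureTheory.volume 0 Real.pi := by
  refine (intervalIntegrable_const (c := |ρ| * C)).mono_fun' ?_ ?_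
  · rw [Set.uIoc_of_le Real.pi_pos.le, ← MeasureTheory.Measure.restrict_congr_set
      MeasureTheory.Ioo_ae_eq_Ioc]
    refine ContinuousOn.aestronglyMeasurable ?_ measurableSet_Ioo
    exact ContinuousOn.mul (by fun_prop) (hφ.comp (by fun_prop) fun θ hθ => circleMap_im_pos hρ hθ)
  · rw [Set.uIoc_of_le Real.pi_pos.le, ← MeasureTheory.Measure.restrict_congr_set
      MeasureTheory.Ioo_ae_eq_Ioc, Filter.EventuallyLE,
      MeasureTheory.ae_restrict_iff' measurableSet_Ioo]
    refine .of_forall fun θ hθ => ?_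
    simp only [norm_mul, norm_circleMap_zero, Complex.norm_I, mul_one]
    exact mul_le_mul_of_nonneg_left (hC θ hθ) (abs_nonneg _)

theorem norm_circleMap_le (c ρ θ : ℝ) : ‖circleMap c ρ θ‖ ≤ |c| + |ρ| := by
  rw [circleMap]
  exact (norm_add_le _ _).trans (by simp)

theorem HasBoundaryValues.exists_bound_semicircle {s : ℕ → ℝ} {n : ℕ} {φ : ℂ → ℂ}
    (h : HasBoundaryValues s n φ) {c ρ : ℝ} (hρ : 0 < ρ)
    (h₁ : rootProd s n ((c - ρ : ℝ) : ℂ) ≠ 0) (h₂ : rootProd s n ((c + ρ : ℝ) : ℂ) ≠ 0) :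
    ∃ C : ℝ, ∀ θ ∈ Set.Ioo 0 Real.pi, ‖φ (circleMap c ρ θ)‖ ≤ C := by
  obtain ⟨m, hm, hmle⟩ := exists_le_norm_rootProd s n hρ h₁ h₂
  obtain ⟨C, hC⟩ := h.bound (|c| + |ρ|)
  refine ⟨|C| * m⁻¹, fun θ hθ => (hC _ (circleMap_im_pos hρ hθ) (norm_circleMap_le _ _ _)).trans ?_⟩
  have := hmle θ (Set.Ioo_subset_Icc_self hθ) 0 le_rfl
  rw [Complex.ofReal_zero, zero_mul, add_zero] at this
  gcongr
  exact le_abs_self C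

/-! ### The bilinear relation -/

/-- The branch points completed by the end points of a large interval `[-R, R]`. -/
noncomputable def extSeq (s : ℕ → ℝ) (n : ℕ) (R : ℝ) (k : ℕ) : ℝ :=
  if k = 0 then R else if k ≤ n then s k else -R

theorem extSeq_succ_lt {s : ℕ → ℝ} {n : ℕ} {R : ℝ} (hs : StrictAntiOn s (Set.Icc 1 n))
    (hR : 0 < R) (hsR : ∀ k ∈ Finset.Icc 1 n, |s k| < R) {k : ℕ} (hk : k ≤ n) :
    extSeq s n R (k + 1) < extSeq s n R k := by
  unfold extSeq
  rcases Nat.eq_zero_or_pos k with rfl | hk0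
  · rcases Nat.eq_zero_or_pos n with rfl | hn
    · simp; linarith
    · have := (abs_lt.mp (hsR 1 (by simp; omega))).2
      simpa [show 1 ≤ n from hn] using this
  · rcases eq_or_lt_of_le hk with rfl | hkn
    · have := (abs_lt.mp (hsR k (by simp; omega))).1
      simpa [hk0.ne'] using this
    · have := hs ⟨hk0, hk⟩ ⟨by omega, hkn⟩ (Nat.lt_succ_self k)
      simpa [hk0.ne', hk, Nat.succ_le_of_lt hkn] using this

theorem inCell_extSeq {s : ℕ → ℝ} {n : ℕ} {R : ℝ} {k : ℕ} (hk : k ≤ n) {x : ℝ}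
    (hx : x ∈ Set.Ioo (extSeq s n R (k + 1)) (extSeq s n R k)) : InCell s n k x := by
  refine ⟨hk, fun h => ?_, fun h => ?_⟩
  · have := hx.2
    rwa [extSeq, if_neg (by omega), if_pos hk] at this
  · have := hx.1
    rwa [extSeq, if_neg (by omega), if_pos (by omega)] at this

/-- The integral of `N / √|∏ (x - s j)|` over the part of the cell `k` in `[-R, R]`. -/
noncomputable def extCellIntegral (s : ℕ → ℝ) (n : ℕ) (R : ℝ) (k : ℕ) (N : ℝ[X]) : ℝ :=
  ∫ x in (extSeq s n R (k + 1))..(extSeq s n R k), realQuot s n N x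

theorem extCellIntegral_eq {s : ℕ → ℝ} {n : ℕ} {R : ℝ} {k : ℕ} (h1 : 1 ≤ k) (hk : k < n)
    (N : ℝ[X]) : extCellIntegral s n R k N = cellIntegral s n k N := by
  unfold extCellIntegral cellIntegral extSeq
  rw [if_neg (show k ≠ 0 by omega), if_neg (show k + 1 ≠ 0 by omega), if_pos hk.le,
    if_pos (show k + 1 ≤ n from hk)]

theorem integral_extSeq_eq_sum {f : ℝ → ℂ} {s : ℕ → ℝ} {n : ℕ} {R : ℝ}
    (hf : ∀ a b : ℝ, IntervalIntegrable f MeasureTheory.volume a b) (m : ℕ) :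
    ∫ x in (extSeq s n R m)..R, f x =
      ∑ k ∈ Finset.range m, ∫ x in (extSeq s n R (k + 1))..(extSeq s n R k), f x := by
  have h0 : extSeq s n R 0 = R := by simp [extSeq]
  have := intervalIntegral.sum_integral_adjacent_intervals (a := extSeq s n R) (n := m)
    (fun k _ => hf _ _)
  rw [h0] at this
  rw [intervalIntegral.integral_symm, ← this, ← Finset.sum_neg_distrib]
  exact Finset.sum_congr rfl fun k _ => (intervalIntegral.integral_symm _ _).symm

theorem integral_polyQuot_extSeq {s : ℕ → ℝ} {n : ℕ} {R : ℝ} (hs : StrictAntiOn s (Set.Icc 1 n))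
    (hR : 0 < R) (hsR : ∀ k ∈ Finset.Icc 1 n, |s k| < R) (N : ℝ[X]) {k : ℕ} (hk : k ≤ n) :
    ∫ x in (extSeq s n R (k + 1))..(extSeq s n R k), polyQuot s n N (x : ℂ) =
      (-Complex.I) ^ k * (extCellIntegral s n R k N : ℝ) :=
  integral_polyQuot_of_inCell hs N (extSeq_succ_lt hs hR hsR hk).le fun _ hx => inCell_extSeq hk hx

theorem neg_I_pow_even (j : ℕ) : (-Complex.I) ^ (2 * j) = ((-1 : ℝ) ^ j : ℝ) := by
  rw [pow_mul, neg_sq, Complex.I_sq]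
  push_cast
  rfl

theorem neg_I_pow_odd (j : ℕ) : (-Complex.I) ^ (2 * j + 1) = -(((-1 : ℝ) ^ j : ℝ) * Complex.I) := by
  rw [pow_succ, neg_I_pow_even]
  ring

/-- The half-period `∫ N / y` over the cut with number `j + 1`, up to a factor `i`. -/
noncomputable def cutPeriod (s : ℕ → ℝ) (n : ℕ) (N : ℝ[X]) (j : ℕ) : ℝ :=
  (-1) ^ j * cellIntegral s n (2 * j + 1) N

/-- The sum of the half-periods `∫ N / y` over the first `j` gaps between the cuts. -/
noncomputable def gapSum (s : ℕ → ℝ) (n : ℕ) (N : ℝ[X]) (j : ℕ) : ℝ :=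
  ∑ i ∈ Finset.Icc 1 j, (-1) ^ i * cellIntegral s n (2 * i) N

theorem im_sum_neg_I_pow (γ : ℕ → ℝ) (r : ℕ) :
    (∑ k ∈ Finset.range (2 * r + 1), (-Complex.I) ^ k * (γ k : ℂ)).im =
      -∑ j ∈ Finset.range r, (-1) ^ j * γ (2 * j + 1) := by
  induction r with
  | zero => simp
  | succ r ih =>
    rw [show 2 * (r + 1) + 1 = (2 * r + 1) + 1 + 1 by ring, Finset.sum_range_succ,
      Finset.sum_range_succ, Complex.add_im, Complex.add_im, ih, Finset.sum_range_succ,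
      neg_I_pow_odd, show 2 * r + 1 + 1 = 2 * (r + 1) by ring, neg_I_pow_even,
      ← Complex.ofReal_mul, Complex.ofReal_im, show -(((-1 : ℝ) ^ r : ℝ) * Complex.I) *
        (γ (2 * r + 1) : ℂ) = ((-((-1) ^ r * γ (2 * r + 1)) : ℝ) : ℂ) * Complex.I by push_cast; ring,
      Complex.im_ofReal_mul, Complex.I_im]
    ring

/-- The sum on the left is the boundary integral of a product of two forms, computed cell by cell;
summation by parts turns it into the bilinear expression in the periods. -/
theorem sum_im_mul_eq (c d : ℕ → ℂ) (hc : ∀ j, (c (2 * j)).im = 0)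
    (hc' : ∀ j, (c (2 * j + 1)).re = 0) (hd : ∀ j, (d (2 * j)).im = 0)
    (hd' : ∀ j, (d (2 * j + 1)).re = 0) (r : ℕ) :
    ∑ k ∈ Finset.range (2 * r + 1), ((∑ j ∈ Finset.range k, c j) * d k).im =
      (∑ j ∈ Finset.range r, (c (2 * j + 1)).im) * (∑ j ∈ Finset.range (r + 1), (d (2 * j)).re) +
      ∑ j ∈ Finset.range r, ((d (2 * j + 1)).im * (∑ i ∈ Finset.range (j + 1), (c (2 * i)).re) -
        (c (2 * j + 1)).im * (∑ i ∈ Finset.range (j + 1), (d (2 * i)).re)) := by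
  have him : ∀ r, (∑ j ∈ Finset.range (2 * r), c j).im = ∑ j ∈ Finset.range r, (c (2 * j + 1)).im ∧
      (∑ j ∈ Finset.range (2 * r), c j).re = ∑ j ∈ Finset.range r, (c (2 * j)).re := by
    intro r
    induction r with
    | zero => simp
    | succ r ih =>
      rw [show 2 * (r + 1) = 2 * r + 1 + 1 by ring, Finset.sum_range_succ, Finset.sum_range_succ]
      simp only [Complex.add_im, Complex.add_re, ih.1, ih.2, hc, hc', Finset.sum_range_succ, add_zero]
      exact ⟨trivial, trivial⟩
  induction r with
  | zero => simp
  | succ r ih =>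
    have h1 : ((∑ j ∈ Finset.range (2 * r + 1), c j) * d (2 * r + 1)).im =
        (∑ i ∈ Finset.range (r + 1), (c (2 * i)).re) * (d (2 * r + 1)).im := by
      rw [Complex.mul_im, hd', mul_zero, add_zero, Finset.sum_range_succ, Complex.add_re, (him r).2,
        Finset.sum_range_succ]
    have h2 : ((∑ j ∈ Finset.range (2 * (r + 1)), c j) * d (2 * (r + 1))).im =
        (∑ j ∈ Finset.range (r + 1), (c (2 * j + 1)).im) * (d (2 * (r + 1))).re := by
      rw [Complex.mul_im, hd, mul_zero, zero_add, (him (r + 1)).1]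
    rw [show 2 * (r + 1) + 1 = (2 * r + 1) + 1 + 1 by ring, Finset.sum_range_succ,
      Finset.sum_range_succ, ih, h1, show 2 * r + 1 + 1 = 2 * (r + 1) by ring, h2,
      Finset.sum_range_succ _ (r + 1), Finset.sum_range_succ _ r, Finset.sum_range_succ _ r]
    simp only [Finset.sum_range_succ _ r]
    ring

namespace IsBranchSeq

variable {r : ℕ} {p : ℝ[X]} {T : ℝ} {s : ℕ → ℝ}

theorem exists_radius (s : ℕ → ℝ) (n : ℕ) :
    ∃ R₀ : ℝ, 0 < R₀ ∧ ∀ R, R₀ ≤ R → ∀ k ∈ Finset.Icc 1 n, |s k| < R := by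
  refine ⟨1 + ∑ k ∈ Finset.Icc 1 n, |s k|, by positivity, fun R hR k hk => ?_⟩
  have := Finset.single_le_sum (f := fun k => |s k|) (fun i _ => abs_nonneg _) hk
  linarith

theorem rootProd_ne_zero_of_radius {n : ℕ} {R : ℝ} (hsR : ∀ k ∈ Finset.Icc 1 n, |s k| < R)
    {x : ℝ} (hx : |x| = R) : rootProd s n x ≠ 0 := by
  rw [rootProd_ne_zero_iff]
  intro k hk h
  have := hsR k hk
  rw [← hx, Complex.ofReal_inj.mp h] at this
  exact lt_irrefl _ this

/-- The imaginary part of the integral over a large interval is the sum over the cuts. -/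
theorem im_integral_polyQuot (h : IsBranchSeq r p T s) (N : ℝ[X]) {R : ℝ} (hR : 0 < R)
    (hsR : ∀ k ∈ Finset.Icc 1 (2 * r), |s k| < R) :
    (∫ x in (-R)..R, polyQuot s (2 * r) N (x : ℂ)).im =
      -∑ j ∈ Finset.range r, cutPeriod s (2 * r) N j := by
  have hlast : extSeq s (2 * r) R (2 * r + 1) = -R := by simp [extSeq]
  rw [← hlast, integral_extSeq_eq_sum
    ((hasBoundaryValues_polyQuot s (2 * r) N).intervalIntegrable h.anti.injOn),
    Finset.sum_congr rfl fun k hk => integral_polyQuot_extSeq h.anti hR hsR N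
      (Nat.lt_succ_iff.mp (Finset.mem_range.mp hk)), im_sum_neg_I_pow]
  congr 1
  refine Finset.sum_congr rfl fun j hj => ?_
  rw [Finset.mem_range] at hj
  rw [cutPeriod, extCellIntegral_eq (by omega) (by omega)]

/-- Cauchy's theorem on the half-disc of radius `R`. -/
theorem sum_cutPeriod_eq (h : IsBranchSeq r p T s) (N : ℝ[X]) {R : ℝ} (hR : 0 < R)
    (hsR : ∀ k ∈ Finset.Icc 1 (2 * r), |s k| < R) :
    ∑ j ∈ Finset.range r, cutPeriod s (2 * r) N j =
      (semicircleIntegral 0 R (polyQuot s (2 * r) N)).im := by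
  have h1 : rootProd s (2 * r) ((0 - R : ℝ) : ℂ) ≠ 0 :=
    rootProd_ne_zero_of_radius hsR (by rw [zero_sub, abs_neg, abs_of_pos hR])
  have h2 : rootProd s (2 * r) ((0 + R : ℝ) : ℂ) ≠ 0 :=
    rootProd_ne_zero_of_radius hsR (by rw [zero_add, abs_of_pos hR])
  rw [(hasBoundaryValues_polyQuot s (2 * r) N).semicircleIntegral_eq h.anti.injOn hR h1 h2,
    zero_sub, zero_add, Complex.neg_im, h.im_integral_polyQuot N hR hsR, neg_neg]

/-- The sum of all periods over the cuts is the period over a large circle, which vanishes for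
differentials without a residue at infinity. -/
theorem sum_cutPeriod_eq_zero (h : IsBranchSeq r p T s) (N : ℝ[X]) (a : ℝ)
    (hN : Tendsto (fun z : ℂ => z * (polyQuot s (2 * r) N z - a)) upperInfty (𝓝 0)) :
    ∑ j ∈ Finset.range r, cutPeriod s (2 * r) N j = 0 := by
  obtain ⟨R₀, hR₀, hbd⟩ := exists_radius s (2 * r)
  have hcont : ContinuousOn (polyQuot s (2 * r) N) {z | 0 < z.im} :=
    (hasBoundaryValues_polyQuot s (2 * r) N).diff.continuousOn
  have h1 := tendsto_semicircleIntegral (hcont.sub (continuousOn_const (c := (a : ℂ)))) hN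
  rw [mul_zero] at h1
  have h2 := (Complex.continuous_im.tendsto _).comp h1
  refine tendsto_nhds_unique (tendsto_const_nhds.congr' ?_) h2
  filter_upwards [eventually_ge_atTop R₀] with R hR
  have hR0 := hR₀.trans_le hR
  rw [h.sum_cutPeriod_eq N hR0 (hbd R hR)]
  -- A real constant contributes the real number `-2 a R`.
  have hconst : semicircleIntegral 0 R (fun _ => (a : ℂ)) = ((-R * a : ℝ) : ℂ) - ((R * a : ℝ) : ℂ) := by
    have hlim : ∀ x : ℝ, Tendsto (fun δ : ℝ => ((x : ℂ) + δ * Complex.I) * (a : ℂ)) (𝓝[>] 0)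
        (𝓝 ((x * a : ℝ) : ℂ)) := fun x => by
      have := (tendsto_add_mul_I (x : ℂ)).mul_const (a : ℂ)
      rwa [← Complex.ofReal_mul] at this
    have hm := hlim (0 - R)
    have hp := hlim (0 + R)
    rw [zero_sub] at hm
    rw [zero_add] at hp
    refine semicircleIntegral_eq_sub (Ψ := fun z => z * a) (C := ‖(a : ℂ)‖) hR0
      continuousOn_const (fun z _ => ?_) (fun _ _ _ _ => le_rfl) ?_ ?_
    · simpa using (hasDerivAt_id z).mul_const (a : ℂ)
    · rwa [zero_sub]
    · rwa [zero_add]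
  have hsplit : semicircleIntegral 0 R (fun z => polyQuot s (2 * r) N z - a) =
      semicircleIntegral 0 R (polyQuot s (2 * r) N) - semicircleIntegral 0 R fun _ => (a : ℂ) := by
    obtain ⟨C, hC⟩ := (hasBoundaryValues_polyQuot s (2 * r) N).exists_bound_semicircle (c := 0) hR0
      (rootProd_ne_zero_of_radius (hbd R hR) (by rw [zero_sub, abs_neg, abs_of_pos hR0]))
      (rootProd_ne_zero_of_radius (hbd R hR) (by rw [zero_add, abs_of_pos hR0]))
    unfold semicircleIntegral
    rw [← intervalIntegral.integral_sub (intervalIntegrable_semicircle hR0 hcont hC)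
      (intervalIntegrable_semicircle (c := 0) (C := ‖(a : ℂ)‖) hR0 continuousOn_const
        fun _ _ => le_rfl)]
    exact intervalIntegral.integral_congr fun θ _ => by ring
  change _ = (semicircleIntegral 0 R fun z => polyQuot s (2 * r) N z - a).im
  rw [hsplit, hconst, ← Complex.ofReal_sub, Complex.sub_im, Complex.ofReal_im, sub_zero]

/-- The boundary integral of the product of a form and a primitive of another one, computed cell by
cell: on each cell one of the two factors only contributes through its value at the right end. -/
theorem im_integral_primitive_mul (h : IsBranchSeq r p T s) (Q N : ℝ[X]) {R : ℝ} (hR : 0 < R)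
    (hsR : ∀ k ∈ Finset.Icc 1 (2 * r), |s k| < R) {Φ : ℂ → ℂ} (hΦR : Φ R = 0)
    (hΦ : ∀ x y : ℝ, rootProd s (2 * r) x ≠ 0 → rootProd s (2 * r) y ≠ 0 →
        ∫ t in x..y, polyQuot s (2 * r) Q (t : ℂ) = Φ y - Φ x)
    (hint : IntervalIntegrable (fun x : ℝ => Φ x * polyQuot s (2 * r) N x)
      MeasureTheory.volume (-R) R) :
    (∫ x in (-R)..R, Φ x * polyQuot s (2 * r) N (x : ℂ)).im =
      -∑ k ∈ Finset.range (2 * r + 1), ((∑ j ∈ Finset.range k,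
          (-Complex.I) ^ j * (extCellIntegral s (2 * r) R j Q : ℂ)) *
        ((-Complex.I) ^ k * (extCellIntegral s (2 * r) R k N : ℂ))).im := by
  have hq := hasBoundaryValues_polyQuot s (2 * r) Q
  have hg := hasBoundaryValues_polyQuot s (2 * r) N
  have hanti : ∀ k ≤ 2 * r, extSeq s (2 * r) R (k + 1) ≤ extSeq s (2 * r) R k := fun k hk =>
    (extSeq_succ_lt h.anti hR hsR hk).le
  have hlast : extSeq s (2 * r) R (2 * r + 1) = -R := by simp [extSeq]
  have hsum : ∀ m ≤ 2 * r + 1, ∫ x in (extSeq s (2 * r) R m)..R, polyQuot s (2 * r) Q (x : ℂ) =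
      ∑ j ∈ Finset.range m, (-Complex.I) ^ j * (extCellIntegral s (2 * r) R j Q : ℂ) := by
    intro m hm
    rw [integral_extSeq_eq_sum (hq.intervalIntegrable h.anti.injOn)]
    exact Finset.sum_congr rfl fun k hk => integral_polyQuot_extSeq h.anti hR hsR Q
      (by have := Finset.mem_range.mp hk; omega)
  have hmem : ∀ k ≤ 2 * r + 1, extSeq s (2 * r) R k ∈ Set.Icc (-R) R := by
    intro k hk
    have hle : -R ≤ R := by linarith
    unfold extSeq
    split_ifs with h1 h2
    · exact ⟨hle, le_rfl⟩
    · have := abs_lt.mp (hsR k (by simp; omega))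
      exact ⟨this.1.le, this.2.le⟩
    · exact ⟨le_rfl, hle⟩
  have hintk : ∀ k ≤ 2 * r, IntervalIntegrable (fun x : ℝ => Φ x * polyQuot s (2 * r) N x)
      MeasureTheory.volume (extSeq s (2 * r) R (k + 1)) (extSeq s (2 * r) R k) := by
    intro k hk
    refine hint.mono_set ?_
    rw [Set.uIcc_of_le (show -R ≤ R by linarith), Set.uIcc_of_le (hanti k hk)]
    exact Set.Icc_subset_Icc (hmem _ (by omega)).1 (hmem _ (by omega)).2
  have hsplit : ∫ x in (-R)..R, Φ x * polyQuot s (2 * r) N (x : ℂ) =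
      ∑ k ∈ Finset.range (2 * r + 1), ∫ x in (extSeq s (2 * r) R (k + 1))..(extSeq s (2 * r) R k),
        Φ x * polyQuot s (2 * r) N (x : ℂ) := by
    have h0 : extSeq s (2 * r) R 0 = R := by simp [extSeq]
    have := intervalIntegral.sum_integral_adjacent_intervals (a := extSeq s (2 * r) R)
      (n := 2 * r + 1) (fun k hk => (hintk k (by omega)).symm)
    rw [h0, hlast] at this
    rw [intervalIntegral.integral_symm, ← this, ← Finset.sum_neg_distrib]
    exact Finset.sum_congr rfl fun k _ => (intervalIntegral.integral_symm _ _).symm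
  have hRne : rootProd s (2 * r) R ≠ 0 := rootProd_ne_zero_of_radius hsR (abs_of_pos hR)
  rw [hsplit, Complex.im_sum, ← Finset.sum_neg_distrib]
  refine Finset.sum_congr rfl fun k hk => ?_
  have hk' : k ≤ 2 * r := Nat.lt_succ_iff.mp (Finset.mem_range.mp hk)
  have hreal : ∀ x ∈ Set.Ioo (extSeq s (2 * r) R (k + 1)) (extSeq s (2 * r) R k),
      (Φ x * polyQuot s (2 * r) N (x : ℂ)).im =
      (-(∑ j ∈ Finset.range k, (-Complex.I) ^ j * (extCellIntegral s (2 * r) R j Q : ℂ)) *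
        polyQuot s (2 * r) N (x : ℂ)).im := by
    intro x hx
    have hcell := inCell_extSeq hk' hx
    have h1 := hΦ x R (hcell.rootProd_ne_zero h.anti) hRne
    rw [hΦR, ← intervalIntegral.integral_add_adjacent_intervals
      (hq.intervalIntegrable h.anti.injOn x (extSeq s (2 * r) R k))
      (hq.intervalIntegrable h.anti.injOn _ R), hsum k (by omega),
      integral_polyQuot_of_inCell h.anti Q hx.2.le fun t ht =>
        inCell_extSeq hk' ⟨hx.1.trans ht.1, ht.2⟩] at h1
    have h2 : Φ x = -((-Complex.I) ^ k * ((∫ t in x..(extSeq s (2 * r) R k),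
        realQuot s (2 * r) Q t : ℝ) : ℂ)) - ∑ j ∈ Finset.range k, (-Complex.I) ^ j *
          (extCellIntegral s (2 * r) R j Q : ℂ) := by linear_combination h1
    rw [h2, sub_eq_add_neg, add_mul, Complex.add_im]
    have h3 : (-((-Complex.I) ^ k * ((∫ t in x..(extSeq s (2 * r) R k),
        realQuot s (2 * r) Q t : ℝ) : ℂ)) * polyQuot s (2 * r) N (x : ℂ)).im = 0 := by
      rw [polyQuot_ofReal, hcell.countAbove_eq h.anti]
      have hI : (-Complex.I) ^ k * (-Complex.I) ^ k = ((-1 : ℝ) ^ k : ℝ) := by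
        rw [← mul_pow]; simp
      have : ∀ a b : ℝ, -((-Complex.I) ^ k * (a : ℂ)) * ((-Complex.I) ^ k * (b : ℂ)) =
          ((-((-1) ^ k * a * b) : ℝ) : ℂ) := fun a b => by
        push_cast at hI ⊢
        linear_combination -(a : ℂ) * b * hI
      rw [this, Complex.ofReal_im]
    rw [h3, zero_add]
  have him : ∀ f : ℝ → ℂ, ∀ a b : ℝ, IntervalIntegrable f MeasureTheory.volume a b →
      (∫ x in a..b, f x).im = ∫ x in a..b, (f x).im := fun f a b hf =>
    (Complex.imCLM.intervalIntegral_comp_comm hf).symm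
  rw [him _ _ _ (hintk k hk'), integral_congr_Ioo (hanti k hk') hreal, ← him _ _ _
    ((hg.intervalIntegrable h.anti.injOn _ _).const_mul _), intervalIntegral.integral_const_mul,
    integral_polyQuot_extSeq h.anti hR hsR N hk', neg_mul, Complex.neg_im]

end IsBranchSeq

end SeibergWitten

namespace SeibergWitten

namespace IsBranchSeq

variable {r : ℕ} {p : ℝ[X]} {T : ℝ} {s : ℕ → ℝ}

/-- A primitive of a form decaying like `C / |z| ^ 2` varies by at most `π C / R` on the semicircle
of radius `R`. -/
theorem norm_primitive_semicircle_le {φ Φ : ℂ → ℂ} {C R : ℝ} (hR : 0 < R)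
    (hC : ∀ z : ℂ, 0 < z.im → R ≤ ‖z‖ → ‖z ^ 2 * φ z‖ ≤ C)
    (hΦ : ∀ z : ℂ, 0 < z.im → HasDerivAt Φ (φ z) z)
    (hr : Tendsto (fun δ : ℝ => Φ ((R : ℂ) + δ * Complex.I)) (𝓝[>] 0) (𝓝 0))
    {θ : ℝ} (hθ : θ ∈ Set.Ioo 0 Real.pi) :
    ‖Φ (circleMap 0 R θ)‖ ≤ Real.pi * C / R := by
  have hC0 : 0 ≤ C := (norm_nonneg _).trans (hC (R * Complex.I) (by simpa using hR)
    (by simp [abs_of_pos hR]))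
  have key : ∀ δ : ℝ, 0 < δ → ‖Φ (circleMap 0 R θ + δ * Complex.I) - Φ (R + δ * Complex.I)‖ ≤
      Real.pi * C / R := by
    intro δ hδ
    have him : ∀ τ ∈ Set.Icc 0 Real.pi, δ ≤ (circleMap 0 R τ + δ * Complex.I).im := by
      intro τ hτ
      have := circleMap_im_nonneg (c := 0) hR hτ
      simpa using this
    have hnorm : ∀ τ ∈ Set.Icc 0 Real.pi, R ≤ ‖circleMap 0 R τ + δ * Complex.I‖ := by
      intro τ hτ
      have h0 := circleMap_im_nonneg (c := 0) hR hτ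
      rw [Complex.ofReal_zero] at h0
      calc R = ‖circleMap 0 R τ‖ := by rw [norm_circleMap_zero, abs_of_pos hR]
        _ ≤ _ := by
          rw [Complex.norm_eq_sqrt_sq_add_sq, Complex.norm_eq_sqrt_sq_add_sq]
          refine Real.sqrt_le_sqrt ?_
          simp only [Complex.add_re, Complex.add_im, Complex.mul_re, Complex.mul_im,
            Complex.ofReal_re, Complex.ofReal_im, Complex.I_re, Complex.I_im]
          have e1 : (circleMap 0 R τ).re + (δ * 0 - 0 * 1) = (circleMap 0 R τ).re := by ring
          rw [e1]
          gcongr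
          linarith
    have h1 := norm_image_sub_le_of_norm_deriv_le_segment'
      (f := fun τ : ℝ => Φ (circleMap 0 R τ + δ * Complex.I)) (a := 0) (b := Real.pi)
      (f' := fun τ : ℝ => circleMap 0 R τ * Complex.I * φ (circleMap 0 R τ + δ * Complex.I))
      (C := C / R) (fun τ hτ => ?_) (fun τ hτ => ?_) θ (Set.Ioo_subset_Icc_self hθ)
    · have h2 : circleMap 0 R 0 = R := by simp [circleMap]
      rw [h2] at h1
      refine h1.trans ?_
      rw [sub_zero, mul_comm, mul_div_assoc]
      gcongr
      exact hθ.2.le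
    · have h2 : HasDerivAt (fun τ : ℝ => circleMap 0 R τ + δ * Complex.I)
          (circleMap 0 R τ * Complex.I) τ := (hasDerivAt_circleMap 0 R τ).add_const _
      have := HasDerivAt.scomp (h := fun τ : ℝ => circleMap 0 R τ + δ * Complex.I) τ
        (hΦ _ (hδ.trans_le (him τ hτ))) h2
      simpa [Function.comp_def, mul_comm] using this.hasDerivWithinAt
    · have hτ' := Set.Ico_subset_Icc_self hτ
      set w := circleMap 0 R τ + δ * Complex.I
      have hw := hnorm τ hτ'
      have h3 := hC w (hδ.trans_le (him τ hτ')) hw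
      rw [norm_mul, norm_pow] at h3
      rw [norm_mul, norm_mul, Complex.norm_I, mul_one, norm_circleMap_zero, abs_of_pos hR,
        le_div_iff₀ hR]
      calc R * ‖φ w‖ * R = R ^ 2 * ‖φ w‖ := by ring
        _ ≤ ‖w‖ ^ 2 * ‖φ w‖ := by gcongr
        _ ≤ C := h3
  have hp : 0 < (circleMap 0 R θ).im := by
    have := circleMap_im_pos (c := 0) hR hθ
    simpa using this
  have hlim := (((hΦ _ hp).continuousAt.tendsto.comp (tendsto_add_mul_I _)).sub hr).norm
  rw [sub_zero] at hlim
  refine le_of_tendsto hlim ?_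
  filter_upwards [self_mem_nhdsWithin] with δ hδ using key δ hδ

/-- The bilinear expression agrees, up to an error that is small for large `R`, with the
contribution of the semicircle of radius `R`. -/
theorem abs_bilinear_sub_le (h : IsBranchSeq r p T s) (Q N : ℝ[X])
    (htQ : ∑ j ∈ Finset.range r, cutPeriod s (2 * r) Q j = 0)
    (htN : ∑ j ∈ Finset.range r, cutPeriod s (2 * r) N j = 0) {R C η : ℝ} (hR : 0 < R)
    (hsR : ∀ k ∈ Finset.Icc 1 (2 * r), |s k| < R)
    (hC : ∀ z : ℂ, 0 < z.im → R ≤ ‖z‖ → ‖z ^ 2 * polyQuot s (2 * r) Q z‖ ≤ C)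
    (hg : ∀ z : ℂ, 0 < z.im → R ≤ ‖z‖ → ‖polyQuot s (2 * r) N z - r‖ ≤ η) :
    |∑ j ∈ Finset.range r,
      (cutPeriod s (2 * r) N j * gapSum s (2 * r) Q j -
        cutPeriod s (2 * r) Q j * gapSum s (2 * r) N j) -
      r * (semicircleIntegral 0 R (polyQuot s (2 * r) (X * Q))).im| ≤
      Real.pi ^ 2 * C * η := by
  have hq := hasBoundaryValues_polyQuot s (2 * r) Q
  have hzq := hasBoundaryValues_polyQuot s (2 * r) (X * Q)
  have hgN := hasBoundaryValues_polyQuot s (2 * r) N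
  have hzq_eq : ∀ z, polyQuot s (2 * r) (X * Q) z = z * polyQuot s (2 * r) Q z := fun z => by
    simp [polyQuot, mul_div_assoc]
  have hY1 : rootProd s (2 * r) ((0 - R : ℝ) : ℂ) ≠ 0 :=
    rootProd_ne_zero_of_radius hsR (by rw [zero_sub, abs_neg, abs_of_pos hR])
  have hY2 : rootProd s (2 * r) ((0 + R : ℝ) : ℂ) ≠ 0 :=
    rootProd_ne_zero_of_radius hsR (by rw [zero_add, abs_of_pos hR])
  -- The primitive of the holomorphic form that vanishes at `R`.
  obtain ⟨Φ₀, hΦ₀, hr₀, hint₀⟩ := hq.exists_primitive h.anti.injOn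
  obtain ⟨Φ, hΦ_def⟩ : ∃ Φ : ℂ → ℂ, Φ = fun z => Φ₀ z - Φ₀ R := ⟨_, rfl⟩
  have hΦR : Φ R = 0 := by simp [hΦ_def]
  have hΦ : ∀ z : ℂ, 0 < z.im → HasDerivAt Φ (polyQuot s (2 * r) Q z) z := fun z hz => by
    rw [hΦ_def]
    exact (hΦ₀ z hz).sub_const _
  have hrad : ∀ x : ℝ, rootProd s (2 * r) x ≠ 0 →
      Tendsto (fun δ : ℝ => Φ ((x : ℂ) + δ * Complex.I)) (𝓝[>] 0) (𝓝 (Φ x)) := fun x hx => by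
    rw [hΦ_def]
    exact (hr₀ x hx).sub_const _
  have hint : ∀ x y : ℝ, rootProd s (2 * r) x ≠ 0 → rootProd s (2 * r) y ≠ 0 →
      ∫ t in x..y, polyQuot s (2 * r) Q (t : ℂ) = Φ y - Φ x := fun x y hx hy => by
    rw [hint₀ x y hx hy, hΦ_def]
    ring
  have hprod := hq.mul_primitive hgN h.anti.injOn hΦ hrad
  have hΦc : ContinuousOn Φ {z | 0 < z.im} := fun z hz =>
    (hΦ z hz).continuousAt.continuousWithinAt
  have hY2' := hY2
  rw [zero_add] at hY2'
  have hrR := hrad R hY2'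
  rw [hΦR] at hrR
  have hΦle : ∀ θ ∈ Set.Ioo 0 Real.pi, ‖Φ (circleMap ((0 : ℝ) : ℂ) R θ)‖ ≤ Real.pi * C / R :=
    fun θ hθ => by
      rw [Complex.ofReal_zero]
      exact norm_primitive_semicircle_le hR hC hΦ hrR hθ
  -- The boundary integral, computed cell by cell.
  have hbdry : (∫ x in (-R)..R, Φ x * polyQuot s (2 * r) N (x : ℂ)).im =
      ∑ j ∈ Finset.range r, (cutPeriod s (2 * r) N j * gapSum s (2 * r) Q j -
        cutPeriod s (2 * r) Q j * gapSum s (2 * r) N j) := by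
    rw [h.im_integral_primitive_mul Q N hR hsR hΦR hint
      (hprod.intervalIntegrable h.anti.injOn _ _)]
    have him : ∀ (M : ℝ[X]) (j : ℕ), ((-Complex.I) ^ (2 * j) *
        (extCellIntegral s (2 * r) R (2 * j) M : ℂ)) =
        (((-1) ^ j * extCellIntegral s (2 * r) R (2 * j) M : ℝ) : ℂ) := fun M j => by
      rw [neg_I_pow_even, Complex.ofReal_mul]
    have hre : ∀ (M : ℝ[X]) (j : ℕ), ((-Complex.I) ^ (2 * j + 1) *
        (extCellIntegral s (2 * r) R (2 * j + 1) M : ℂ)) =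
        ((-((-1) ^ j * extCellIntegral s (2 * r) R (2 * j + 1) M) : ℝ) : ℂ) * Complex.I :=
      fun M j => by
        rw [neg_I_pow_odd]
        push_cast
        ring
    have hcut : ∀ (M : ℝ[X]), ∀ j ∈ Finset.range r,
        (-1) ^ j * extCellIntegral s (2 * r) R (2 * j + 1) M = cutPeriod s (2 * r) M j :=
      fun M j hj => by
        rw [Finset.mem_range] at hj
        rw [cutPeriod, extCellIntegral_eq (by omega) (by omega)]
    have hgap : ∀ (M : ℝ[X]), ∀ j ∈ Finset.range r, ∑ i ∈ Finset.range (j + 1),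
        (-1) ^ i * extCellIntegral s (2 * r) R (2 * i) M =
        extCellIntegral s (2 * r) R 0 M + gapSum s (2 * r) M j := fun M j hj => by
      rw [Finset.mem_range] at hj
      rw [gapSum, Finset.range_eq_Ico, Finset.sum_eq_sum_Ico_succ_bot (by omega), pow_zero, one_mul,
        mul_zero]
      congr 1
      refine Finset.sum_congr rfl fun i hi => ?_
      simp only [Finset.mem_Icc] at hi
      rw [extCellIntegral_eq (by omega) (by omega)]
    rw [sum_im_mul_eq _ _ (fun j => by rw [him, Complex.ofReal_im])
      (fun j => by rw [hre, Complex.re_ofReal_mul, Complex.I_re, mul_zero])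
      (fun j => by rw [him, Complex.ofReal_im])
      (fun j => by rw [hre, Complex.re_ofReal_mul, Complex.I_re, mul_zero])]
    simp only [him, hre, Complex.ofReal_re, Complex.im_ofReal_mul, Complex.I_im, mul_one,
      Finset.sum_neg_distrib]
    rw [Finset.sum_congr rfl (hcut Q), htQ, neg_zero, zero_mul, zero_add, ← Finset.sum_neg_distrib]
    have hterm : ∀ j ∈ Finset.range r,
        -(-((-1) ^ j * extCellIntegral s (2 * r) R (2 * j + 1) N) *
            ∑ i ∈ Finset.range (j + 1), (-1) ^ i * extCellIntegral s (2 * r) R (2 * i) Q -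
          -((-1) ^ j * extCellIntegral s (2 * r) R (2 * j + 1) Q) *
            ∑ i ∈ Finset.range (j + 1), (-1) ^ i * extCellIntegral s (2 * r) R (2 * i) N) =
        (cutPeriod s (2 * r) N j * gapSum s (2 * r) Q j -
          cutPeriod s (2 * r) Q j * gapSum s (2 * r) N j) +
        (extCellIntegral s (2 * r) R 0 Q * cutPeriod s (2 * r) N j -
          extCellIntegral s (2 * r) R 0 N * cutPeriod s (2 * r) Q j) := fun j hj => by
      rw [hcut N j hj, hcut Q j hj, hgap N j hj, hgap Q j hj]
      ring
    rw [Finset.sum_congr rfl hterm, Finset.sum_add_distrib, Finset.sum_sub_distrib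
      (fun j => extCellIntegral s (2 * r) R 0 Q * _), ← Finset.mul_sum, ← Finset.mul_sum, htQ, htN]
    ring
  have hflat := hprod.semicircleIntegral_eq h.anti.injOn hR hY1 hY2
  rw [zero_sub, zero_add] at hflat
  -- On the semicircle, split off the constant `r` from the second form and integrate by parts.
  have hzΦ : semicircleIntegral 0 R (fun z => Φ z + polyQuot s (2 * r) (X * Q) z) =
      (-R : ℝ) * Φ (-R : ℝ) - (R : ℝ) * Φ (R : ℝ) := by
    obtain ⟨m, hm, hmle⟩ := exists_le_norm_rootProd s (2 * r) hR hY1 hY2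
    obtain ⟨C₁, hC₁0, hC₁⟩ := hq.exists_norm_primitive_le h.anti.injOn hΦ (|0| + |R| + 1)
    obtain ⟨C₂, hC₂⟩ := hzq.bound (|0| + |R| + 1)
    have hlim : ∀ x : ℝ, rootProd s (2 * r) x ≠ 0 →
        Tendsto (fun δ : ℝ => ((x : ℂ) + δ * Complex.I) * Φ ((x : ℂ) + δ * Complex.I)) (𝓝[>] 0)
          (𝓝 (x * Φ x)) := fun x hx => (tendsto_add_mul_I _).mul (hrad x hx)
    have l1 := hlim _ hY1
    have l2 := hlim _ hY2
    rw [zero_sub] at l1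
    rw [zero_add] at l2
    refine semicircleIntegral_eq_sub (Ψ := fun z => z * Φ z) (C := C₁ + |C₂| * m⁻¹) hR
      (hΦc.add hzq.diff.continuousOn) (fun z hz => ?_) (fun θ hθ δ hδ => ?_) (by rwa [zero_sub])
      (by rwa [zero_add])
    · rw [hzq_eq]
      simpa using (hasDerivAt_id' z).fun_mul (hΦ z hz)
    · have h0 := circleMap_im_nonneg (c := 0) hR hθ
      have him : 0 < (circleMap ((0 : ℝ) : ℂ) R θ + δ * Complex.I).im := by
        simp only [Complex.add_im, Complex.mul_im, Complex.ofReal_re, Complex.ofReal_im,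
          Complex.I_re, Complex.I_im]
        linarith [hδ.1]
      have hn : ‖circleMap ((0 : ℝ) : ℂ) R θ + δ * Complex.I‖ ≤ |0| + |R| + 1 :=
        (norm_add_le _ _).trans (add_le_add (norm_circleMap_le _ _ _)
          (by simp [abs_of_pos hδ.1, hδ.2.le]))
      refine (norm_add_le _ _).trans (add_le_add (hC₁ _ him hn) ((hC₂ _ him hn).trans ?_))
      have := hmle θ hθ δ hδ.1.le
      gcongr
      exact le_abs_self _
  have hzΦim : (semicircleIntegral 0 R (fun z => Φ z + polyQuot s (2 * r) (X * Q) z)).im = 0 := by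
    have h1 := hint (-R) R (by rwa [zero_sub] at hY1) hY2'
    have h2 := h.im_integral_polyQuot Q hR hsR
    rw [htQ, neg_zero, h1, hΦR, zero_sub, Complex.neg_im, neg_eq_zero] at h2
    rw [hzΦ, hΦR, mul_zero, sub_zero, Complex.im_ofReal_mul, h2, mul_zero]
  obtain ⟨C₂, hC₂⟩ := hzq.exists_bound_semicircle (c := 0) hR hY1 hY2
  obtain ⟨C₃, hC₃⟩ := hgN.exists_bound_semicircle (c := 0) hR hY1 hY2
  have hgle : ∀ θ ∈ Set.Ioo 0 Real.pi,
      ‖polyQuot s (2 * r) N (circleMap ((0 : ℝ) : ℂ) R θ) - r‖ ≤ η := fun θ hθ =>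
    hg _ (circleMap_im_pos hR hθ) (by
      rw [Complex.ofReal_zero, norm_circleMap_zero]
      exact le_abs_self R)
  have hC0 : 0 ≤ Real.pi * C / R :=
    (norm_nonneg _).trans (hΦle (Real.pi / 2) ⟨by positivity, by linarith [Real.pi_pos]⟩)
  have hErr : ∀ θ ∈ Set.Ioo 0 Real.pi, ‖Φ (circleMap ((0 : ℝ) : ℂ) R θ) *
      (polyQuot s (2 * r) N (circleMap ((0 : ℝ) : ℂ) R θ) - r)‖ ≤ Real.pi * C / R * η :=
    fun θ hθ => by
      rw [norm_mul]
      exact mul_le_mul (hΦle θ hθ) (hgle θ hθ) (norm_nonneg _) hC0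
  have hsplit : semicircleIntegral 0 R (fun z => Φ z * polyQuot s (2 * r) N z) =
      r * semicircleIntegral 0 R (fun z => Φ z + polyQuot s (2 * r) (X * Q) z) -
      r * semicircleIntegral 0 R (polyQuot s (2 * r) (X * Q)) +
      semicircleIntegral 0 R (fun z => Φ z * (polyQuot s (2 * r) N z - r)) := by
    have i1 := intervalIntegrable_semicircle (c := 0)
      (φ := fun z => Φ z + polyQuot s (2 * r) (X * Q) z) hR
      (hΦc.add hzq.diff.continuousOn)
      (fun θ hθ => (norm_add_le _ _).trans (add_le_add (hΦle θ hθ) (hC₂ θ hθ)))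
    have i2 := intervalIntegrable_semicircle (c := 0) hR hzq.diff.continuousOn hC₂
    have i3 := intervalIntegrable_semicircle (c := 0)
      (φ := fun z => Φ z * (polyQuot s (2 * r) N z - r)) hR
      (hΦc.mul (hgN.diff.continuousOn.sub continuousOn_const)) hErr
    unfold semicircleIntegral
    rw [← intervalIntegral.integral_const_mul, ← intervalIntegral.integral_const_mul,
      ← intervalIntegral.integral_sub (i1.const_mul _) (i2.const_mul _),
      ← intervalIntegral.integral_add ((i1.const_mul _).sub (i2.const_mul _)) i3]
    exact intervalIntegral.integral_congr fun θ _ => by ring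
  have hnorm : ‖semicircleIntegral 0 R (fun z => Φ z * (polyQuot s (2 * r) N z - r))‖ ≤
      Real.pi ^ 2 * C * η := by
    have := intervalIntegral.norm_integral_le_of_norm_le_const_ae (a := 0) (b := Real.pi)
      (C := Real.pi * C * η) (f := fun θ : ℝ => circleMap 0 R θ * Complex.I *
        (Φ (circleMap ((0 : ℝ) : ℂ) R θ) * (polyQuot s (2 * r) N (circleMap ((0 : ℝ) : ℂ) R θ) - r)))
      ?_
    · rw [sub_zero, abs_of_pos Real.pi_pos] at this
      refine this.trans (le_of_eq ?_)
      ring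
    · filter_upwards [MeasureTheory.Measure.ae_ne MeasureTheory.volume Real.pi] with θ hne hθ
      rw [Set.uIoc_of_le Real.pi_pos.le] at hθ
      have := hErr θ ⟨hθ.1, lt_of_le_of_ne hθ.2 hne⟩
      rw [norm_mul, norm_mul, norm_circleMap_zero, Complex.norm_I, mul_one, abs_of_pos hR]
      calc _ ≤ R * (Real.pi * C / R * η) := by gcongr
        _ = _ := by field_simp
  have hfinal : ∑ j ∈ Finset.range r, (cutPeriod s (2 * r) N j * gapSum s (2 * r) Q j -
        cutPeriod s (2 * r) Q j * gapSum s (2 * r) N j) -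
      r * (semicircleIntegral 0 R (polyQuot s (2 * r) (X * Q))).im =
      -(semicircleIntegral 0 R (fun z => Φ z * (polyQuot s (2 * r) N z - r))).im := by
    rw [← hbdry]
    have e1 := congrArg Complex.im hflat
    rw [hsplit, Complex.neg_im, Complex.add_im, Complex.sub_im, ← Complex.ofReal_natCast,
      Complex.im_ofReal_mul, Complex.im_ofReal_mul, hzΦim, mul_zero] at e1
    rw [← Complex.ofReal_natCast]
    linarith
  rw [hfinal, abs_neg]
  exact (Complex.abs_im_le_norm _).trans hnorm

/-- **Riemann bilinear relation** for the differential `N dz / y`, `N = z p'`, and a holomorphic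
differential `Q dz / y`. -/
theorem bilinear (h : IsBranchSeq r p T s) (hr : 2 ≤ r) (hc : p.coeff (r - 1) = 0) {Q : ℝ[X]}
    (hQ : Q.natDegree ≤ r - 2) :
    ∑ j ∈ Finset.range r,
      (cutPeriod s (2 * r) (X * derivative p) j * gapSum s (2 * r) Q j -
        cutPeriod s (2 * r) Q j * gapSum s (2 * r) (X * derivative p) j) =
      Real.pi * r * Q.coeff (r - 2) := by
  set N := X * derivative p with hN
  have hq := hasBoundaryValues_polyQuot s (2 * r) Q
  have hzq := hasBoundaryValues_polyQuot s (2 * r) (X * Q)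
  have hg := hasBoundaryValues_polyQuot s (2 * r) N
  have hzq_eq : ∀ z, polyQuot s (2 * r) (X * Q) z = z * polyQuot s (2 * r) Q z := fun z => by
    simp [polyQuot, mul_div_assoc]
  have hinf := h.tendsto_mul_polyQuot_sub hr hc
  have htQ : ∑ j ∈ Finset.range r, cutPeriod s (2 * r) Q j = 0 :=
    h.sum_cutPeriod_eq_zero Q 0 (by simpa using tendsto_mul_polyQuot s hr hQ)
  have htN : ∑ j ∈ Finset.range r, cutPeriod s (2 * r) N j = 0 :=
    h.sum_cutPeriod_eq_zero N r (by simpa using hinf)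
  obtain ⟨R₀, hR₀, hbd⟩ := exists_radius s (2 * r)
  have hκ := tendsto_sq_mul_polyQuot s hr hQ
  obtain ⟨R₁, hR₁, hC⟩ := exists_radius_of_eventually
    (hκ.norm.eventually_lt_const (lt_add_one ‖(Q.coeff (r - 2) : ℂ)‖))
  set C := ‖(Q.coeff (r - 2) : ℂ)‖ + 1
  have hg0 : Tendsto (fun z : ℂ => polyQuot s (2 * r) N z - r) upperInfty (𝓝 0) := by
    have := tendsto_inv_upperInfty.mul hinf
    rw [mul_zero] at this
    refine this.congr' ?_
    filter_upwards [eventually_ne_zero_upperInfty] with z hz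
    field_simp
    rfl
  have hzqlim : Tendsto (fun R : ℝ => semicircleIntegral 0 R (polyQuot s (2 * r) (X * Q))) atTop
      (𝓝 (Real.pi * Complex.I * Q.coeff (r - 2))) := by
    refine tendsto_semicircleIntegral hzq.diff.continuousOn (hκ.congr fun z => ?_)
    rw [hzq_eq]
    ring
  have hlim : Tendsto (fun R : ℝ => r * (semicircleIntegral 0 R (polyQuot s (2 * r) (X * Q))).im)
      atTop (𝓝 (Real.pi * r * Q.coeff (r - 2))) := by
    have := ((Complex.continuous_im.tendsto _).comp hzqlim).const_mul (r : ℝ)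
    rw [show (Real.pi : ℂ) * Complex.I * (Q.coeff (r - 2) : ℂ) =
      ((Real.pi * Q.coeff (r - 2) : ℝ) : ℂ) * Complex.I by push_cast; ring,
      Complex.im_ofReal_mul, Complex.I_im, mul_one] at this
    rw [show Real.pi * r * Q.coeff (r - 2) = r * (Real.pi * Q.coeff (r - 2)) by ring]
    exact this
  refine tendsto_nhds_unique ?_ hlim
  rw [Metric.tendsto_atTop]
  intro ε hε
  have hCpos : 0 < C := by positivity
  have hη : 0 < ε / (2 * Real.pi ^ 2 * C) := by positivity
  obtain ⟨R₂, hR₂, hgη⟩ := exists_radius_of_eventually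
    (hg0.norm.eventually_lt_const (by rwa [norm_zero]))
  refine ⟨max R₀ (max R₁ R₂), fun R hR => ?_⟩
  simp only [ge_iff_le, max_le_iff] at hR
  have := h.abs_bilinear_sub_le Q N htQ htN (hR₀.trans_le hR.1) (hbd R hR.1)
    (fun z hz hzR => (hC z hz (hR.2.1.trans hzR)).le) fun z hz hzR => (hgη z hz (hR.2.2.trans hzR)).le
  rw [Real.dist_eq, abs_sub_comm]
  refine this.trans_lt ?_
  have e : Real.pi ^ 2 * C * (ε / (2 * Real.pi ^ 2 * C)) = ε / 2 := by field_simp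
  rw [e]
  linarith

end IsBranchSeq

end SeibergWitten

namespace SeibergWitten

/-! ### The sheet on which `y` is approximated by `P` -/

namespace IsBranchSeq

variable {r : ℕ} {p : ℝ[X]} {T : ℝ} {s : ℕ → ℝ}

theorem val_odd (h : IsBranchSeq r p T s) {j : ℕ} (hj : j < r) :
    p.eval (s (2 * j + 1)) = (-1) ^ j * T := by
  rw [h.val _ (by simp; omega), show (2 * j + 1) / 2 = j by omega]

theorem val_even (h : IsBranchSeq r p T s) {j : ℕ} (hj : j < r) :
    p.eval (s (2 * j + 2)) = -((-1) ^ j * T) := by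
  rw [h.val _ (by simp; omega), show (2 * j + 2) / 2 = j + 1 by omega, pow_succ]
  ring

theorem cut_lt (h : IsBranchSeq r p T s) {j : ℕ} (hj : j < r) : s (2 * j + 2) < s (2 * j + 1) :=
  h.anti ⟨by omega, by omega⟩ ⟨by omega, by omega⟩ (by omega)

/-- Every value in `[-T, T]` is taken on every cut. -/
theorem exists_eval_eq (h : IsBranchSeq r p T s) {c : ℝ} (hc : |c| ≤ T) {j : ℕ} (hj : j < r) :
    ∃ x ∈ Set.Icc (s (2 * j + 2)) (s (2 * j + 1)), p.eval x = c := by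
  have hivt := intermediate_value_uIcc (a := s (2 * j + 2)) (b := s (2 * j + 1))
    (f := fun x => p.eval x) p.continuous.continuousOn
  rw [h.val_odd hj, h.val_even hj, Set.uIcc_of_le (h.cut_lt hj).le] at hivt
  have hmem : c ∈ Set.uIcc (-((-1) ^ j * T)) ((-1) ^ j * T) := by
    have := abs_le.mp hc
    rcases neg_one_pow_eq_or ℝ j with hj | hj <;> rw [hj, Set.mem_uIcc]
    · left; constructor <;> linarith
    · right; constructor <;> linarith
  obtain ⟨x, hx, hxc⟩ := hivt hmem
  exact ⟨x, hx, hxc⟩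

/-- Points of different cuts are different, in decreasing order. -/
theorem lt_of_mem_cut (h : IsBranchSeq r p T s) {i j : ℕ} (hij : i < j) (hj : j < r) {x y : ℝ}
    (hx : x ∈ Set.Icc (s (2 * i + 2)) (s (2 * i + 1)))
    (hy : y ∈ Set.Icc (s (2 * j + 2)) (s (2 * j + 1))) : y < x :=
  hy.2.trans_lt ((h.anti ⟨by omega, by omega⟩ ⟨by omega, by omega⟩
    (show 2 * i + 2 < 2 * j + 1 by omega)).trans_le hx.1)

theorem sub_C_eq_prod (h : IsBranchSeq r p T s) (hr : 1 ≤ r) {c : ℝ} {e : ℕ → ℝ}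
    (he : ∀ j < r, e j ∈ Set.Icc (s (2 * j + 2)) (s (2 * j + 1)) ∧ p.eval (e j) = c) :
    p - C c = ∏ j ∈ Finset.range r, (X - C (e j)) := by
  have hdeg : 0 < p.degree := by
    rw [degree_eq_natDegree h.monic.ne_zero, h.natDegree]
    exact_mod_cast hr
  refine monic_eq_prod_of_roots (h.monic.sub_of_left (degree_C_le.trans_lt hdeg)) _ _ ?_ ?_ ?_
  · intro i hi j hj hij
    rw [Finset.mem_coe, Finset.mem_range] at hi hj
    rcases lt_trichotomy i j with hlt | heq | hlt
    · exact absurd hij (h.lt_of_mem_cut hlt hj (he i hi).1 (he j hj).1).ne'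
    · exact heq
    · exact absurd hij (h.lt_of_mem_cut hlt hi (he j hj).1 (he i hi).1).ne
  · intro j hj
    rw [eval_sub, eval_C, (he j (Finset.mem_range.mp hj)).2, sub_self]
  · rw [natDegree_sub_C, h.natDegree, Finset.card_range]

/-- Off the real axis `p` does not take values in `[-T, T]`: all preimages are on the cuts. -/
theorem aeval_ne_ofReal (h : IsBranchSeq r p T s) (hr : 1 ≤ r) {c : ℝ} (hc : |c| ≤ T) {z : ℂ}
    (hz : z.im ≠ 0) : aeval z p ≠ (c : ℂ) := by
  intro hzc
  choose! e he using fun (j : ℕ) (hj : j < r) => h.exists_eval_eq hc hj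
  have := congrArg (aeval z) (h.sub_C_eq_prod hr he)
  rw [map_sub, aeval_C, map_prod, hzc, Complex.coe_algebraMap, sub_self, eq_comm,
    Finset.prod_eq_zero_iff] at this
  obtain ⟨j, -, hj⟩ := this
  rw [map_sub, aeval_X, aeval_C, Complex.coe_algebraMap, sub_eq_zero] at hj
  simp [hj] at hz

theorem aeval_ne_zero (h : IsBranchSeq r p T s) (hr : 1 ≤ r) {z : ℂ} (hz : z.im ≠ 0) :
    aeval z p ≠ 0 := by
  have := h.aeval_ne_ofReal hr (c := 0) (by simpa using h.pos.le) hz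
  simpa using this

/-- The argument of the square root in `swY` meets the negative real axis only where `p` takes a value
in `[-T, T]`, hence only on the real axis. -/
theorem one_sub_mem_slitPlane (h : IsBranchSeq r p T s) (hr : 1 ≤ r) {z : ℂ} (hz : z.im ≠ 0) :
    1 - (T : ℂ) ^ 2 / aeval z p ^ 2 ∈ Complex.slitPlane := by
  rw [Complex.mem_slitPlane_iff_not_le_zero]
  intro hle
  have hp := h.aeval_ne_zero hr hz
  obtain ⟨hre, him⟩ := Complex.le_def.mp hle
  set w := 1 - (T : ℂ) ^ 2 / aeval z p ^ 2 with hw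
  have hwr : w = (w.re : ℂ) := Complex.ext (by simp) (by simpa using him)
  have hden : 1 ≤ 1 - w.re := by simpa using hre
  set q := T / √(1 - w.re) with hq
  have hsq : 1 ≤ √(1 - w.re) := Real.one_le_sqrt.mpr hden
  have hqT : |q| ≤ T := by
    rw [hq, abs_of_nonneg (div_nonneg h.pos.le (by positivity))]
    exact div_le_self h.pos.le hsq
  have hq2 : q ^ 2 * (1 - w.re) = T ^ 2 := by
    rw [hq, div_pow, Real.sq_sqrt (by linarith)]
    field_simp
  have hpq : aeval z p ^ 2 = (q : ℂ) ^ 2 := by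
    have h1 : (T : ℂ) ^ 2 = (1 - (w.re : ℂ)) * aeval z p ^ 2 := by
      rw [← hwr, hw]
      field_simp
      ring
    have h2 : ((q : ℂ)) ^ 2 * (1 - (w.re : ℂ)) = (T : ℂ) ^ 2 := by exact_mod_cast hq2
    have h3 : (1 - (w.re : ℂ)) ≠ 0 := by
      have : (1 - w.re) ≠ 0 := by linarith
      exact_mod_cast this
    have : (1 - (w.re : ℂ)) * (aeval z p ^ 2 - (q : ℂ) ^ 2) = 0 := by linear_combination -h1 - h2
    rcases mul_eq_zero.mp this with h4 | h4
    · exact absurd h4 h3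
    · exact sub_eq_zero.mp h4
  rcases sq_eq_sq_iff_eq_or_eq_neg.mp hpq with h1 | h1
  · exact h.aeval_ne_ofReal hr hqT hz h1
  · exact h.aeval_ne_ofReal hr (c := -q) (by rwa [abs_neg]) hz (by rw [h1]; push_cast; rfl)

end IsBranchSeq

/-- The square root of `p ^ 2 - T ^ 2` that is approximated by `p`. -/
noncomputable def sheetRoot (p : ℝ[X]) (T : ℝ) (z : ℂ) : ℂ :=
  aeval z p * (1 - (T : ℂ) ^ 2 / aeval z p ^ 2).sqrt

theorem sheetRoot_sq {p : ℝ[X]} (T : ℝ) {z : ℂ} (hz : aeval z p ≠ 0) :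
    sheetRoot p T z ^ 2 = aeval z p ^ 2 - (T : ℂ) ^ 2 := by
  rw [sheetRoot, mul_pow, csqrt_sq]
  field_simp

namespace IsBranchSeq

variable {r : ℕ} {p : ℝ[X]} {T : ℝ} {s : ℕ → ℝ}

theorem continuousAt_sheetRoot {z : ℂ} (hz : aeval z p ≠ 0)
    (hs : 1 - (T : ℂ) ^ 2 / aeval z p ^ 2 ∈ Complex.slitPlane) :
    ContinuousAt (sheetRoot p T) z := by
  have hp : ContinuousAt (fun z : ℂ => aeval z p) z := p.continuous_aeval.continuousAt
  refine hp.mul (ContinuousAt.comp (f := fun z : ℂ => 1 - (T : ℂ) ^ 2 / aeval z p ^ 2)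
    (Complex.differentiableAt_sqrt hs).continuousAt ?_)
  exact continuousAt_const.sub (continuousAt_const.div (hp.pow 2) (pow_ne_zero 2 hz))

instance : upperInfty.NeBot :=
  (tendsto_circleMap_upperInfty (θ := Real.pi / 2)
    ⟨by positivity, by linarith [Real.pi_pos]⟩).neBot

theorem tendsto_sheetRoot_div (h : IsBranchSeq r p T s) (hr : 1 ≤ r) :
    Tendsto (fun z : ℂ => sheetRoot p T z / z ^ r) upperInfty (𝓝 1) := by
  have hp : Tendsto (fun z : ℂ => aeval z p / z ^ r) upperInfty (𝓝 1) := by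
    have := tendsto_aeval_div_pow p h.natDegree.le
    rwa [show p.coeff r = 1 by rw [← h.natDegree]; exact h.monic] at this
  have h1 : Tendsto (fun z : ℂ => 1 - (T : ℂ) ^ 2 * (z⁻¹ ^ r) ^ 2 / (aeval z p / z ^ r) ^ 2)
      upperInfty (𝓝 (1 - (T : ℂ) ^ 2 * (0 ^ r) ^ 2 / 1 ^ 2)) :=
    ((((tendsto_inv_upperInfty.pow r).pow 2).const_mul _).div (hp.pow 2) (by simp)).const_sub 1
  rw [zero_pow (by omega : r ≠ 0), zero_pow two_ne_zero, mul_zero, zero_div, sub_zero] at h1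
  have h2 := hp.mul ((Complex.differentiableAt_sqrt (z := 1) (by simp)).continuousAt.tendsto.comp h1)
  rw [Complex.sqrt_one, mul_one] at h2
  refine h2.congr' ?_
  filter_upwards [eventually_ne_zero_upperInfty, eventually_im_pos] with z hz him
  have := h.aeval_ne_zero hr him.ne'
  have e : (T : ℂ) ^ 2 * (z⁻¹ ^ r) ^ 2 / (aeval z p / z ^ r) ^ 2 = (T : ℂ) ^ 2 / aeval z p ^ 2 := by
    rw [inv_pow]
    field_simp
  simp only [Function.comp, e, sheetRoot]
  ring

/-- On the upper half-plane, the sheet of `y` that is approximated by `p` is the product of the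
principal roots over the branch points. -/
theorem sheetRoot_eq_rootProd (h : IsBranchSeq r p T s) (hr : 1 ≤ r) {z : ℂ} (hz : 0 < z.im) :
    sheetRoot p T z = rootProd s (2 * r) z := by
  have hor := convex_upperHalf.isPreconnected.eq_or_eq_neg_of_sq_eq
    (f := sheetRoot p T) (g := rootProd s (2 * r))
    (fun z hz => (continuousAt_sheetRoot (h.aeval_ne_zero hr (ne_of_gt hz))
      (h.one_sub_mem_slitPlane hr (ne_of_gt hz))).continuousWithinAt)
    (fun z hz => (differentiableAt_rootProd s (2 * r) hz).continuousAt.continuousWithinAt)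
    (fun z hz => by
      simp only [Pi.pow_apply]
      rw [sheetRoot_sq T (h.aeval_ne_zero hr (ne_of_gt hz)), h.rootProd_sq hr])
    (fun hz => rootProd_ne_zero_of_im_pos s (2 * r) hz)
  rcases hor with h1 | h1
  · exact h1 hz
  · exfalso
    have h2 := (tendsto_rootProd_div s r).neg
    have h3 : Tendsto (fun z : ℂ => sheetRoot p T z / z ^ r) upperInfty (𝓝 (-1)) := by
      refine h2.congr' ?_
      filter_upwards [eventually_im_pos] with z hz
      rw [h1 hz, Pi.neg_apply, neg_div]
    have := tendsto_nhds_unique h3 (h.tendsto_sheetRoot_div hr)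
    norm_num at this

theorem eval_sq_sub (h : IsBranchSeq r p T s) (hr : 1 ≤ r) (x : ℝ) :
    p.eval x ^ 2 - T ^ 2 = ∏ k ∈ Finset.Icc 1 (2 * r), (x - s k) := by
  have := congrArg (eval x) (h.sq_sub_eq_prod hr)
  simpa [eval_prod] using this

theorem sq_lt_of_inCell_even (h : IsBranchSeq r p T s) (hr : 1 ≤ r) {m : ℕ} {x : ℝ}
    (hx : InCell s (2 * r) (2 * m) x) : T ^ 2 < p.eval x ^ 2 := by
  rw [← sub_pos, h.eval_sq_sub hr, prod_sub_eq_neg_one_pow, hx.countAbove_eq h.anti, pow_mul]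
  simp only [even_two, Even.neg_pow, one_pow, one_mul, abs_pos]
  rw [Finset.prod_ne_zero_iff]
  exact fun k hk => sub_ne_zero.mpr (hx.ne h.anti k hk)

theorem sq_lt_of_inCell_odd (h : IsBranchSeq r p T s) (hr : 1 ≤ r) {m : ℕ} {x : ℝ}
    (hx : InCell s (2 * r) (2 * m + 1) x) : p.eval x ^ 2 < T ^ 2 := by
  rw [← sub_neg, h.eval_sq_sub hr, prod_sub_eq_neg_one_pow, hx.countAbove_eq h.anti, pow_succ,
    pow_mul]
  simp only [even_two, Even.neg_pow, one_pow, one_mul, neg_mul, neg_lt_zero, abs_pos]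
  rw [Finset.prod_ne_zero_iff]
  exact fun k hk => sub_ne_zero.mpr (hx.ne h.anti k hk)

/-- In the gaps, where `swY` is continuous, the two square roots agree as well. -/
theorem sheetRoot_eq_rootProd_of_inCell (h : IsBranchSeq r p T s) (hr : 1 ≤ r) {m : ℕ} {x : ℝ}
    (hx : InCell s (2 * r) (2 * m) x) : sheetRoot p T x = rootProd s (2 * r) x := by
  have hlt := h.sq_lt_of_inCell_even hr hx
  have hp0 : p.eval x ≠ 0 := fun h0 => by
    rw [h0] at hlt
    have := sq_nonneg T
    linarith [zero_pow (M₀ := ℝ) two_ne_zero]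
  have hp : aeval (x : ℂ) p ≠ 0 := by
    rw [aeval_ofReal_eq]
    exact_mod_cast hp0
  have hslit : 1 - (T : ℂ) ^ 2 / aeval (x : ℂ) p ^ 2 ∈ Complex.slitPlane := by
    rw [aeval_ofReal_eq, show 1 - (T : ℂ) ^ 2 / ((p.eval x : ℝ) : ℂ) ^ 2 =
      ((1 - T ^ 2 / p.eval x ^ 2 : ℝ) : ℂ) by push_cast; rfl, Complex.ofReal_mem_slitPlane, sub_pos,
      div_lt_one (by positivity)]
    exact hlt
  refine tendsto_nhds_unique ((continuousAt_sheetRoot hp hslit).tendsto.comp (tendsto_add_mul_I _))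
    ((tendsto_rootProd_radial s (2 * r) x).congr' ?_)
  filter_upwards [self_mem_nhdsWithin] with δ hδ
  exact (h.sheetRoot_eq_rootProd hr (by simpa using hδ)).symm

theorem sheetRoot_conj (h : IsBranchSeq r p T s) (hr : 1 ≤ r) {z : ℂ} (hz : z.im ≠ 0) :
    sheetRoot p T ((starRingEnd ℂ) z) = (starRingEnd ℂ) (sheetRoot p T z) := by
  rw [sheetRoot, sheetRoot, aeval_conj, map_mul, ← csqrt_conj (h.one_sub_mem_slitPlane hr hz)]
  simp

end IsBranchSeq

end SeibergWitten

namespace SeibergWitten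

/-! ### Periods of the Seiberg-Witten differential as integrals over cells -/

/-- The polynomial `v_0 z ^ (r - 2) + ⋯ + v_(r - 2)`. -/
noncomputable def lowPoly (r : ℕ) (v : Fin (r - 1) → ℝ) : ℝ[X] :=
  ∑ i : Fin (r - 1), C (v i) * X ^ (r - 2 - (i : ℕ))

/-- The real polynomial `P(z) = z ^ r + v_0 z ^ (r - 2) + ⋯ + v_(r - 2)`. -/
noncomputable def realPoly (r : ℕ) (v : Fin (r - 1) → ℝ) : ℝ[X] := X ^ r + lowPoly r v

theorem natDegree_lowPoly_le (r : ℕ) (v : Fin (r - 1) → ℝ) : (lowPoly r v).natDegree ≤ r - 2 :=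
  natDegree_sum_le_of_forall_le _ _ fun i _ => (natDegree_C_mul_X_pow_le _ _).trans (by omega)

theorem sub_one_pos {r : ℕ} (hr : 2 ≤ r) : 0 < r - 1 := Nat.sub_pos_of_lt hr

theorem coeff_lowPoly {r : ℕ} (hr : 2 ≤ r) (v : Fin (r - 1) → ℝ) :
    (lowPoly r v).coeff (r - 2) = v ⟨0, sub_one_pos hr⟩ := by
  rw [lowPoly, finsetSum_coeff, Finset.sum_eq_single ⟨0, sub_one_pos hr⟩]
  · simp
  · intro i _ hi
    have hi' : (i : ℕ) ≠ 0 := fun h => hi (Fin.ext h)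
    rw [coeff_C_mul_X_pow, if_neg]
    have := i.2
    omega
  · simp

theorem monic_realPoly {r : ℕ} (hr : 2 ≤ r) (v : Fin (r - 1) → ℝ) : (realPoly r v).Monic :=
  monic_X_pow_add (degree_le_natDegree.trans_lt
    (by exact_mod_cast (natDegree_lowPoly_le r v).trans_lt (by omega)))

theorem natDegree_realPoly {r : ℕ} (hr : 2 ≤ r) (v : Fin (r - 1) → ℝ) :
    (realPoly r v).natDegree = r := by
  rw [realPoly, natDegree_add_eq_left_of_natDegree_lt, natDegree_X_pow]
  rw [natDegree_X_pow]
  exact (natDegree_lowPoly_le r v).trans_lt (by omega)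

theorem coeff_realPoly_sub_one {r : ℕ} (hr : 2 ≤ r) (v : Fin (r - 1) → ℝ) :
    (realPoly r v).coeff (r - 1) = 0 := by
  rw [realPoly, coeff_add, coeff_X_pow, if_neg (by omega), zero_add,
    coeff_eq_zero_of_natDegree_lt ((natDegree_lowPoly_le r v).trans_lt (by omega))]

theorem swPoly_eq_map (r : ℕ) (v : Fin (r - 1) → ℝ) :
    swPoly r (fun i => (v i : ℂ)) = (realPoly r v).map (algebraMap ℝ ℂ) := by
  simp [swPoly, realPoly, lowPoly, Polynomial.map_sum]

theorem eval_swPoly (r : ℕ) (v : Fin (r - 1) → ℝ) (z : ℂ) :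
    (swPoly r fun i => (v i : ℂ)).eval z = aeval z (realPoly r v) := by
  rw [swPoly_eq_map, eval_map_algebraMap]

theorem eval_derivative_swPoly (r : ℕ) (v : Fin (r - 1) → ℝ) (z : ℂ) :
    (swPoly r fun i => (v i : ℂ)).derivative.eval z = aeval z (derivative (realPoly r v)) := by
  rw [swPoly_eq_map, derivative_map, eval_map_algebraMap]

theorem swForm_eq (r : ℕ) (v : Fin (r - 1) → ℝ) (Λ : ℝ) (z : ℂ) :
    swForm r (fun i => (v i : ℂ)) Λ z = -(1 / (2 * (Real.pi : ℂ))) *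
      (aeval z (X * derivative (realPoly r v)) / sheetRoot (realPoly r v) (2 * Λ ^ r) z) := by
  rw [swForm, eval_derivative_swPoly, swY, eval_swPoly, sheetRoot, map_mul, aeval_X]
  congr 5
  push_cast
  ring

/-- The sequence of all branch points in decreasing order:
`z_1⁺ > z_1⁻ > z_2⁻ > z_2⁺ > z_3⁺ > ⋯`. -/
noncomputable def branchSeq (zp zm : ℕ → ℝ) (k : ℕ) : ℝ := gapEnd zp zm (k / 2 + 1) ((k + 1) / 2)

theorem branchSeq_odd (zp zm : ℕ → ℝ) (j : ℕ) :
    branchSeq zp zm (2 * j + 1) = gapEnd zp zm (j + 1) (j + 1) := by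
  rw [branchSeq, show (2 * j + 1) / 2 + 1 = j + 1 by omega, show (2 * j + 1 + 1) / 2 = j + 1 by omega]

theorem branchSeq_even (zp zm : ℕ → ℝ) (j : ℕ) :
    branchSeq zp zm (2 * j + 2) = gapEnd zp zm (j + 2) (j + 1) := by
  rw [branchSeq, show (2 * j + 2) / 2 + 1 = j + 2 by omega, show (2 * j + 2 + 1) / 2 = j + 1 by omega]

/-- The numbering `z_1⁺ > z_1⁻ > z_2⁻ > z_2⁺ > ⋯` makes the values of `P` follow the pattern of
`IsBranchSeq`. -/
theorem IsRealBranchPoints.isBranchSeq {r : ℕ} (hr : 2 ≤ r) {v : Fin (r - 1) → ℝ} {Λ : ℝ}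
    {zp zm : ℕ → ℝ} (h : IsRealBranchPoints r (fun i => (v i : ℂ)) Λ zp zm) :
    IsBranchSeq r (realPoly r v) (2 * Λ ^ r) (branchSeq zp zm) where
  monic := monic_realPoly hr v
  natDegree := natDegree_realPoly hr v
  pos := mul_pos two_pos (pow_pos h.scale_pos r)
  anti := by
    have hstep : ∀ k, 1 ≤ k → k + 1 ≤ 2 * r →
        branchSeq zp zm (k + 1) < branchSeq zp zm k := by
      intro k h1 h2
      rcases Nat.even_or_odd' k with ⟨m, rfl | rfl⟩
      · obtain ⟨j, rfl⟩ : ∃ j, m = j + 1 := ⟨m - 1, by omega⟩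
        rw [branchSeq_odd, show 2 * (j + 1) = 2 * j + 2 by ring, branchSeq_even]
        exact h.gap (j + 2) (by simp; omega)
      · rw [branchSeq_odd, branchSeq_even]
        unfold gapEnd
        rcases Nat.even_or_odd m with hm | hm
        · rw [if_pos (hm.add even_two), if_neg (Nat.not_even_iff_odd.mpr hm.add_one)]
          exact h.cut_odd _ (by simp; omega) hm.add_one
        · rw [if_neg (Nat.not_even_iff_odd.mpr (hm.add_even even_two)), if_pos hm.add_one]
          exact h.cut_even _ (by simp; omega) hm.add_one
    intro i hi j hj hij
    obtain ⟨d, rfl⟩ : ∃ d, j = i + 1 + d := ⟨j - (i + 1), by omega⟩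
    clear hij
    induction d with
    | zero => exact hstep i hi.1 hj.2
    | succ d ih =>
      have hj2 := hj.2
      exact (hstep (i + 1 + d) (by omega) (by omega)).trans (ih ⟨by omega, by omega⟩)
  val k hk := by
    rw [Finset.mem_Icc] at hk
    have hmem : (k + 1) / 2 ∈ Finset.Icc 1 r := by simp; omega
    have hp : eval (zp ((k + 1) / 2)) (realPoly r v) = 2 * Λ ^ r := by
      have := h.eval_plus _ hmem
      rw [eval_swPoly, aeval_ofReal_eq] at this
      exact_mod_cast this
    have hm : eval (zm ((k + 1) / 2)) (realPoly r v) = -(2 * Λ ^ r) := by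
      have := h.eval_minus _ hmem
      rw [eval_swPoly, aeval_ofReal_eq] at this
      exact_mod_cast this
    unfold branchSeq gapEnd
    rcases Nat.even_or_odd (k / 2) with he | ho
    · rw [if_neg (Nat.not_even_iff_odd.mpr he.add_one), hp, he.neg_one_pow, one_mul]
    · rw [if_pos ho.add_one, hm, ho.neg_one_pow]
      ring

theorem exists_inCell {s : ℕ → ℝ} {n k : ℕ} (hs : StrictAntiOn s (Set.Icc 1 n)) (hk : k ≤ n) :
    ∃ x, InCell s n k x := by
  rcases Nat.eq_zero_or_pos k with rfl | hk0
  · exact ⟨s 1 + 1, hk, by omega, fun _ => by simp⟩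
  · rcases eq_or_lt_of_le hk with rfl | hkn
    · exact ⟨s k - 1, le_rfl, fun _ => by linarith, by omega⟩
    · have := hs ⟨hk0, hk⟩ ⟨by omega, hkn⟩ (Nat.lt_succ_self k)
      exact ⟨(s (k + 1) + s k) / 2, hk, fun _ => by simp at this ⊢; linarith,
        fun _ => by simp at this ⊢; linarith⟩

theorem InCell.lt {s : ℕ → ℝ} {n i j : ℕ} {x y : ℝ} (hs : StrictAntiOn s (Set.Icc 1 n))
    (hx : InCell s n i x) (hy : InCell s n j y) (hij : i < j) : y < x := by
  have h1 := hx.2.2 (by have := hy.1; omega)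
  have h2 := hy.2.1 (by omega)
  have h3 := hs.antitoneOn ⟨by omega, by have := hy.1; omega⟩ ⟨by omega, hy.1⟩
    (show i + 1 ≤ j from hij)
  linarith

namespace IsBranchSeq

variable {r : ℕ} {p : ℝ[X]} {T : ℝ} {s : ℕ → ℝ}

/-- The semicircle around a single cut computes the period over that cut. -/
theorem im_semicircleIntegral (h : IsBranchSeq r p T s) (N : ℝ[X]) {c ρ : ℝ} (hρ : 0 < ρ) {j : ℕ}
    (hx : InCell s (2 * r) (2 * j + 2) (c - ρ)) (hy : InCell s (2 * r) (2 * j) (c + ρ)) :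
    (semicircleIntegral c ρ (polyQuot s (2 * r) N)).im = cutPeriod s (2 * r) N j := by
  have := re_I_pow_mul_semicircleIntegral h.anti N hρ hx hy
  have hI : Complex.I ^ (2 * j + 1) = (((-1) ^ j : ℝ) : ℂ) * Complex.I := by
    rw [pow_succ, pow_mul, Complex.I_sq]
    push_cast
    rfl
  rw [hI, mul_assoc, Complex.re_ofReal_mul, Complex.I_mul_re] at this
  have hsq : ((-1 : ℝ) ^ j) * (-1) ^ j = 1 := by rw [← mul_pow]; simp
  rw [cutPeriod]
  linear_combination (-1 : ℝ) ^ j * (-this) - (semicircleIntegral c ρ (polyQuot s (2 * r) N)).im * hsq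

end IsBranchSeq

/-- The integral over a circle of a function that is real on the real axis is determined by the
upper half of the circle. -/
theorem circleIntegral_eq_of_conj {f : ℂ → ℂ} {c ρ : ℝ} (hρ : 0 < ρ)
    (hf : ∀ z : ℂ, 0 < z.im → f ((starRingEnd ℂ) z) = (starRingEnd ℂ) (f z))
    (hint : IntervalIntegrable (fun θ : ℝ => circleMap 0 ρ θ * Complex.I * f (circleMap c ρ θ))
      MeasureTheory.volume 0 Real.pi) :
    (∮ z in C((c : ℂ), ρ), f z) = 2 * ((semicircleIntegral c ρ f).im : ℂ) * Complex.I := by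
  set F : ℝ → ℂ := fun θ => circleMap 0 ρ θ * Complex.I * f (circleMap c ρ θ) with hF
  have hconj : ∀ (c θ : ℝ), circleMap c ρ (2 * Real.pi - θ) = (starRingEnd ℂ) (circleMap c ρ θ) := by
    intro c θ
    apply Complex.ext
    · rw [circleMap_re, Complex.conj_re, circleMap_re, Real.cos_two_pi_sub]
    · rw [circleMap_im, Complex.conj_im, circleMap_im, Real.sin_two_pi_sub, mul_neg]
  have hrefl : ∀ θ ∈ Set.Ioo 0 Real.pi, F (2 * Real.pi - θ) = -(starRingEnd ℂ) (F θ) := by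
    intro θ hθ
    have h0 := hconj 0 θ
    rw [Complex.ofReal_zero] at h0
    simp only [hF]
    rw [h0, hconj, hf _ (circleMap_im_pos hρ hθ), map_mul, map_mul, Complex.conj_I]
    ring
  have hconjint : IntervalIntegrable (fun θ => (starRingEnd ℂ) (F θ)) MeasureTheory.volume 0
      Real.pi := by
    refine hint.mono_fun ?_ (.of_forall fun θ => by simp [hF])
    exact Complex.continuous_conj.comp_aestronglyMeasurable hint.aestronglyMeasurable_restrict_uIoc
  have h2 : ∫ θ in Real.pi..(2 * Real.pi), F θ = -(starRingEnd ℂ) (∫ θ in (0 : ℝ)..Real.pi, F θ) := by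
    have h3 := intervalIntegral.integral_comp_sub_left F (a := 0) (b := Real.pi) (2 * Real.pi)
    rw [sub_zero, show 2 * Real.pi - Real.pi = Real.pi by ring] at h3
    rw [← h3, integral_congr_Ioo Real.pi_pos.le hrefl, intervalIntegral.integral_neg]
    congr 1
    rw [intervalIntegral.integral_of_le Real.pi_pos.le, intervalIntegral.integral_of_le
      Real.pi_pos.le, integral_conj]
  have hint2 : IntervalIntegrable F MeasureTheory.volume Real.pi (2 * Real.pi) := by
    have h4 : IntervalIntegrable (fun θ => F (2 * Real.pi - θ)) MeasureTheory.volume 0 Real.pi := by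
      refine hconjint.neg.congr_uIoo fun θ hθ => ?_
      rw [Set.uIoo_of_le Real.pi_pos.le] at hθ
      exact (hrefl θ hθ).symm
    have h5 := h4.comp_sub_left (2 * Real.pi)
    simpa [show 2 * Real.pi - Real.pi = Real.pi by ring] using h5.symm
  have h1 : (∮ z in C((c : ℂ), ρ), f z) = ∫ θ in (0 : ℝ)..(2 * Real.pi), F θ := by
    simp [circleIntegral, hF, deriv_circleMap]
  rw [h1, ← intervalIntegral.integral_add_adjacent_intervals hint hint2, h2, semicircleIntegral,
    ← sub_eq_add_neg, Complex.sub_conj]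
  push_cast
  ring

theorem neg_one_div_two_pi : -(1 / (2 * (Real.pi : ℂ))) = ((-(1 / (2 * Real.pi)) : ℝ) : ℂ) := by
  push_cast
  rfl

theorem semicircleIntegral_congr_mul {c ρ : ℝ} (hρ : 0 < ρ) {f g : ℂ → ℂ} (a : ℂ)
    (h : ∀ z : ℂ, 0 < z.im → f z = a * g z) :
    semicircleIntegral c ρ f = a * semicircleIntegral c ρ g := by
  unfold semicircleIntegral
  rw [← intervalIntegral.integral_const_mul]
  refine integral_congr_Ioo Real.pi_pos.le fun θ hθ => ?_
  rw [h _ (circleMap_im_pos hρ hθ)]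
  ring

variable {r : ℕ} {v : Fin (r - 1) → ℝ} {Λ : ℝ}

theorem swForm_eq_polyQuot {s : ℕ → ℝ} (hr : 2 ≤ r)
    (h : IsBranchSeq r (realPoly r v) (2 * Λ ^ r) s) {z : ℂ} (hz : 0 < z.im) :
    swForm r (fun i => (v i : ℂ)) Λ z = -(1 / (2 * (Real.pi : ℂ))) *
      polyQuot s (2 * r) (X * derivative (realPoly r v)) z := by
  rw [swForm_eq, h.sheetRoot_eq_rootProd (by omega) hz, polyQuot]

/-- Reality of the Seiberg-Witten differential on the chosen sheet. -/
theorem swForm_conj {s : ℕ → ℝ} (hr : 2 ≤ r)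
    (h : IsBranchSeq r (realPoly r v) (2 * Λ ^ r) s) {z : ℂ} (hz : 0 < z.im) :
    swForm r (fun i => (v i : ℂ)) Λ ((starRingEnd ℂ) z) =
      (starRingEnd ℂ) (swForm r (fun i => (v i : ℂ)) Λ z) := by
  rw [swForm_eq, swForm_eq, h.sheetRoot_conj (by omega) hz.ne', aeval_conj, neg_one_div_two_pi]
  simp only [map_mul (starRingEnd ℂ), map_div₀, Complex.conj_ofReal]

/-- The integral of `dS` over a circle around a single cut as a real integral over the cut. -/
theorem circleIntegral_swForm {s : ℕ → ℝ} (hr : 2 ≤ r)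
    (h : IsBranchSeq r (realPoly r v) (2 * Λ ^ r) s) {c ρ : ℝ} (hρ : 0 < ρ) {j : ℕ}
    (hx : InCell s (2 * r) (2 * j + 2) (c - ρ)) (hy : InCell s (2 * r) (2 * j) (c + ρ)) :
    (∮ z in C((c : ℂ), ρ), swForm r (fun i => (v i : ℂ)) Λ z) =
      -Complex.I * (((1 / Real.pi) * cutPeriod s (2 * r) (X * derivative (realPoly r v)) j : ℝ) : ℂ) := by
  have hN := hasBoundaryValues_polyQuot s (2 * r) (X * derivative (realPoly r v))
  obtain ⟨C, hC⟩ := hN.exists_bound_semicircle hρ (hx.rootProd_ne_zero h.anti)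
    (hy.rootProd_ne_zero h.anti)
  rw [circleIntegral_eq_of_conj hρ (fun z hz => swForm_conj hr h hz),
    semicircleIntegral_congr_mul hρ _ (fun z hz => swForm_eq_polyQuot hr h hz), neg_one_div_two_pi,
    Complex.im_ofReal_mul, h.im_semicircleIntegral _ hρ hx hy]
  · push_cast
    field_simp
  · refine ((intervalIntegrable_semicircle hρ hN.diff.continuousOn hC).const_mul
      (-(1 / (2 * (Real.pi : ℂ))))).congr_uIoo fun θ hθ => ?_
    rw [Set.uIoo_of_le Real.pi_pos.le] at hθ
    beta_reduce
    rw [swForm_eq_polyQuot hr h (circleMap_im_pos hρ hθ)]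
    ring

theorem encirclesCut_of_inCell {zp zm : ℕ → ℝ} {s : ℕ → ℝ} (hs : s = branchSeq zp zm)
    (hanti : StrictAntiOn s (Set.Icc 1 (2 * r))) {c ρ : ℝ} {j : ℕ}
    (hx : InCell s (2 * r) (2 * j + 2) (c - ρ)) (hy : InCell s (2 * r) (2 * j) (c + ρ)) :
    EncirclesCut r zp zm (j + 1) c ρ := by
  have hj := hx.1
  have h1 := hx.2.1 (by omega)
  have h2 := hy.2.2 (by omega)
  have h3 : s (2 * j + 2) < s (2 * j + 1) := hanti ⟨by omega, by omega⟩ ⟨by omega, by omega⟩ (by omega)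
  -- Both ends of the cut `i + 1`, with the labels exchanged or not.
  have hends : ∀ i : ℕ, (zp (i + 1) = s (2 * i + 1) ∧ zm (i + 1) = s (2 * i + 2)) ∨
      (zm (i + 1) = s (2 * i + 1) ∧ zp (i + 1) = s (2 * i + 2)) := by
    intro i
    rw [hs, branchSeq_odd, branchSeq_even]
    unfold gapEnd
    rcases Nat.even_or_odd i with hi | hi
    · left
      rw [if_neg (Nat.not_even_iff_odd.mpr hi.add_one), if_pos (hi.add even_two)]
      exact ⟨rfl, rfl⟩
    · right
      rw [if_pos hi.add_one, if_neg (Nat.not_even_iff_odd.mpr (hi.add_even even_two))]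
      exact ⟨rfl, rfl⟩
  have hin : |s (2 * j + 1) - c| < ρ ∧ |s (2 * j + 2) - c| < ρ := by
    constructor <;> rw [abs_lt] <;> constructor <;> linarith
  have hout : ∀ i, i ≠ j → i < r → ρ < |s (2 * i + 1) - c| ∧ ρ < |s (2 * i + 2) - c| := by
    intro i hij hir
    rcases lt_or_gt_of_ne hij with hlt | hgt
    · have h5 := hy.2.1 (by omega)
      have h6 := hanti.antitoneOn ⟨by omega, by omega⟩ ⟨by omega, by omega⟩
        (show 2 * i + 1 ≤ 2 * j by omega)
      have h7 := hanti.antitoneOn ⟨by omega, by omega⟩ ⟨by omega, by omega⟩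
        (show 2 * i + 2 ≤ 2 * j by omega)
      exact ⟨lt_abs.mpr (Or.inl (by linarith)), lt_abs.mpr (Or.inl (by linarith))⟩
    · have h5 := hx.2.2 (by omega)
      have h6 := hanti.antitoneOn ⟨by omega, by omega⟩ ⟨by omega, by omega⟩
        (show 2 * j + 2 + 1 ≤ 2 * i + 1 by omega)
      have h7 := hanti.antitoneOn ⟨by omega, by omega⟩ ⟨by omega, by omega⟩
        (show 2 * j + 2 + 1 ≤ 2 * i + 2 by omega)
      exact ⟨lt_abs.mpr (Or.inr (by linarith)), lt_abs.mpr (Or.inr (by linarith))⟩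
  refine ⟨?_, ?_, fun β hβ hβj => ?_⟩
  · rcases hends j with h | h <;> simp only [h, hin]
  · rcases hends j with h | h <;> simp only [h, hin]
  · rw [Finset.mem_Icc] at hβ
    obtain ⟨i, rfl⟩ : ∃ i, β = i + 1 := ⟨β - 1, by omega⟩
    have := hout i (by omega) (by omega)
    rcases hends i with h | h <;> simp only [h, this, and_self]

/-- The `A`-periods as real integrals over the cuts. -/
theorem IsAPeriod.eq_cutPeriod {zp zm : ℕ → ℝ} (hr : 2 ≤ r)
    (h : IsBranchSeq r (realPoly r v) (2 * Λ ^ r) (branchSeq zp zm)) {j : ℕ} (hj : j < r) {a : ℂ}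
    (ha : IsAPeriod r (fun i => (v i : ℂ)) Λ zp zm (j + 1) a) :
    a = -Complex.I * (((1 / Real.pi) *
      cutPeriod (branchSeq zp zm) (2 * r) (X * derivative (realPoly r v)) j : ℝ) : ℂ) := by
  obtain ⟨x, hx⟩ := exists_inCell h.anti (show 2 * j + 2 ≤ 2 * r by omega)
  obtain ⟨y, hy⟩ := exists_inCell h.anti (show 2 * j ≤ 2 * r by omega)
  have hxy := hy.lt h.anti hx (by omega)
  have hx' : InCell (branchSeq zp zm) (2 * r) (2 * j + 2) ((x + y) / 2 - (y - x) / 2) := by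
    rwa [show (x + y) / 2 - (y - x) / 2 = x by ring]
  have hy' : InCell (branchSeq zp zm) (2 * r) (2 * j) ((x + y) / 2 + (y - x) / 2) := by
    rwa [show (x + y) / 2 + (y - x) / 2 = y by ring]
  rw [← ha _ _ (encirclesCut_of_inCell rfl h.anti hx' hy')]
  exact circleIntegral_swForm hr h (by linarith) hx' hy'

/-- The cycle `C_(j + 2)` runs over the gap with number `j + 1`. -/
theorem gapPeriod_eq {zp zm : ℕ → ℝ} (hr : 2 ≤ r)
    (h : IsBranchSeq r (realPoly r v) (2 * Λ ^ r) (branchSeq zp zm)) {j : ℕ} (hj : j + 1 < r) :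
    gapPeriod r (fun i => (v i : ℂ)) Λ zp zm (j + 2) =
      (((1 / Real.pi) * ((-1) ^ (j + 1) * cellIntegral (branchSeq zp zm) (2 * r) (2 * (j + 1))
        (X * derivative (realPoly r v))) : ℝ) : ℂ) := by
  have hlt : branchSeq zp zm (2 * (j + 1) + 1) < branchSeq zp zm (2 * (j + 1)) :=
    h.anti ⟨by omega, by omega⟩ ⟨by omega, by omega⟩ (by omega)
  have hcell : ∀ x ∈ Set.Ioo (branchSeq zp zm (2 * (j + 1) + 1)) (branchSeq zp zm (2 * (j + 1))),
      InCell (branchSeq zp zm) (2 * r) (2 * (j + 1)) x := fun x hx =>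
    inCell_of_mem_Ioo (by omega) hx
  rw [gapPeriod, show j + 2 - 1 = j + 1 by omega, ← branchSeq_even,
    show j + 2 = (j + 1) + 1 by ring, ← branchSeq_odd, show 2 * j + 2 = 2 * (j + 1) by ring,
    intervalIntegral.integral_symm, integral_congr_Ioo hlt.le (g := fun x : ℝ =>
      -(1 / (2 * (Real.pi : ℂ))) * polyQuot (branchSeq zp zm) (2 * r)
        (X * derivative (realPoly r v)) x) (fun x hx => by
      rw [swForm_eq, h.sheetRoot_eq_rootProd_of_inCell (by omega) (hcell x hx), polyQuot]),
    intervalIntegral.integral_const_mul, integral_polyQuot_of_inCell h.anti _ hlt.le hcell,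
    neg_I_pow_even, cellIntegral]
  push_cast
  field_simp

/-- The dual periods as real integrals over the gaps. -/
theorem dualPeriod_eq_gapSum {zp zm : ℕ → ℝ} (hr : 2 ≤ r)
    (h : IsBranchSeq r (realPoly r v) (2 * Λ ^ r) (branchSeq zp zm)) {j : ℕ} (hj : j < r) :
    dualPeriod r (fun i => (v i : ℂ)) Λ zp zm (j + 1) =
      2 * Complex.I *
        (gapSum (branchSeq zp zm) (2 * r) (X * derivative (realPoly r v)) j : ℂ) := by
  rw [dualPeriod, gapSum, Complex.ofReal_sum, Finset.mul_sum, Finset.mul_sum]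
  refine Finset.sum_bij' (fun β _ => β - 1) (fun i _ => i + 1) (fun β hβ => ?_) (fun i hi => ?_)
    (fun β hβ => ?_) (fun i hi => ?_) (fun β hβ => ?_)
  · simp only [Finset.mem_Icc] at *; omega
  · simp only [Finset.mem_Icc] at *; omega
  · simp only [Finset.mem_Icc] at *; omega
  · simp
  · rw [Finset.mem_Icc] at hβ
    obtain ⟨i, rfl⟩ : ∃ i, β = i + 2 := ⟨β - 2, by omega⟩
    rw [gapPeriod_eq hr h (by omega), show i + 2 - 1 = i + 1 by omega]
    push_cast
    field_simp

end SeibergWitten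

namespace SeibergWitten

/-! ### Variation of the periods with the curve -/

/-- The numerator of `(Q / y)' = quotNum / y ^ 3`, where `y ^ 2 = p ^ 2 - T ^ 2`. -/
noncomputable def quotNum (p : ℝ[X]) (T : ℝ) (Q : ℝ[X]) : ℝ[X] :=
  derivative Q * (p ^ 2 - C (T ^ 2)) - Q * p * derivative p

theorem aeval_quotNum (p : ℝ[X]) (T : ℝ) (Q : ℝ[X]) (z : ℂ) :
    aeval z (quotNum p T Q) = aeval z (derivative Q) * (aeval z p ^ 2 - (T : ℂ) ^ 2) -
      aeval z Q * aeval z p * aeval z (derivative p) := by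
  simp [quotNum]

namespace IsBranchSeq

variable {r : ℕ} {p : ℝ[X]} {T : ℝ} {s : ℕ → ℝ}

theorem hasDerivAt_polyQuot (h : IsBranchSeq r p T s) (hr : 1 ≤ r) (Q : ℝ[X]) {z : ℂ}
    (hz : 0 < z.im) :
    HasDerivAt (polyQuot s (2 * r) Q)
      (aeval z (quotNum p T Q) / rootProd s (2 * r) z ^ 3) z := by
  have hY := rootProd_ne_zero_of_im_pos s (2 * r) hz
  have hd := (differentiableAt_rootProd s (2 * r) hz).hasDerivAt
  have hsq : deriv (rootProd s (2 * r)) z * (2 * rootProd s (2 * r) z) =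
      2 * aeval z p * aeval z (derivative p) := by
    have h1 := hd.pow 2
    have h2 : HasDerivAt (fun w : ℂ => aeval w p ^ 2 - (T : ℂ) ^ 2)
        (2 * aeval z p * aeval z (derivative p)) z := by
      simpa using ((p.hasDerivAt_aeval z).pow 2).sub_const ((T : ℂ) ^ 2)
    have h3 : (rootProd s (2 * r)) ^ 2 = fun w : ℂ => aeval w p ^ 2 - (T : ℂ) ^ 2 := by
      funext w
      exact h.rootProd_sq hr w
    rw [h3] at h1
    have := h1.unique h2
    rw [← this]
    push_cast
    ring
  refine ((Q.hasDerivAt_aeval z).div hd hY).congr_deriv ?_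
  rw [aeval_quotNum, ← h.rootProd_sq hr, div_eq_div_iff (pow_ne_zero 2 hY) (pow_ne_zero 3 hY)]
  linear_combination (-aeval z Q * rootProd s (2 * r) z ^ 2 / 2) * hsq

/-- Integration by parts: the primitive `z Q / y` of `z (Q / y)' + Q / y` has no component along
`(-i) ^ (m + 1)` in the cells `m` and `m + 2`. -/
theorem re_I_pow_mul_semicircleIntegral_deriv (h : IsBranchSeq r p T s) (hr : 1 ≤ r) (Q : ℝ[X])
    {m : ℕ} {c ρ : ℝ} (hρ : 0 < ρ) (hx : InCell s (2 * r) (m + 2) (c - ρ))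
    (hy : InCell s (2 * r) m (c + ρ)) :
    (Complex.I ^ (m + 1) * semicircleIntegral c ρ fun z =>
      z * (aeval z (quotNum p T Q) / rootProd s (2 * r) z ^ 3)).re =
        cellIntegral s (2 * r) (m + 1) Q := by
  obtain ⟨q, hq⟩ : ∃ q, q = polyQuot s (2 * r) Q := ⟨_, rfl⟩
  obtain ⟨q', hq'⟩ : ∃ q' : ℂ → ℂ,
      q' = fun z => aeval z (quotNum p T Q) / rootProd s (2 * r) z ^ 3 := ⟨_, rfl⟩
  have hφ : (fun z => z * (aeval z (quotNum p T Q) / rootProd s (2 * r) z ^ 3)) =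
      fun z => z * q' z := by rw [hq']
  rw [hφ]
  have hbv := hasBoundaryValues_polyQuot s (2 * r) Q
  rw [← hq] at hbv
  have hder : ∀ z : ℂ, 0 < z.im → HasDerivAt q (q' z) z := by
    rw [hq, hq']
    exact fun z hz => h.hasDerivAt_polyQuot hr Q hz
  have hxr := hx.rootProd_ne_zero h.anti
  have hyr := hy.rootProd_ne_zero h.anti
  obtain ⟨μ, hμ, hmle⟩ := exists_le_norm_rootProd s (2 * r) hρ hxr hyr
  obtain ⟨C₁, hC₁⟩ := (isCompact_closedBall (0 : ℂ) (|c| + |ρ| + 1)).exists_bound_of_continuousOn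
      (f := fun z : ℂ => aeval z Q) Q.continuous_aeval.continuousOn
  obtain ⟨C₂, hC₂⟩ := (isCompact_closedBall (0 : ℂ) (|c| + |ρ| + 1)).exists_bound_of_continuousOn
      (f := fun z : ℂ => z * aeval z (quotNum p T Q))
      (continuous_id.mul (quotNum p T Q).continuous_aeval).continuousOn
  have hball : ∀ θ : ℝ, ∀ δ : ℝ, 0 ≤ δ → δ ≤ 1 →
      circleMap c ρ θ + δ * Complex.I ∈ Metric.closedBall (0 : ℂ) (|c| + |ρ| + 1) := by
    intro θ δ hδ hδ1
    rw [mem_closedBall_zero_iff]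
    refine (norm_add_le _ _).trans (add_le_add (norm_circleMap_le c ρ θ) ?_)
    simpa [abs_of_nonneg hδ] using hδ1
  have hb1 : ∀ θ ∈ Set.Icc 0 Real.pi, ∀ δ : ℝ, 0 ≤ δ → δ ≤ 1 →
      ‖q (circleMap c ρ θ + δ * Complex.I)‖ ≤ C₁ / μ := by
    intro θ hθ δ hδ hδ1
    rw [hq, polyQuot, norm_div]
    exact div_le_div₀ ((norm_nonneg _).trans (hC₁ _ (hball θ δ hδ hδ1))) (hC₁ _ (hball θ δ hδ hδ1))
      hμ (hmle θ hθ δ hδ)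
  have hb2 : ∀ θ ∈ Set.Icc 0 Real.pi, ∀ δ : ℝ, 0 ≤ δ → δ ≤ 1 →
      ‖(circleMap c ρ θ + δ * Complex.I) * q' (circleMap c ρ θ + δ * Complex.I)‖ ≤ C₂ / μ ^ 3 := by
    intro θ hθ δ hδ hδ1
    rw [hq', ← mul_div_assoc, norm_div, norm_pow]
    exact div_le_div₀ ((norm_nonneg _).trans (hC₂ _ (hball θ δ hδ hδ1))) (hC₂ _ (hball θ δ hδ hδ1))
      (by positivity) (by have := hmle θ hθ δ hδ; gcongr)
  have hcq : ContinuousOn q {z | 0 < z.im} := hbv.diff.continuousOn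
  have hcq' : ContinuousOn (fun z => z * q' z) {z | 0 < z.im} := by
    rw [hq']
    refine continuousOn_id.mul ((quotNum p T Q).continuous_aeval.continuousOn.div
      (fun z hz => ((differentiableAt_rootProd s (2 * r) hz).continuousAt.pow 3).continuousWithinAt)
      fun z hz => pow_ne_zero 3 (rootProd_ne_zero_of_im_pos s (2 * r) hz))
  have htend : ∀ x : ℝ, rootProd s (2 * r) x ≠ 0 →
      Tendsto (fun δ : ℝ => (fun z => z * q z) ((x : ℂ) + δ * Complex.I)) (𝓝[>] 0)
        (𝓝 (x * q x)) := fun x hx => (tendsto_add_mul_I (x : ℂ)).mul (hbv.radial x hx)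
  have htot : semicircleIntegral c ρ (fun z => q z + z * q' z) =
      ((c - ρ : ℝ) : ℂ) * q ((c - ρ : ℝ) : ℂ) - ((c + ρ : ℝ) : ℂ) * q ((c + ρ : ℝ) : ℂ) := by
    refine semicircleIntegral_eq_sub (Ψ := fun z => z * q z) (C := C₁ / μ + C₂ / μ ^ 3) hρ (hcq.add hcq')
      (fun z hz => ?_)
      (fun θ hθ δ hδ => (norm_add_le _ _).trans
        (add_le_add (hb1 θ hθ δ hδ.1.le hδ.2.le) (hb2 θ hθ δ hδ.1.le hδ.2.le)))
      (htend _ hxr) (htend _ hyr)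
    have h1 := (hasDerivAt_id' z).mul (hder z hz)
    rw [one_mul] at h1
    exact h1
  have hsum : semicircleIntegral c ρ (fun z => q z + z * q' z) =
      semicircleIntegral c ρ q + semicircleIntegral c ρ fun z => z * q' z := by
    unfold semicircleIntegral
    rw [← intervalIntegral.integral_add]
    · simp only [mul_add]
    · refine intervalIntegrable_semicircle hρ hcq (C := C₁ / μ) fun θ hθ => ?_
      simpa using hb1 θ (Set.Ioo_subset_Icc_self hθ) 0 le_rfl zero_le_one
    · refine intervalIntegrable_semicircle hρ hcq' (C := C₂ / μ ^ 3) fun θ hθ => ?_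
      simpa using hb2 θ (Set.Ioo_subset_Icc_self hθ) 0 le_rfl zero_le_one
  have hI : ∀ j : ℕ, Complex.I ^ j * (-Complex.I) ^ j = 1 := fun j => by
    rw [← mul_pow]; simp
  have e1 : Complex.I ^ (m + 1) * (-Complex.I) ^ (m + 2) = -Complex.I := by
    rw [pow_succ (-Complex.I), ← mul_assoc, hI, one_mul]
  have e2 : Complex.I ^ (m + 1) * (-Complex.I) ^ m = Complex.I := by
    rw [pow_succ, mul_right_comm, hI, one_mul]
  have hends : (Complex.I ^ (m + 1) * (((c - ρ : ℝ) : ℂ) * q ((c - ρ : ℝ) : ℂ) -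
      ((c + ρ : ℝ) : ℂ) * q ((c + ρ : ℝ) : ℂ))).re = 0 := by
    rw [hq, polyQuot_ofReal, polyQuot_ofReal, hx.countAbove_eq h.anti, hy.countAbove_eq h.anti]
    have e : ∀ a b A B : ℝ, Complex.I ^ (m + 1) * ((a : ℂ) * ((-Complex.I) ^ (m + 2) * A) -
        b * ((-Complex.I) ^ m * B)) = ((-(a * A) - b * B : ℝ) : ℂ) * Complex.I := by
      intro a b A B
      push_cast
      linear_combination ((a : ℂ) * A) * e1 - ((b : ℂ) * B) * e2
    rw [e, Complex.re_ofReal_mul, Complex.I_re, mul_zero]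
  have h1 := re_I_pow_mul_semicircleIntegral h.anti Q hρ hx hy
  rw [← hq] at h1
  rw [← htot, hsum, mul_add, Complex.add_re, h1] at hends
  linarith

/-- A decreasing sequence of points at which `p ^ 2 - T ^ 2` has alternating signs meets every
cell. -/
theorem inCell_of_sign (h : IsBranchSeq r p T s) (hr : 1 ≤ r) {y : ℕ → ℝ}
    (hy : ∀ i j, i < j → j ≤ 2 * r → y j < y i)
    (hsign : ∀ j ≤ 2 * r, 0 < (-1) ^ j * (p.eval (y j) ^ 2 - T ^ 2)) {j : ℕ} (hj : j ≤ 2 * r) :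
    InCell s (2 * r) j (y j) := by
  set n : ℕ → ℕ := fun j => countAbove s (2 * r) (y j) with hn
  have hmod : ∀ j ≤ 2 * r, n j % 2 = j % 2 := by
    intro j hj
    have h1 := hsign j hj
    rw [h.eval_sq_sub hr, prod_sub_eq_neg_one_pow, ← mul_assoc, ← pow_add] at h1
    have h2 : 0 < (-1 : ℝ) ^ (j + n j) := pos_of_mul_pos_left h1 (abs_nonneg _)
    rcases Nat.even_or_odd (j + n j) with he | ho
    · rcases he with ⟨k, hk⟩
      omega
    · rw [ho.neg_one_pow] at h2
      linarith
  have hstep : ∀ j, j + 1 ≤ 2 * r → n j < n (j + 1) := by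
    intro j hj
    have h1 : n j ≤ n (j + 1) := countAbove_antitone s (2 * r) (hy j (j + 1) (by omega) hj).le
    have h2 := hmod j (by omega)
    have h3 := hmod (j + 1) hj
    omega
  have hlow : ∀ j ≤ 2 * r, j ≤ n j := by
    intro j
    induction j with
    | zero => simp
    | succ j ih =>
      intro hj
      have := hstep j hj
      have := ih (by omega)
      omega
  have hup : ∀ d ≤ 2 * r, n (2 * r - d) + d ≤ 2 * r := by
    intro d
    induction d with
    | zero => intro _; simpa using countAbove_le s (2 * r) (y (2 * r))
    | succ d ih =>
      intro hd
      have h1 := ih (by omega)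
      have h2 := hstep (2 * r - (d + 1)) (by omega)
      rw [show 2 * r - (d + 1) + 1 = 2 * r - d by omega] at h2
      omega
  have hnj : n j = j := by
    have h1 := hlow j hj
    have h2 := hup (2 * r - j) (by omega)
    rw [show 2 * r - (2 * r - j) = j by omega] at h2
    omega
  have h1 : InCell s (2 * r) (n j) (y j) := by
    refine inCell_countAbove h.anti fun k hk hyk => ?_
    have := hsign j hj
    rw [h.eval_sq_sub hr, Finset.prod_eq_zero hk (by rw [hyk, sub_self]), mul_zero] at this
    exact lt_irrefl _ this
  rwa [hnj] at h1

theorem sign_of_inCell (h : IsBranchSeq r p T s) (hr : 1 ≤ r) {j : ℕ} {x : ℝ}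
    (hx : InCell s (2 * r) j x) : 0 < (-1) ^ j * (p.eval x ^ 2 - T ^ 2) := by
  rw [h.eval_sq_sub hr, prod_sub_eq_neg_one_pow, hx.countAbove_eq h.anti, ← mul_assoc, ← mul_pow]
  simp only [mul_neg, mul_one, neg_neg, one_pow, one_mul, abs_pos]
  rw [Finset.prod_ne_zero_iff]
  exact fun k hk => sub_ne_zero.mpr (hx.ne h.anti k hk)

theorem norm_rootProd_sq (h : IsBranchSeq r p T s) (hr : 1 ≤ r) (z : ℂ) :
    ‖rootProd s (2 * r) z‖ ^ 2 = ‖aeval z p ^ 2 - (T : ℂ) ^ 2‖ := by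
  rw [← norm_pow, h.rootProd_sq hr]

end IsBranchSeq

/-- The derivative of `z p' / y` along a family of curves is `z (Q / y)'`, where
`Q = ∂p - (∂T / T) p`. -/
theorem hasDerivAt_div_sheetRoot {P P₁ : ℝ → ℂ} {T : ℝ → ℝ} {dP dP₁ : ℂ} {dT t : ℝ}
    (hP : HasDerivAt P dP t) (hP₁ : HasDerivAt P₁ dP₁ t) (hT : HasDerivAt T dT t) (h0 : P t ≠ 0)
    (hs : 1 - (T t : ℂ) ^ 2 / P t ^ 2 ∈ Complex.slitPlane) {y : ℝ → ℂ}
    (hy : y = fun t => P t * (1 - (T t : ℂ) ^ 2 / P t ^ 2).sqrt) (hTt : T t ≠ 0) :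
    HasDerivAt (fun t => P₁ t / y t)
      (((dP₁ - (dT / T t : ℝ) * P₁ t) * (P t ^ 2 - (T t : ℂ) ^ 2) -
        (dP - (dT / T t : ℝ) * P t) * P t * P₁ t) / y t ^ 3) t := by
  have hTc : HasDerivAt (fun t => (T t : ℂ)) (dT : ℂ) t := hT.ofReal_comp
  have hw : DifferentiableAt ℝ (fun t => 1 - (T t : ℂ) ^ 2 / P t ^ 2) t :=
    (((hTc.pow 2).div (hP.pow 2) (pow_ne_zero 2 h0)).const_sub 1).differentiableAt
  have hyd : DifferentiableAt ℝ y t := by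
    rw [hy]
    refine hP.differentiableAt.mul ?_
    exact (((Complex.differentiableAt_sqrt hs).restrictScalars ℝ).comp t hw)
  have hsq : ∀ᶠ t' in 𝓝 t, y t' ^ 2 = P t' ^ 2 - (T t' : ℂ) ^ 2 := by
    filter_upwards [hP.continuousAt.eventually_ne h0] with t' ht'
    rw [hy]
    simp only [mul_pow, csqrt_sq]
    field_simp
  have hyt : y t ≠ 0 := by
    rw [hy]
    refine mul_ne_zero h0 fun h => Complex.slitPlane_ne_zero hs ?_
    rw [← csqrt_sq (1 - (T t : ℂ) ^ 2 / P t ^ 2), h]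
    simp
  have hyy : y t * deriv y t = P t * dP - T t * dT := by
    have h1 := (hyd.hasDerivAt.pow 2).congr_of_eventuallyEq
      (hsq.mono fun t' ht' => ht'.symm : (fun t' => P t' ^ 2 - (T t' : ℂ) ^ 2) =ᶠ[𝓝 t] _)
    have h2 := h1.unique ((hP.pow 2).sub (hTc.pow 2))
    push_cast at h2
    linear_combination h2 / 2
  have hTt' : (T t : ℂ) ≠ 0 := by exact_mod_cast hTt
  refine (hP₁.div hyd.hasDerivAt hyt).congr_deriv ?_
  rw [div_eq_div_iff (pow_ne_zero 2 hyt) (pow_ne_zero 3 hyt)]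
  have hs := hsq.self_of_nhds
  have e : (dT : ℂ) = ((dT / T t : ℝ) : ℂ) * T t := by
    push_cast
    field_simp
  linear_combination (-P₁ t * y t ^ 2) * hyy + (dP₁ * y t ^ 2) * hs + P₁ t * T t * y t ^ 2 * e

end SeibergWitten

namespace SeibergWitten

theorem aeval_lowPoly (r : ℕ) (v : Fin (r - 1) → ℝ) (z : ℂ) :
    aeval z (lowPoly r v) = ∑ i : Fin (r - 1), (v i : ℂ) * z ^ (r - 2 - (i : ℕ)) := by
  simp [lowPoly]

theorem aeval_derivative_lowPoly (r : ℕ) (v : Fin (r - 1) → ℝ) (z : ℂ) :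
    aeval z (derivative (lowPoly r v)) =
      ∑ i : Fin (r - 1), (v i : ℂ) * aeval z (derivative (X ^ (r - 2 - (i : ℕ)) : ℝ[X])) := by
  simp [lowPoly]

theorem eval_lowPoly (r : ℕ) (v : Fin (r - 1) → ℝ) (x : ℝ) :
    (lowPoly r v).eval x = ∑ i : Fin (r - 1), v i * x ^ (r - 2 - (i : ℕ)) := by
  simp [lowPoly, eval_finsetSum]

section Continuity

variable {r : ℕ} {v : ℝ → Fin (r - 1) → ℝ} {t₀ : ℝ}

theorem continuousAt_ofReal_apply (hv : ContinuousAt v t₀) (z : ℂ) (i : Fin (r - 1)) :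
    ContinuousAt (fun q : ℝ × ℂ => (v q.1 i : ℂ)) (t₀, z) :=
  Complex.continuous_ofReal.continuousAt.comp (((continuous_apply i).continuousAt.comp hv).comp
    (f := fun q : ℝ × ℂ => q.1) (x := (t₀, z)) continuousAt_fst)

theorem continuousAt_aeval_lowPoly (hv : ContinuousAt v t₀) (z : ℂ) :
    ContinuousAt (fun q : ℝ × ℂ => aeval q.2 (lowPoly r (v q.1))) (t₀, z) := by
  simp only [aeval_lowPoly]
  exact tendsto_finsetSum _ fun i _ =>
    (continuousAt_ofReal_apply hv z i).mul (continuousAt_snd.pow _)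

theorem continuousAt_aeval_derivative_lowPoly (hv : ContinuousAt v t₀) (z : ℂ) :
    ContinuousAt (fun q : ℝ × ℂ => aeval q.2 (derivative (lowPoly r (v q.1)))) (t₀, z) := by
  simp only [aeval_derivative_lowPoly]
  exact tendsto_finsetSum _ fun i _ => (continuousAt_ofReal_apply hv z i).mul
    ((derivative (X ^ (r - 2 - (i : ℕ)) : ℝ[X])).continuous_aeval.continuousAt.comp
      (f := fun q : ℝ × ℂ => q.2) (x := (t₀, z)) continuousAt_snd)

theorem continuousAt_aeval_realPoly (hv : ContinuousAt v t₀) (z : ℂ) :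
    ContinuousAt (fun q : ℝ × ℂ => aeval q.2 (realPoly r (v q.1))) (t₀, z) := by
  simp only [realPoly, map_add, map_pow, aeval_X]
  exact (continuousAt_snd.pow r).add (continuousAt_aeval_lowPoly hv z)

theorem continuousAt_aeval_derivative_realPoly (hv : ContinuousAt v t₀) (z : ℂ) :
    ContinuousAt (fun q : ℝ × ℂ => aeval q.2 (derivative (realPoly r (v q.1)))) (t₀, z) := by
  simp only [realPoly, map_add]
  exact ((derivative (X ^ r : ℝ[X])).continuous_aeval.continuousAt.comp
      (f := fun q : ℝ × ℂ => q.2) (x := (t₀, z)) continuousAt_snd).add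
    (continuousAt_aeval_derivative_lowPoly hv z)

theorem hasDerivAt_aeval_realPoly {v' : Fin (r - 1) → ℝ} (hv : HasDerivAt v v' t₀) (z : ℂ) :
    HasDerivAt (fun t => aeval z (realPoly r (v t))) (aeval z (lowPoly r v')) t₀ := by
  simp only [realPoly, map_add, aeval_lowPoly]
  exact (HasDerivAt.fun_sum fun i _ =>
    ((hasDerivAt_pi.mp hv i).ofReal_comp.mul_const (z ^ (r - 2 - (i : ℕ))))).const_add _

theorem hasDerivAt_aeval_derivative_realPoly {v' : Fin (r - 1) → ℝ} (hv : HasDerivAt v v' t₀)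
    (z : ℂ) :
    HasDerivAt (fun t => aeval z (derivative (realPoly r (v t))))
      (aeval z (derivative (lowPoly r v'))) t₀ := by
  simp only [realPoly, map_add, aeval_derivative_lowPoly]
  exact (HasDerivAt.fun_sum fun i _ => ((hasDerivAt_pi.mp hv i).ofReal_comp.mul_const
    (aeval z (derivative (X ^ (r - 2 - (i : ℕ)) : ℝ[X]))))).const_add _

theorem continuousAt_eval_realPoly (hv : ContinuousAt v t₀) (x : ℝ) :
    ContinuousAt (fun t => (realPoly r (v t)).eval x) t₀ := by
  simp only [realPoly, eval_add, eval_lowPoly]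
  exact continuousAt_const.add (tendsto_finsetSum _ fun i _ =>
    ((continuous_apply i).continuousAt.comp hv).mul continuousAt_const)

end Continuity

theorem eventually_hasDerivAt_of_contDiffAt {E : Type*} [NormedAddCommGroup E] [NormedSpace ℝ E]
    {f : ℝ → E} {t₀ : ℝ} (h : ContDiffAt ℝ 1 f t₀) : ∀ᶠ t in 𝓝 t₀, HasDerivAt f (deriv f t) t :=
  (h.eventually (by simp)).mono fun _ ht => (ht.differentiableAt one_ne_zero).hasDerivAt

theorem continuousAt_deriv_of_contDiffAt {E : Type*} [NormedAddCommGroup E] [NormedSpace ℝ E]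
    {f : ℝ → E} {t₀ : ℝ} (h : ContDiffAt ℝ 1 f t₀) : ContinuousAt (deriv f) t₀ := by
  have : deriv f = fun t => fderiv ℝ f t 1 := by
    funext t
    rw [fderiv_apply_one_eq_deriv]
  rw [this]
  exact (h.continuousAt_fderiv one_ne_zero).clm_apply continuousAt_const

theorem aestronglyMeasurable_semicircle {c ρ : ℝ} (hρ : 0 < ρ) {φ : ℂ → ℂ}
    (hφ : ContinuousOn φ {z | 0 < z.im}) :
    MeasureTheory.AEStronglyMeasurable
      (fun θ : ℝ => circleMap 0 ρ θ * Complex.I * φ (circleMap c ρ θ))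
      (MeasureTheory.volume.restrict (Set.uIoc 0 Real.pi)) := by
  rw [Set.uIoc_of_le Real.pi_pos.le, ← MeasureTheory.Measure.restrict_congr_set
    MeasureTheory.Ioo_ae_eq_Ioc]
  refine ContinuousOn.aestronglyMeasurable ?_ measurableSet_Ioo
  exact ContinuousOn.mul (by fun_prop) (hφ.comp (by fun_prop) fun θ hθ => circleMap_im_pos hρ hθ)

theorem semicircleIntegral_congr {c ρ : ℝ} (hρ : 0 < ρ) {f g : ℂ → ℂ}
    (h : ∀ z : ℂ, 0 < z.im → f z = g z) : semicircleIntegral c ρ f = semicircleIntegral c ρ g := by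
  simpa using semicircleIntegral_congr_mul hρ (g := g) 1 fun z hz => by rw [one_mul, h z hz]

/-- Along a differentiable family of curves, the real points of the cells of one curve stay in the
cells with the same numbers. -/
theorem eventually_inCell {r : ℕ} (hr : 1 ≤ r) {v : ℝ → Fin (r - 1) → ℝ} {T : ℝ → ℝ}
    {s : ℝ → ℕ → ℝ} {t₀ : ℝ} (hv : ContinuousAt v t₀) (hT : ContinuousAt T t₀)
    (h : ∀ᶠ t in 𝓝 t₀, IsBranchSeq r (realPoly r (v t)) (T t) (s t)) :
    ∃ y : ℕ → ℝ, ∀ᶠ t in 𝓝 t₀, ∀ j ≤ 2 * r, InCell (s t) (2 * r) j (y j) := by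
  have h₀ := h.self_of_nhds
  choose! y hy using fun (j : ℕ) (hj : j ≤ 2 * r) => exists_inCell h₀.anti hj
  refine ⟨y, ?_⟩
  have hsign : ∀ᶠ t in 𝓝 t₀, ∀ j ∈ Finset.range (2 * r + 1),
      0 < (-1) ^ j * ((realPoly r (v t)).eval (y j) ^ 2 - T t ^ 2) := by
    rw [Finset.eventually_all]
    intro j hj
    have hj' : j ≤ 2 * r := by rw [Finset.mem_range] at hj; omega
    exact (continuousAt_const.mul (((continuousAt_eval_realPoly hv (y j)).pow 2).sub
      (hT.pow 2))).eventually_const_lt (h₀.sign_of_inCell hr (hy j hj'))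
  filter_upwards [h, hsign] with t ht hst j hj
  exact ht.inCell_of_sign hr
    (fun i j hij hj => (hy i (by omega)).lt h₀.anti (hy j hj) hij)
    (fun j hj => hst j (Finset.mem_range.mpr (by omega))) hj

/-- The derivative of the periods of `z p' dz / y` along a family of curves: it is given by the
periods of `-(∂p - (∂T / T) p) dz / y`, which differs from `∂(z p' / y) dz` by an exact form. -/
theorem hasDerivAt_cellIntegral {r : ℕ} (hr : 1 ≤ r) {v : ℝ → Fin (r - 1) → ℝ} {T : ℝ → ℝ}
    {s : ℝ → ℕ → ℝ} {t₀ : ℝ} (hv : ContDiffAt ℝ 1 v t₀) (hT : ContDiffAt ℝ 1 T t₀)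
    (h : ∀ᶠ t in 𝓝 t₀, IsBranchSeq r (realPoly r (v t)) (T t) (s t)) {m : ℕ}
    (hm : m + 2 ≤ 2 * r) :
    HasDerivAt (fun t => cellIntegral (s t) (2 * r) (m + 1) (X * derivative (realPoly r (v t))))
      (-cellIntegral (s t₀) (2 * r) (m + 1)
        (lowPoly r (deriv v t₀) - C (deriv T t₀ / T t₀) * realPoly r (v t₀))) t₀ := by
  obtain ⟨y, hy⟩ := eventually_inCell hr hv.continuousAt hT.continuousAt h
  have h₀ := h.self_of_nhds
  have hy₀ := hy.self_of_nhds
  have hlt := (hy₀ m (by omega)).lt h₀.anti (hy₀ (m + 2) hm) (by omega)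
  obtain ⟨c, hc⟩ : ∃ c, c = (y (m + 2) + y m) / 2 := ⟨_, rfl⟩
  obtain ⟨ρ, hρe⟩ : ∃ ρ, ρ = (y m - y (m + 2)) / 2 := ⟨_, rfl⟩
  have hρ : 0 < ρ := by rw [hρe]; linarith
  have hcρ : ∀ᶠ t in 𝓝 t₀, InCell (s t) (2 * r) (m + 2) (c - ρ) ∧ InCell (s t) (2 * r) m (c + ρ) := by
    filter_upwards [hy] with t ht
    rw [hc, hρe]
    exact ⟨by convert ht (m + 2) hm using 1; ring, by convert ht m (by omega) using 1; ring⟩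
  -- The integrand on the semicircle and its derivative.
  let Q : ℝ → ℝ[X] := fun t => lowPoly r (deriv v t) - C (deriv T t / T t) * realPoly r (v t)
  let f : ℝ → ℂ → ℂ := fun t z =>
    aeval z (X * derivative (realPoly r (v t))) / sheetRoot (realPoly r (v t)) (T t) z
  let f' : ℝ → ℂ → ℂ := fun t z =>
    z * (aeval z (quotNum (realPoly r (v t)) (T t) (Q t)) / sheetRoot (realPoly r (v t)) (T t) z ^ 3)
  have hf : ∀ᶠ t in 𝓝 t₀, ∀ z : ℂ, 0 < z.im → HasDerivAt (fun t => f t z) (f' t z) t := by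
    filter_upwards [h, eventually_hasDerivAt_of_contDiffAt hv, eventually_hasDerivAt_of_contDiffAt hT]
      with t ht hvt hTt z hz
    have h1 := (hasDerivAt_div_sheetRoot (hasDerivAt_aeval_realPoly hvt z)
      (hasDerivAt_aeval_derivative_realPoly hvt z) hTt (ht.aeval_ne_zero hr hz.ne')
      (ht.one_sub_mem_slitPlane hr hz.ne') rfl ht.pos.ne').const_mul z
    have h2 : (fun t => f t z) = fun t => z * (aeval z (derivative (realPoly r (v t))) /
        (aeval z (realPoly r (v t)) * (1 - (T t : ℂ) ^ 2 / aeval z (realPoly r (v t)) ^ 2).sqrt)) := by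
      funext t
      simp only [f, sheetRoot, map_mul, aeval_X, mul_div_assoc]
    rw [h2]
    refine h1.congr_deriv ?_
    simp only [f', Q, aeval_quotNum, sheetRoot, map_sub, map_mul, aeval_C, Complex.coe_algebraMap,
      derivative_C_mul]
  -- Uniform bounds on the semicircle.
  set K : Set ℂ := (fun θ : ℝ => circleMap c ρ θ) '' Set.Icc 0 Real.pi
  have hKc : IsCompact K := isCompact_Icc.image (continuous_circleMap c ρ)
  obtain ⟨μ, hμ, hmle⟩ := exists_le_norm_rootProd (s t₀) (2 * r) hρ
    (hcρ.self_of_nhds.1.rootProd_ne_zero h₀.anti) (hcρ.self_of_nhds.2.rootProd_ne_zero h₀.anti)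
  have hTc (z : ℂ) : ContinuousAt (fun q : ℝ × ℂ => (T q.1 : ℂ)) (t₀, z) :=
    Complex.continuous_ofReal.continuousAt.comp (hT.continuousAt.comp
      (f := fun q : ℝ × ℂ => q.1) (x := (t₀, z)) continuousAt_fst)
  have hT'c (z : ℂ) : ContinuousAt (fun q : ℝ × ℂ => ((deriv T q.1 / T q.1 : ℝ) : ℂ)) (t₀, z) :=
    Complex.continuous_ofReal.continuousAt.comp
      (((continuousAt_deriv_of_contDiffAt hT).div hT.continuousAt h₀.pos.ne').comp
      (f := fun q : ℝ × ℂ => q.1) (x := (t₀, z)) continuousAt_fst)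
  have hdisc (z : ℂ) : ContinuousAt
      (fun q : ℝ × ℂ => aeval q.2 (realPoly r (v q.1)) ^ 2 - (T q.1 : ℂ) ^ 2) (t₀, z) :=
    ((continuousAt_aeval_realPoly hv.continuousAt z).pow 2).sub ((hTc z).pow 2)
  have hnum (z : ℂ) : ContinuousAt
      (fun q : ℝ × ℂ => q.2 * aeval q.2 (quotNum (realPoly r (v q.1)) (T q.1) (Q q.1))) (t₀, z) := by
    simp only [Q, aeval_quotNum, derivative_C_mul, map_sub, map_mul,
      aeval_C, Complex.coe_algebraMap]
    have hv' := continuousAt_deriv_of_contDiffAt hv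
    exact continuousAt_snd.mul ((((continuousAt_aeval_derivative_lowPoly hv' z).sub
      ((hT'c z).mul (continuousAt_aeval_derivative_realPoly hv.continuousAt z))).mul (hdisc z)).sub
      ((((continuousAt_aeval_lowPoly hv' z).sub
        ((hT'c z).mul (continuousAt_aeval_realPoly hv.continuousAt z))).mul
        (continuousAt_aeval_realPoly hv.continuousAt z)).mul
        (continuousAt_aeval_derivative_realPoly hv.continuousAt z)))
  have hlow : ∀ᶠ t in 𝓝 t₀, ∀ z ∈ K,
      (μ / 2) ^ 2 < ‖aeval z (realPoly r (v t)) ^ 2 - (T t : ℂ) ^ 2‖ := by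
    refine hKc.eventually_forall_of_forall_eventually fun z hz => ?_
    refine (hdisc z).norm.eventually_const_lt ?_
    obtain ⟨θ, hθ, rfl⟩ := hz
    have h1 := hmle θ hθ 0 le_rfl
    rw [Complex.ofReal_zero, zero_mul, add_zero] at h1
    beta_reduce
    rw [← h₀.norm_rootProd_sq hr]
    have : (μ / 2) ^ 2 < μ ^ 2 := by nlinarith
    exact this.trans_le (by gcongr)
  obtain ⟨M, hM⟩ := hKc.exists_bound_of_continuousOn
    (f := fun z : ℂ => z * aeval z (quotNum (realPoly r (v t₀)) (T t₀) (Q t₀)))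
    (continuous_id.mul (quotNum _ _ _).continuous_aeval).continuousOn
  have hup : ∀ᶠ t in 𝓝 t₀, ∀ z ∈ K,
      ‖z * aeval z (quotNum (realPoly r (v t)) (T t) (Q t))‖ < M + 1 := by
    refine hKc.eventually_forall_of_forall_eventually fun z hz => ?_
    exact (hnum z).norm.eventually_lt_const ((hM z hz).trans_lt (lt_add_one M))
  have hbound : ∀ᶠ t in 𝓝 t₀, ∀ θ ∈ Set.Ioo 0 Real.pi,
      ‖f' t (circleMap c ρ θ)‖ ≤ (M + 1) / (μ / 2) ^ 3 := by
    filter_upwards [h, hlow, hup] with t ht hlt hut θ hθ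
    have hz := circleMap_im_pos (c := c) hρ hθ
    have hzK : circleMap c ρ θ ∈ K := ⟨θ, Set.Ioo_subset_Icc_self hθ, rfl⟩
    have h1 := hlt _ hzK
    rw [← sheetRoot_sq _ (ht.aeval_ne_zero hr hz.ne'), norm_pow] at h1
    have h2 := (lt_of_pow_lt_pow_left₀ 2 (norm_nonneg _) h1).le
    have h3 := (hut _ hzK).le
    simp only [f']
    rw [← mul_div_assoc, norm_div, norm_pow]
    exact div_le_div₀ ((norm_nonneg _).trans h3) h3 (by positivity) (by gcongr)
  have hcont : ∀ᶠ t in 𝓝 t₀, ContinuousOn (f t) {z | 0 < z.im} := by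
    filter_upwards [h] with t ht
    refine (hasBoundaryValues_polyQuot (s t) (2 * r)
      (X * derivative (realPoly r (v t)))).diff.continuousOn.congr fun z hz => ?_
    simp only [f, polyQuot]
    rw [ht.sheetRoot_eq_rootProd hr hz]
  have hf'eq : ∀ z : ℂ, 0 < z.im → f' t₀ z =
      z * (aeval z (quotNum (realPoly r (v t₀)) (T t₀) (Q t₀)) / rootProd (s t₀) (2 * r) z ^ 3) := by
    intro z hz
    simp only [f']
    rw [h₀.sheetRoot_eq_rootProd hr hz]
  have hcont' : ContinuousOn (f' t₀) {z | 0 < z.im} := by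
    refine ContinuousOn.congr (continuousOn_id.mul ((quotNum _ _ _).continuous_aeval.continuousOn.div
      (fun z hz => ((differentiableAt_rootProd (s t₀) (2 * r) hz).continuousAt.pow
        3).continuousWithinAt) fun z hz => pow_ne_zero 3 (rootProd_ne_zero_of_im_pos _ _ hz)))
      fun z hz => hf'eq z hz
  have hint : IntervalIntegrable (fun θ : ℝ => circleMap 0 ρ θ * Complex.I *
      f t₀ (circleMap c ρ θ)) MeasureTheory.volume 0 Real.pi := by
    obtain ⟨B, hB⟩ := (hasBoundaryValues_polyQuot (s t₀) (2 * r)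
      (X * derivative (realPoly r (v t₀)))).exists_bound_semicircle hρ
      (hcρ.self_of_nhds.1.rootProd_ne_zero h₀.anti) (hcρ.self_of_nhds.2.rootProd_ne_zero h₀.anti)
    refine intervalIntegrable_semicircle hρ hcont.self_of_nhds (C := B) fun θ hθ => ?_
    have := hB θ hθ
    simp only [f]
    rwa [h₀.sheetRoot_eq_rootProd hr (circleMap_im_pos hρ hθ)]
  have hne : ∀ᵐ θ : ℝ, θ ≠ Real.pi := MeasureTheory.Measure.ae_ne _ _
  have hder := (intervalIntegral.hasDerivAt_integral_of_dominated_loc_of_deriv_le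
    (F := fun t θ => circleMap 0 ρ θ * Complex.I * f t (circleMap c ρ θ))
    (F' := fun t θ => circleMap 0 ρ θ * Complex.I * f' t (circleMap c ρ θ))
    (a := 0) (b := Real.pi) (μ := MeasureTheory.volume)
    (bound := fun _ => |ρ| * ((M + 1) / (μ / 2) ^ 3)) (hf.and hbound)
    (hcont.mono fun t ht => aestronglyMeasurable_semicircle hρ ht) hint
    (aestronglyMeasurable_semicircle hρ hcont') (by
      filter_upwards [hne] with θ hne hθ t ht
      rw [Set.uIoc_of_le Real.pi_pos.le] at hθ
      rw [norm_mul, norm_mul, norm_circleMap_zero, Complex.norm_I, mul_one]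
      exact mul_le_mul_of_nonneg_left (ht.2 θ ⟨hθ.1, lt_of_le_of_ne hθ.2 hne⟩) (abs_nonneg _))
    intervalIntegrable_const (by
      filter_upwards [hne] with θ hne hθ t ht
      rw [Set.uIoc_of_le Real.pi_pos.le] at hθ
      exact (ht.1 _ (circleMap_im_pos hρ ⟨hθ.1, lt_of_le_of_ne hθ.2 hne⟩)).const_mul _)).2
  have hder' : HasDerivAt (fun t => semicircleIntegral c ρ (f t)) (semicircleIntegral c ρ (f' t₀)) t₀ :=
    hder
  have hre : HasDerivAt (fun t => (Complex.I ^ (m + 1) * semicircleIntegral c ρ (f t)).re)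
      (Complex.I ^ (m + 1) * semicircleIntegral c ρ (f' t₀)).re t₀ :=
    (Complex.reCLM.hasFDerivAt.comp_hasDerivAt t₀ (hder'.const_mul (Complex.I ^ (m + 1))))
  rw [semicircleIntegral_congr hρ hf'eq, h₀.re_I_pow_mul_semicircleIntegral_deriv hr (Q t₀) hρ
    hcρ.self_of_nhds.1 hcρ.self_of_nhds.2] at hre
  refine hre.neg.congr_of_eventuallyEq ?_
  filter_upwards [h, hcρ] with t ht hct
  rw [Pi.neg_apply, semicircleIntegral_congr hρ (f := f t)
    (g := polyQuot (s t) (2 * r) (X * derivative (realPoly r (v t)))) (fun z hz => by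
      simp only [f, polyQuot]
      rw [ht.sheetRoot_eq_rootProd hr hz]),
    re_I_pow_mul_semicircleIntegral ht.anti _ hρ hct.1 hct.2, neg_neg]

end SeibergWitten

namespace SeibergWitten

/-! ### The prepotential at the real points -/

theorem cellIntegral_add {s : ℕ → ℝ} {n : ℕ} (hs : StrictAntiOn s (Set.Icc 1 n)) (k : ℕ)
    (A B : ℝ[X]) : cellIntegral s n k (A + B) = cellIntegral s n k A + cellIntegral s n k B := by
  unfold cellIntegral
  rw [← intervalIntegral.integral_add (intervalIntegrable_realQuot hs.injOn A _ _)
    (intervalIntegrable_realQuot hs.injOn B _ _)]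
  simp only [realQuot, eval_add, add_div]

theorem cutPeriod_add {s : ℕ → ℝ} {n : ℕ} (hs : StrictAntiOn s (Set.Icc 1 n)) (A B : ℝ[X]) (j : ℕ) :
    cutPeriod s n (A + B) j = cutPeriod s n A j + cutPeriod s n B j := by
  rw [cutPeriod, cellIntegral_add hs, mul_add]
  rfl

theorem gapSum_neg (s : ℕ → ℝ) (n : ℕ) (A : ℝ[X]) (j : ℕ) : gapSum s n (-A) j = -gapSum s n A j := by
  unfold gapSum cellIntegral
  rw [← Finset.sum_neg_distrib]
  refine Finset.sum_congr rfl fun i _ => ?_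
  simp only [realQuot, eval_neg, neg_div]
  rw [intervalIntegral.integral_neg, mul_neg]

theorem exists_eval_eq_zero_of_cellIntegral_eq_zero {s : ℕ → ℝ} {n k : ℕ}
    (hs : StrictAntiOn s (Set.Icc 1 n)) (h1 : 1 ≤ k) (hk : k + 1 ≤ n) {N : ℝ[X]}
    (h : cellIntegral s n k N = 0) : ∃ x ∈ Set.Ioo (s (k + 1)) (s k), N.eval x = 0 := by
  have hlt : s (k + 1) < s k := hs ⟨h1, by omega⟩ ⟨by omega, hk⟩ (by omega)
  have hden : ∀ x ∈ Set.Ioo (s (k + 1)) (s k), 0 < √|∏ i ∈ Finset.Icc 1 n, (x - s i)| := by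
    intro x hx
    rw [Real.sqrt_pos, abs_pos, Finset.prod_ne_zero_iff]
    exact fun i hi => sub_ne_zero.mpr ((inCell_of_mem_Ioo (by omega) hx).ne hs i hi)
  have hint := intervalIntegrable_realQuot hs.injOn N (s (k + 1)) (s k)
  by_contra! hne
  by_cases hpos : ∀ x ∈ Set.Ioo (s (k + 1)) (s k), 0 < N.eval x
  · have := intervalIntegral.intervalIntegral_pos_of_pos_on hint
      (fun x hx => div_pos (hpos x hx) (hden x hx)) hlt
    exact this.ne' h
  by_cases hneg : ∀ x ∈ Set.Ioo (s (k + 1)) (s k), N.eval x < 0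
  · have := intervalIntegral.intervalIntegral_pos_of_pos_on hint.neg
      (fun x hx => neg_pos.mpr (div_neg_of_neg_of_pos (hneg x hx) (hden x hx))) hlt
    simp only [Pi.neg_apply] at this
    rw [intervalIntegral.integral_neg] at this
    exact (neg_pos.mp this).ne h
  push Not at hpos hneg
  obtain ⟨x, hx, hx0⟩ := hpos
  obtain ⟨y, hy, hy0⟩ := hneg
  obtain ⟨z, hz, hz0⟩ := isPreconnected_Ioo.intermediate_value hx hy N.continuous.continuousOn
    ⟨hx0, hy0⟩
  exact hne z hz hz0

/-- A polynomial of degree at most `r - 2` is determined by its periods over all cuts but one. -/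
theorem IsBranchSeq.eq_zero_of_cutPeriod_eq_zero {r : ℕ} {p : ℝ[X]} {T : ℝ} {s : ℕ → ℝ}
    (h : IsBranchSeq r p T s) (hr : 2 ≤ r) {N : ℝ[X]} (hN : N.natDegree ≤ r - 2)
    (h0 : ∀ j : Fin (r - 1), cutPeriod s (2 * r) N (j + 1) = 0) : N = 0 := by
  have hex : ∀ j : Fin (r - 1), ∃ x ∈ Set.Ioo (s (2 * ((j : ℕ) + 1) + 1 + 1))
      (s (2 * ((j : ℕ) + 1) + 1)), N.eval x = 0 := by
    intro j
    have hj := j.2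
    refine exists_eval_eq_zero_of_cellIntegral_eq_zero h.anti (by omega) (by omega) ?_
    have := h0 j
    rw [cutPeriod] at this
    exact (mul_eq_zero.mp this).resolve_left (pow_ne_zero _ (by norm_num))
  choose x hx hx0 using hex
  refine Polynomial.eq_zero_of_natDegree_lt_card_of_eval_eq_zero N (f := x) ?_ hx0
    (by rw [Fintype.card_fin]; omega)
  refine StrictAnti.injective fun i j hij => ?_
  have hj := j.2
  exact h.lt_of_mem_cut (show (i : ℕ) + 1 < j + 1 by simpa using hij) (by omega)
    ⟨(hx i).1.le, (hx i).2.le⟩ ⟨(hx j).1.le, (hx j).2.le⟩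

section Variation

variable {r : ℕ} {v : ℝ → Fin (r - 1) → ℝ} {T : ℝ → ℝ} {s : ℝ → ℕ → ℝ} {t₀ : ℝ}

theorem hasDerivAt_cutPeriod (hr : 1 ≤ r) (hv : ContDiffAt ℝ 1 v t₀) (hT : ContDiffAt ℝ 1 T t₀)
    (h : ∀ᶠ t in 𝓝 t₀, IsBranchSeq r (realPoly r (v t)) (T t) (s t)) {j : ℕ} (hj : j < r) :
    HasDerivAt (fun t => cutPeriod (s t) (2 * r) (X * derivative (realPoly r (v t))) j)
      (-cutPeriod (s t₀) (2 * r)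
        (lowPoly r (deriv v t₀) - C (deriv T t₀ / T t₀) * realPoly r (v t₀)) j) t₀ := by
  have := (hasDerivAt_cellIntegral hr hv hT h (m := 2 * j) (by omega)).const_mul ((-1) ^ j)
  rwa [mul_neg] at this

theorem hasDerivAt_gapSum (hr : 1 ≤ r) (hv : ContDiffAt ℝ 1 v t₀) (hT : ContDiffAt ℝ 1 T t₀)
    (h : ∀ᶠ t in 𝓝 t₀, IsBranchSeq r (realPoly r (v t)) (T t) (s t)) {j : ℕ} (hj : j < r) :
    HasDerivAt (fun t => gapSum (s t) (2 * r) (X * derivative (realPoly r (v t))) j)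
      (-gapSum (s t₀) (2 * r)
        (lowPoly r (deriv v t₀) - C (deriv T t₀ / T t₀) * realPoly r (v t₀)) j) t₀ := by
  unfold gapSum
  rw [← Finset.sum_neg_distrib]
  refine HasDerivAt.fun_sum fun i hi => ?_
  rw [Finset.mem_Icc] at hi
  obtain ⟨i, rfl⟩ : ∃ k, i = k + 1 := ⟨i - 1, by omega⟩
  have := (hasDerivAt_cellIntegral hr hv hT h (m := 2 * i + 1) (by omega)).const_mul
    ((-1) ^ (i + 1))
  rwa [mul_neg] at this

end Variation

theorem realPoint_add_smul {r : ℕ} (b β : Fin (r - 1) → ℝ) (Λ l t : ℝ) :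
    (realPoint (b + t • β) (Λ + t * l) : (Fin (r - 1) → ℂ) × ℂ) =
      realPoint b Λ + t • realPoint β l := by
  refine Prod.ext ?_ ?_
  · funext j
    simp [realPoint]
    ring
  · simp [realPoint]

theorem hasDerivAt_realPoint {r : ℕ} {E : Type*} [NormedAddCommGroup E] [NormedSpace ℂ E]
    {G : (Fin (r - 1) → ℂ) × ℂ → E} {b : Fin (r - 1) → ℝ}
    {Λ : ℝ} (hG : DifferentiableAt ℂ G (realPoint b Λ)) (β : Fin (r - 1) → ℝ) (l : ℝ) :
    HasDerivAt (fun t : ℝ => G (realPoint (b + t • β) (Λ + t * l)))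
      (fderiv ℂ G (realPoint b Λ) (realPoint β l)) 0 := by
  simp only [realPoint_add_smul]
  have h1 : HasDerivAt (fun t : ℝ => realPoint b Λ + t • realPoint β l) (realPoint β l) 0 := by
    simpa using ((hasDerivAt_id (0 : ℝ)).smul_const (realPoint β l)).const_add (realPoint b Λ)
  have h2 : HasFDerivAt G (fderiv ℂ G (realPoint b Λ)) (realPoint b Λ + (0 : ℝ) • realPoint β l) := by
    simpa using hG.hasFDerivAt
  exact (h2.restrictScalars ℝ).comp_hasDerivAt (0 : ℝ) h1

theorem contDiffAt_re_realPoint {r : ℕ}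
    {u : (Fin (r - 1) → ℂ) × ℂ → Fin (r - 1) → ℂ} {b : Fin (r - 1) → ℝ} {Λ : ℝ}
    (hu : AnalyticAt ℂ u (realPoint b Λ)) (β : Fin (r - 1) → ℝ) (l : ℝ) :
    ContDiffAt ℝ 1 (fun (t : ℝ) i => (u (realPoint (b + t • β) (Λ + t * l)) i).re) 0 := by
  simp only [realPoint_add_smul]
  have h1 : ContDiffAt ℝ 1 (fun t : ℝ => realPoint b Λ + t • realPoint β l) 0 := by fun_prop
  have h2 : ContDiffAt ℝ 1 u (realPoint b Λ + (0 : ℝ) • realPoint β l) := by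
    rw [zero_smul, add_zero]
    exact (hu.contDiffAt (n := 1)).restrict_scalars ℝ
  have h3 := h2.comp (0 : ℝ) h1
  rw [contDiffAt_pi] at h3 ⊢
  exact fun i => Complex.reCLM.contDiff.contDiffAt.comp (0 : ℝ) (h3 i)

/-- The real points around which the curve is described by `IsSWBranch`. -/
def RealRegion {r : ℕ} (b₀ : Fin (r - 1) → ℝ) (ε : ℝ) (b : Fin (r - 1) → ℝ) (Λ : ℝ) : Prop :=
  dist b b₀ < ε ∧ 0 < Λ ∧ Λ < ε

theorem RealRegion.eventually {r : ℕ} {b₀ b : Fin (r - 1) → ℝ} {ε Λ : ℝ}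
    (h : RealRegion b₀ ε b Λ) (β : Fin (r - 1) → ℝ) (l : ℝ) :
    ∀ᶠ t : ℝ in 𝓝 0, RealRegion b₀ ε (b + t • β) (Λ + t * l) := by
  have h1 : ContinuousAt (fun t : ℝ => dist (b + t • β) b₀) 0 := by fun_prop
  have h2 : ContinuousAt (fun t : ℝ => Λ + t * l) 0 := by fun_prop
  refine (h1.eventually_lt_const (by simpa using h.1)).and
    ((h2.eventually_const_lt (by simpa using h.2.1)).and (h2.eventually_lt_const (by simpa using h.2.2)))

/-- The curve at a real point: real coefficients, branch points, and the periods as real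
integrals. -/
structure RealCurve (r : ℕ) (b : Fin (r - 1) → ℝ) (Λ : ℝ) (w d : Fin (r - 1) → ℂ)
    (s : ℕ → ℝ) : Prop where
  real : ∀ i, w i = ((w i).re : ℂ)
  branch : IsBranchSeq r (realPoly r fun i => (w i).re) (2 * Λ ^ r) s
  period : ∀ j : Fin (r - 1), b j =
    (1 / Real.pi) * cutPeriod s (2 * r) (X * derivative (realPoly r fun i => (w i).re)) (j + 1)
  dual : ∀ j : Fin (r - 1), d j =
    2 * Complex.I * (gapSum s (2 * r) (X * derivative (realPoly r fun i => (w i).re)) (j + 1) : ℂ)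

variable {r : ℕ} {V : Set ((Fin (r - 1) → ℂ) × ℂ)}
  {u aD : (Fin (r - 1) → ℂ) × ℂ → Fin (r - 1) → ℂ} {b₀ : Fin (r - 1) → ℝ} {ε : ℝ}

theorem IsSWBranch.exists_realCurve (hV : IsSWBranch r V u aD b₀ ε) (hr : 2 ≤ r)
    {b : Fin (r - 1) → ℝ} {Λ : ℝ} (h : RealRegion b₀ ε b Λ) :
    ∃ s, RealCurve r b Λ (u (realPoint b Λ)) (aD (realPoint b Λ)) s := by
  obtain ⟨zp, zm, hbr, hper⟩ := hV.real_periods b h.1 Λ h.2.1 h.2.2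
  have hreal : ∀ i, u (realPoint b Λ) i = ((u (realPoint b Λ) i).re : ℂ) := fun i =>
    Complex.ext (by simp) (by simpa using hbr.coeff_real i)
  have hu : u (realPoint b Λ) = fun i => (((u (realPoint b Λ) i).re : ℝ) : ℂ) := funext hreal
  set v : Fin (r - 1) → ℝ := fun i => (u (realPoint b Λ) i).re
  rw [hu] at hbr hper
  have hB := hbr.isBranchSeq hr
  refine ⟨branchSeq zp zm, hreal, hB, fun j => ?_, fun j => ?_⟩
  · have hj := j.2
    have := IsAPeriod.eq_cutPeriod hr hB (j := j + 1) (by omega) (hper j).1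
    simp only [realPoint] at this
    exact_mod_cast mul_left_cancel₀ (neg_ne_zero.mpr Complex.I_ne_zero) this
  · have hj := j.2
    rw [(hper j).2]
    exact dualPeriod_eq_gapSum hr hB (j := j + 1) (by omega)

/-- The variation of the curve in the real direction `(β, l)`: the derivatives of the periods are
periods of the differential with numerator `lowPoly v' - (r l / Λ) p`, up to the factor of `dS`. -/
theorem IsSWBranch.variation (hV : IsSWBranch r V u aD b₀ ε) (hr : 2 ≤ r)
    {b : Fin (r - 1) → ℝ} {Λ : ℝ} (h : RealRegion b₀ ε b Λ) (β : Fin (r - 1) → ℝ) (l : ℝ) :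
    ∃ (s : ℕ → ℝ) (v' : Fin (r - 1) → ℝ),
      RealCurve r b Λ (u (realPoint b Λ)) (aD (realPoint b Λ)) s ∧
      HasDerivAt (fun t : ℝ => u (realPoint (b + t • β) (Λ + t * l)))
        (fun i => (v' i : ℂ)) 0 ∧
      (∀ j : Fin (r - 1), β j = -((1 / Real.pi) * cutPeriod s (2 * r) (lowPoly r v' -
        C (r * l / Λ) * realPoly r fun i => (u (realPoint b Λ) i).re) (j + 1))) ∧
      ∀ j : Fin (r - 1), HasDerivAt (fun t : ℝ => aD (realPoint (b + t • β) (Λ + t * l)) j)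
        (-(2 * Complex.I * (gapSum s (2 * r) (lowPoly r v' -
          C (r * l / Λ) * realPoly r fun i => (u (realPoint b Λ) i).re) (j + 1) : ℂ))) 0 := by
  have hmem := hV.real_mem b h.1 Λ h.2.1 h.2.2
  let c : ℝ → Fin (r - 1) → ℝ := fun t => b + t • β
  let L : ℝ → ℝ := fun t => Λ + t * l
  choose! s hs using fun (t : ℝ) (ht : RealRegion b₀ ε (c t) (L t)) => hV.exists_realCurve hr ht
  have hev := h.eventually β l
  let v : ℝ → Fin (r - 1) → ℝ := fun t i => (u (realPoint (c t) (L t)) i).re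
  let T : ℝ → ℝ := fun t => 2 * L t ^ r
  have hv : ContDiffAt ℝ 1 v 0 := contDiffAt_re_realPoint (hV.analytic_u _ hmem) β l
  have hT : ContDiffAt ℝ 1 T 0 := by
    simp only [T, L]
    fun_prop
  have hB : ∀ᶠ t in 𝓝 (0 : ℝ), IsBranchSeq r (realPoly r (v t)) (T t) (s t) :=
    hev.mono fun t ht => (hs t ht).branch
  have hc0 : c 0 = b := by simp [c]
  have hL0 : L 0 = Λ := by simp [L]
  have hv0 : v 0 = fun i => (u (realPoint b Λ) i).re := by
    simp only [v, hc0, hL0]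
  have hT0 : deriv T 0 / T 0 = r * l / Λ := by
    have h1 : HasDerivAt T (2 * (r * L 0 ^ (r - 1) * l)) 0 := by
      have : HasDerivAt L l 0 := by
        simpa [L] using ((hasDerivAt_id (0 : ℝ)).mul_const l).const_add Λ
      exact (this.pow r).const_mul 2
    have hΛ := h.2.1.ne'
    rw [h1.deriv, hL0]
    simp only [T, hL0]
    obtain ⟨m, rfl⟩ : ∃ m, r = m + 1 := ⟨r - 1, by omega⟩
    rw [Nat.add_sub_cancel, pow_succ]
    field_simp
  refine ⟨s 0, deriv v 0, ?_, ?_, fun j => ?_, fun j => ?_⟩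
  · have := hs 0 (by rw [hc0, hL0]; exact h)
    rwa [hc0, hL0] at this
  · have h1 := (hv.differentiableAt one_ne_zero).hasDerivAt
    rw [hasDerivAt_pi] at h1 ⊢
    intro i
    refine (h1 i).ofReal_comp.congr_of_eventuallyEq ?_
    filter_upwards [hev] with t ht
    exact (hs t ht).real i
  · have hj := j.2
    have h1 := (hasDerivAt_cutPeriod (by omega) hv hT hB (j := j + 1) (by omega)).const_mul
      (1 / Real.pi)
    rw [hv0, hT0, mul_neg] at h1
    have h2 : HasDerivAt (fun t : ℝ => b j + t * β j) (β j) 0 := by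
      simpa using ((hasDerivAt_id (0 : ℝ)).mul_const (β j)).const_add (b j)
    refine (h1.congr_of_eventuallyEq ?_).unique h2 |>.symm
    filter_upwards [hev] with t ht
    have := (hs t ht).period j
    simp only [c, Pi.add_apply, Pi.smul_apply, smul_eq_mul] at this
    exact this
  · have hj := j.2
    have h1 := ((hasDerivAt_gapSum (by omega) hv hT hB (j := j + 1) (by omega)).ofReal_comp).const_mul
      (2 * Complex.I)
    rw [hv0, hT0, Complex.ofReal_neg, mul_neg] at h1
    refine h1.congr_of_eventuallyEq ?_
    filter_upwards [hev] with t ht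
    exact (hs t ht).dual j

end SeibergWitten

namespace SeibergWitten

theorem sum_range_eq_add_sum_fin {r : ℕ} (hr : 1 ≤ r) (f : ℕ → ℝ) :
    ∑ j ∈ Finset.range r, f j = f 0 + ∑ j : Fin (r - 1), f (j + 1) := by
  obtain ⟨m, rfl⟩ : ∃ m, r = m + 1 := ⟨r - 1, by omega⟩
  rw [Finset.sum_range_succ', Finset.sum_range, add_comm]
  rfl

theorem fderiv_eq_partials {r : ℕ} (F : (Fin (r - 1) → ℂ) × ℂ → ℂ) (p w : (Fin (r - 1) → ℂ) × ℂ) :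
    fderiv ℂ F p w = (∑ j, w.1 j * partialA F p j) + w.2 * partialScale F p := by
  have hw : w = (∑ j, w.1 j • ((Pi.single j 1, 0) : (Fin (r - 1) → ℂ) × ℂ)) +
      w.2 • ((0, 1) : (Fin (r - 1) → ℂ) × ℂ) := by
    refine Prod.ext ?_ ?_
    · funext i
      simp [Prod.fst_sum, Finset.sum_apply, Pi.single_apply]
    · simp [Prod.snd_sum]
  conv_lhs => rw [hw]
  rw [map_add, map_sum, map_smul]
  simp only [map_smul, smul_eq_mul, partialA, partialScale]

/-- The defect `2 F + ∑ a_α a^D_α + 2 r u_2`; by the Euler relation it is the difference of the two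
sides of the equation for `Λ ∂F / ∂Λ`. -/
noncomputable def defect (r : ℕ) (i₀ : Fin (r - 1)) (u aD : (Fin (r - 1) → ℂ) × ℂ → Fin (r - 1) → ℂ)
    (F : (Fin (r - 1) → ℂ) × ℂ → ℂ) (p : (Fin (r - 1) → ℂ) × ℂ) : ℂ :=
  2 * F p + ∑ j, p.1 j * aD p j + 2 * r * u p i₀

variable {r : ℕ} {V : Set ((Fin (r - 1) → ℂ) × ℂ)}
  {u aD : (Fin (r - 1) → ℂ) × ℂ → Fin (r - 1) → ℂ} {b₀ : Fin (r - 1) → ℝ} {ε : ℝ}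
  {F : (Fin (r - 1) → ℂ) × ℂ → ℂ}

theorem IsPrepotential.defect_eq (hF : IsPrepotential r V aD b₀ ε F) (i₀ : Fin (r - 1))
    {p : (Fin (r - 1) → ℂ) × ℂ} (hp : p ∈ V) :
    defect r i₀ u aD F p = p.2 * partialScale F p + 2 * r * u p i₀ := by
  have h1 := hF.euler p hp
  have h2 : ∑ j, p.1 j * aD p j = -∑ j, p.1 j * partialA F p j := by
    rw [← Finset.sum_neg_distrib]
    exact Finset.sum_congr rfl fun j _ => by rw [hF.gradient p hp j, mul_neg]
  rw [defect, h2]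
  linear_combination -h1

theorem IsPrepotential.analyticOnNhd_defect (hV : IsSWBranch r V u aD b₀ ε)
    (hF : IsPrepotential r V aD b₀ ε F) (i₀ : Fin (r - 1)) :
    AnalyticOnNhd ℂ (defect r i₀ u aD F) V := by
  intro p hp
  have h1 : ∀ j, AnalyticAt ℂ (fun p => aD p j) p := fun j =>
    (ContinuousLinearMap.proj (R := ℂ) (φ := fun _ : Fin (r - 1) => ℂ) j).analyticAt _ |>.comp
      (hV.analytic_aD p hp)
  have h2 : ∀ j, AnalyticAt ℂ (fun p => u p j) p := fun j =>
    (ContinuousLinearMap.proj (R := ℂ) (φ := fun _ : Fin (r - 1) => ℂ) j).analyticAt _ |>.comp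
      (hV.analytic_u p hp)
  have h3 : ∀ j, AnalyticAt ℂ (fun p : (Fin (r - 1) → ℂ) × ℂ => p.1 j) p := fun j =>
    ((ContinuousLinearMap.proj (R := ℂ) (φ := fun _ : Fin (r - 1) => ℂ) j).comp
      (ContinuousLinearMap.fst ℂ (Fin (r - 1) → ℂ) ℂ)).analyticAt _
  have h4 : AnalyticAt ℂ (fun p => ∑ j, p.1 j * aD p j) p :=
    Finset.analyticAt_fun_sum _ fun j _ => (h3 j).mul (h1 j)
  exact ((analyticAt_const.mul (hF.analytic p hp)).add h4).add (analyticAt_const.mul (h2 i₀))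

/-- The derivative of the defect in a real direction. -/
theorem IsPrepotential.fderiv_defect (hV : IsSWBranch r V u aD b₀ ε)
    (hF : IsPrepotential r V aD b₀ ε F) (i₀ : Fin (r - 1)) {b β : Fin (r - 1) → ℝ} {Λ l : ℝ}
    (h : RealRegion b₀ ε b Λ) {u' aD' : Fin (r - 1) → ℂ}
    (hu : HasDerivAt (fun t : ℝ => u (realPoint (b + t • β) (Λ + t * l))) u' 0)
    (haD : ∀ j, HasDerivAt (fun t : ℝ => aD (realPoint (b + t • β) (Λ + t * l)) j) (aD' j) 0) :
    fderiv ℂ (defect r i₀ u aD F) (realPoint b Λ) (realPoint β l) =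
      2 * fderiv ℂ F (realPoint b Λ) (realPoint β l) +
        ∑ j, (-Complex.I * β j * aD (realPoint b Λ) j + -Complex.I * b j * aD' j) +
          2 * r * u' i₀ := by
  have hmem := hV.real_mem b h.1 Λ h.2.1 h.2.2
  have h1 := hasDerivAt_realPoint
    (IsPrepotential.analyticOnNhd_defect hV hF i₀ _ hmem).differentiableAt β l
  have h2 := hasDerivAt_realPoint (hF.analytic _ hmem).differentiableAt β l
  have h3 : ∀ j, HasDerivAt (fun t : ℝ => (realPoint (b + t • β) (Λ + t * l)).1 j)
      (-Complex.I * β j) 0 := by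
    intro j
    have h4 : HasDerivAt (fun t : ℝ => b j + t * β j) (β j) 0 := by
      simpa using ((hasDerivAt_id (0 : ℝ)).mul_const (β j)).const_add (b j)
    have := h4.ofReal_comp.const_mul (-Complex.I)
    refine this.congr_of_eventuallyEq (.of_forall fun t => ?_)
    simp [realPoint]
  have h5 : HasDerivAt (fun t : ℝ => ∑ j, (realPoint (b + t • β) (Λ + t * l)).1 j *
      aD (realPoint (b + t • β) (Λ + t * l)) j)
      (∑ j, (-Complex.I * β j * aD (realPoint b Λ) j + -Complex.I * b j * aD' j)) 0 := by
    refine HasDerivAt.fun_sum fun j _ => ?_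
    have := (h3 j).mul (haD j)
    simp only [zero_smul, add_zero, zero_mul] at this
    exact this
  exact h1.unique (((h2.const_mul 2).add h5).add ((hasDerivAt_pi.mp hu i₀).const_mul (2 * (r : ℂ))))

/-- At the real points the defect does not depend on `a`, by the bilinear relation. -/
theorem IsPrepotential.fderiv_defect_horizontal (hr : 2 ≤ r) (hV : IsSWBranch r V u aD b₀ ε)
    (hF : IsPrepotential r V aD b₀ ε F) {b : Fin (r - 1) → ℝ} {Λ : ℝ}
    (h : RealRegion b₀ ε b Λ) (β : Fin (r - 1) → ℝ) :
    fderiv ℂ (defect r ⟨0, sub_one_pos hr⟩ u aD F) (realPoint b Λ) (realPoint β 0) = 0 := by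
  have hmem := hV.real_mem b h.1 Λ h.2.1 h.2.2
  obtain ⟨s, v', hC, hu, hβ, haD⟩ := hV.variation hr h β 0
  rw [hF.fderiv_defect hV _ h hu haD, fderiv_eq_partials]
  simp only [mul_zero, zero_div, map_zero, zero_mul, sub_zero] at hβ haD ⊢
  have hbil := hC.branch.bilinear hr (coeff_realPoly_sub_one hr _) (natDegree_lowPoly_le r v')
  rw [coeff_lowPoly hr, sum_range_eq_add_sum_fin (by omega)] at hbil
  have hzero : ∀ A : ℝ[X], gapSum s (2 * r) A 0 = 0 := fun A => by simp [gapSum]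
  have hpi := Real.pi_pos.ne'
  have hreal : ∑ j : Fin (r - 1), (b j * gapSum s (2 * r) (lowPoly r v') (j + 1) + β j *
      gapSum s (2 * r) (X * derivative (realPoly r fun i => (u (realPoint b Λ) i).re)) (j + 1)) =
      r * v' ⟨0, sub_one_pos hr⟩ := by
    rw [hzero, hzero, mul_zero, mul_zero, sub_zero, zero_add] at hbil
    have h1 : ∀ j : Fin (r - 1), b j * gapSum s (2 * r) (lowPoly r v') (j + 1) + β j *
        gapSum s (2 * r) (X * derivative (realPoly r fun i => (u (realPoint b Λ) i).re)) (j + 1) =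
        (1 / Real.pi) * (cutPeriod s (2 * r) (X * derivative (realPoly r fun i =>
          (u (realPoint b Λ) i).re)) (j + 1) * gapSum s (2 * r) (lowPoly r v') (j + 1) -
          cutPeriod s (2 * r) (lowPoly r v') (j + 1) * gapSum s (2 * r) (X * derivative
            (realPoly r fun i => (u (realPoint b Λ) i).re)) (j + 1)) := by
      intro j
      rw [hβ j, hC.period j]
      ring
    rw [Finset.sum_congr rfl fun j _ => h1 j, ← Finset.mul_sum, hbil]
    field_simp
  have hcast := congrArg (fun x : ℝ => (x : ℂ)) hreal
  push_cast at hcast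
  have hsum : ∑ j, (realPoint β 0).1 j * partialA F (realPoint b Λ) j =
      ∑ j, Complex.I * β j * aD (realPoint b Λ) j := by
    refine Finset.sum_congr rfl fun j _ => ?_
    rw [hF.gradient _ hmem j]
    simp only [realPoint]
    ring
  rw [hsum, show (realPoint β 0 : (Fin (r - 1) → ℂ) × ℂ).2 = 0 by simp [realPoint], zero_mul,
    add_zero, mul_assoc 2 (r : ℂ), ← hcast, Finset.mul_sum, Finset.mul_sum, ← Finset.sum_add_distrib,
    ← Finset.sum_add_distrib]
  refine Finset.sum_eq_zero fun j _ => ?_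
  rw [hC.dual j]
  linear_combination (2 * (b j : ℂ) * (gapSum s (2 * r) (lowPoly r v') (j + 1) : ℂ) +
    2 * (β j : ℂ) * (gapSum s (2 * r) (X * derivative (realPoly r fun i =>
      (u (realPoint b Λ) i).re)) (j + 1) : ℂ)) * Complex.I_sq

/-- At the real points the defect is homogeneous of degree `2`. -/
theorem IsPrepotential.fderiv_defect_ray (hr : 2 ≤ r) (hV : IsSWBranch r V u aD b₀ ε)
    (hF : IsPrepotential r V aD b₀ ε F) {b : Fin (r - 1) → ℝ} {Λ : ℝ}
    (h : RealRegion b₀ ε b Λ) :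
    fderiv ℂ (defect r ⟨0, sub_one_pos hr⟩ u aD F) (realPoint b Λ) (realPoint b Λ) =
      2 * defect r ⟨0, sub_one_pos hr⟩ u aD F (realPoint b Λ) := by
  have hmem := hV.real_mem b h.1 Λ h.2.1 h.2.2
  obtain ⟨s, v', hC, hu, hβ, haD⟩ := hV.variation hr h b Λ
  have hΛ := h.2.1.ne'
  rw [mul_div_cancel_right₀ _ hΛ] at hβ haD
  rw [hF.fderiv_defect hV _ h hu haD]
  set p := realPoly r fun i => (u (realPoint b Λ) i).re with hp
  -- Homogeneity of the periods shows that the curve varies by rescaling `z`.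
  have hn : lowPoly r v' + (X * derivative p - C (r : ℝ) * p) = 0 := by
    refine hC.branch.eq_zero_of_cutPeriod_eq_zero hr ?_ fun j => ?_
    · exact natDegree_add_le_of_degree_le (natDegree_lowPoly_le r v')
        (natDegree_X_mul_derivative_sub_le hr (natDegree_realPoly hr _)
          (coeff_realPoly_sub_one hr _))
    · rw [show lowPoly r v' + (X * derivative p - C (r : ℝ) * p) =
        (lowPoly r v' - C (r : ℝ) * p) + X * derivative p by ring, cutPeriod_add hC.branch.anti]
      have h1 := hβ j
      have h2 := hC.period j
      have hpi := Real.pi_pos.ne'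
      field_simp at h1 h2
      linarith
  have hQ : lowPoly r v' - C (r : ℝ) * p = -(X * derivative p) := by
    linear_combination hn
  have hcoeff : v' ⟨0, sub_one_pos hr⟩ = 2 * (u (realPoint b Λ) ⟨0, sub_one_pos hr⟩).re := by
    have h1 := congrArg (fun q : ℝ[X] => q.coeff (r - 2)) hn
    have h2 : p.coeff (r - 2) = (u (realPoint b Λ) ⟨0, sub_one_pos hr⟩).re := by
      rw [hp, realPoly, coeff_add, coeff_X_pow, if_neg (by omega), zero_add, coeff_lowPoly hr]
    have h3 : (X * derivative p).coeff (r - 2) = (r - 2 : ℝ) * p.coeff (r - 2) := by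
      rcases Nat.eq_or_lt_of_le hr with h | h
      · subst h; simp
      · obtain ⟨m, rfl⟩ : ∃ m, r = m + 3 := ⟨r - 3, by omega⟩
        rw [show m + 3 - 2 = m + 1 by omega, coeff_X_mul, coeff_derivative]
        push_cast
        ring
    simp only [coeff_add, coeff_sub, coeff_C_mul, coeff_lowPoly hr, h3, h2, coeff_zero] at h1
    linarith
  have haD' : ∀ j, -(2 * Complex.I * (gapSum s (2 * r) (lowPoly r v' - C (r : ℝ) * p)
      ((j : Fin (r - 1)) + 1) : ℂ)) = aD (realPoint b Λ) j := by
    intro j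
    rw [hQ, gapSum_neg, hC.dual j]
    push_cast
    ring
  have hE : fderiv ℂ F (realPoint b Λ) (realPoint b Λ) = 2 * F (realPoint b Λ) := by
    rw [fderiv_eq_partials]
    exact hF.euler _ hmem
  rw [hE, defect]
  simp only [haD', hcoeff]
  rw [hC.real ⟨0, sub_one_pos hr⟩]
  simp only [realPoint, Finset.sum_add_distrib, Complex.ofReal_re]
  push_cast
  ring

end SeibergWitten

namespace SeibergWitten

/-! ### The distribution on a cut -/

/-- The mean of a polynomial `N` over the cut with number `j + 1`, with respect to the density
`|p'| / (π √(T ^ 2 - p ^ 2))`. -/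
noncomputable def cutMean (r : ℕ) (p : ℝ[X]) (s : ℕ → ℝ) (j : ℕ) (N : ℝ[X]) : ℝ :=
  (1 / Real.pi) * cutPeriod s (2 * r) (N * derivative p) j

namespace IsBranchSeq

variable {r : ℕ} {p : ℝ[X]} {T : ℝ} {s : ℕ → ℝ}

theorem cutMean_add (h : IsBranchSeq r p T s) (j : ℕ) (A B : ℝ[X]) :
    cutMean r p s j (A + B) = cutMean r p s j A + cutMean r p s j B := by
  rw [cutMean, add_mul, cutPeriod_add h.anti, mul_add]
  rfl

theorem cutMean_C_mul (j : ℕ) (c : ℝ) (A : ℝ[X]) :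
    cutMean r p s j (C c * A) = c * cutMean r p s j A := by
  unfold cutMean cutPeriod cellIntegral
  have : ∀ x, realQuot s (2 * r) (C c * A * derivative p) x =
      c * realQuot s (2 * r) (A * derivative p) x := fun x => by
    simp only [realQuot, eval_mul, eval_C]
    ring
  simp only [this]
  rw [intervalIntegral.integral_const_mul]
  ring

/-- By Rolle's theorem all zeros of `p'` lie in the gaps, which gives its sign on the cuts. -/
theorem derivative_nonneg (h : IsBranchSeq r p T s) (hr : 1 ≤ r) {j : ℕ} (hj : j < r) {x : ℝ}
    (hx : x ∈ Set.Icc (s (2 * j + 2)) (s (2 * j + 1))) :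
    0 ≤ (-1) ^ j * (derivative p).eval x := by
  have hrolle : ∀ i ∈ Finset.Icc 1 (r - 1), ∃ ξ ∈ Set.Ioo (s (2 * i + 1)) (s (2 * i)),
      (derivative p).eval ξ = 0 := by
    intro i hi
    rw [Finset.mem_Icc] at hi
    obtain ⟨ξ, hξ, h0⟩ := exists_deriv_eq_zero (f := fun x => p.eval x)
      (h.anti ⟨by omega, by omega⟩ ⟨by omega, by omega⟩ (show 2 * i < 2 * i + 1 by omega))
      p.continuous.continuousOn (by
        rw [h.val _ (by simp; omega), h.val _ (by simp; omega),
          show (2 * i + 1) / 2 = 2 * i / 2 by omega])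
    exact ⟨ξ, hξ, by rwa [Polynomial.deriv] at h0⟩
  choose! ξ hξ hξ0 using hrolle
  have hanti : StrictAntiOn ξ (Set.Icc 1 (r - 1)) := by
    intro i hi k hk hik
    have h1 := (hξ i (by simpa using hi)).1
    have h2 := (hξ k (by simpa using hk)).2
    have h3 := h.anti.antitoneOn ⟨by omega, by have := hi.2; omega⟩
      ⟨by omega, by have := hk.1; have := hk.2; omega⟩ (show 2 * i + 1 ≤ 2 * k by omega)
    linarith
  have hr0 : (r : ℝ) ≠ 0 := by exact_mod_cast (by omega : r ≠ 0)
  have hlead : (derivative p).coeff (r - 1) = r := by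
    rw [coeff_derivative, show r - 1 + 1 = p.natDegree by rw [h.natDegree]; omega,
      h.monic.coeff_natDegree, Nat.cast_sub hr]
    simp
  have hdeg : (derivative p).natDegree = r - 1 := by
    refine natDegree_eq_of_le_of_coeff_ne_zero ?_ (by rwa [hlead])
    exact (natDegree_derivative_le p).trans_eq (by rw [h.natDegree])
  have hprod : C (r : ℝ)⁻¹ * derivative p = ∏ i ∈ Finset.Icc 1 (r - 1), (X - C (ξ i)) := by
    refine monic_eq_prod_of_roots ?_ _ _ (by simpa using hanti.injOn) (fun k hk => ?_) ?_
    · rw [Monic, leadingCoeff_mul, leadingCoeff_C, leadingCoeff, hdeg, hlead, inv_mul_cancel₀ hr0]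
    · rw [eval_mul, hξ0 k hk, mul_zero]
    · rw [natDegree_C_mul (inv_ne_zero hr0), hdeg]
      simp
  have hcell : InCell ξ (r - 1) j x := by
    refine ⟨by omega, fun h1 => ?_, fun h1 => ?_⟩
    · have h2 := (hξ j (by simp; omega)).1
      exact hx.2.trans_lt h2
    · have h2 := (hξ (j + 1) (by simp; omega)).2
      exact h2.trans_le hx.1
  have heval := congrArg (eval x) hprod
  rw [eval_mul, eval_C, eval_prod] at heval
  simp only [eval_sub, eval_X, eval_C] at heval
  rw [prod_sub_eq_neg_one_pow, hcell.countAbove_eq hanti] at heval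
  have hsq : ((-1 : ℝ) ^ j) * (-1) ^ j = 1 := by rw [← mul_pow]; simp
  have : (-1) ^ j * (derivative p).eval x = r * |∏ i ∈ Finset.Icc 1 (r - 1), (x - ξ i)| := by
    rw [← mul_left_cancel_iff_of_pos (show (0 : ℝ) < (r : ℝ)⁻¹ by positivity), mul_left_comm, heval,
      ← mul_assoc, hsq]
    field_simp
  rw [this]
  positivity

theorem cutMean_nonneg (h : IsBranchSeq r p T s) (hr : 1 ≤ r) {j : ℕ} (hj : j < r) {N : ℝ[X]}
    (hN : ∀ x ∈ Set.Icc (s (2 * j + 2)) (s (2 * j + 1)), 0 ≤ N.eval x) :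
    0 ≤ cutMean r p s j N := by
  rw [cutMean, cutPeriod, cellIntegral, ← intervalIntegral.integral_const_mul]
  refine mul_nonneg (by have := Real.pi_pos; positivity)
    (intervalIntegral.integral_nonneg (h.cut_lt hj).le fun x hx => ?_)
  rw [realQuot, eval_mul, ← mul_div_assoc, mul_left_comm]
  exact div_nonneg (mul_nonneg (hN x hx) (h.derivative_nonneg hr hj hx)) (Real.sqrt_nonneg _)

theorem sq_lt_of_mem_cut (h : IsBranchSeq r p T s) (hr : 1 ≤ r) {j : ℕ} (hj : j < r) {x : ℝ}
    (hx : x ∈ Set.Ioo (s (2 * j + 2)) (s (2 * j + 1))) : p.eval x ^ 2 < T ^ 2 :=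
  h.sq_lt_of_inCell_odd hr (inCell_of_mem_Ioo (by omega) hx)

theorem sqrt_abs_prod (h : IsBranchSeq r p T s) (hr : 1 ≤ r) {j : ℕ} (hj : j < r) {x : ℝ}
    (hx : x ∈ Set.Ioo (s (2 * j + 2)) (s (2 * j + 1))) :
    √|∏ k ∈ Finset.Icc 1 (2 * r), (x - s k)| = √(T ^ 2 - p.eval x ^ 2) := by
  rw [← h.eval_sq_sub hr, abs_of_neg (sub_neg.mpr (h.sq_lt_of_mem_cut hr hj hx)), neg_sub]

/-- The density has mass `1`: its primitive is `arcsin (p / T) / π` up to sign. -/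
theorem cutMean_one (h : IsBranchSeq r p T s) (hr : 1 ≤ r) {j : ℕ} (hj : j < r) :
    cutMean r p s j 1 = 1 := by
  have hT := h.pos
  have hftc : cellIntegral s (2 * r) (2 * j + 1) (1 * derivative p) =
      Real.arcsin (p.eval (s (2 * j + 1)) / T) - Real.arcsin (p.eval (s (2 * j + 2)) / T) := by
    refine intervalIntegral.integral_eq_sub_of_hasDerivAt_of_le (h.cut_lt hj).le
      (f := fun x => Real.arcsin (p.eval x / T)) ?_ (fun x hx => ?_)
      (intervalIntegrable_realQuot h.anti.injOn _ _ _)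
    · exact (Real.continuous_arcsin.comp (p.continuous.div_const T)).continuousOn
    · have hlt := h.sq_lt_of_mem_cut hr hj hx
      have habs := abs_lt.mp (abs_lt_of_sq_lt_sq hlt hT.le)
      have h1 : p.eval x / T ≠ -1 := by
        intro h1
        rw [div_eq_iff hT.ne'] at h1
        linarith
      have h2 : p.eval x / T ≠ 1 := by
        intro h1
        rw [div_eq_iff hT.ne'] at h1
        linarith
      have hd := (Real.hasDerivAt_arcsin h1 h2).comp x ((p.hasDerivAt x).div_const T)
      refine hd.congr_deriv ?_
      rw [realQuot, h.sqrt_abs_prod hr hj hx, one_mul]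
      have h3 : 1 - (p.eval x / T) ^ 2 = (T ^ 2 - p.eval x ^ 2) / T ^ 2 := by field_simp
      rw [h3, Real.sqrt_div (by linarith), Real.sqrt_sq hT.le]
      have : √(T ^ 2 - p.eval x ^ 2) ≠ 0 := (Real.sqrt_pos.mpr (by linarith)).ne'
      field_simp
  rw [cutMean, cutPeriod, hftc, h.val_odd hj, h.val_even hj, neg_div, mul_div_cancel_right₀ _ hT.ne']
  have hpi := Real.pi_pos.ne'
  rcases neg_one_pow_eq_or ℝ j with hj | hj <;> rw [hj] <;>
    simp only [Real.arcsin_neg, Real.arcsin_one, neg_neg] <;> field_simp <;> ring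

/-- The mean of `p` over a cut is zero: `p p' / √(T ^ 2 - p ^ 2)` has the primitive
`-√(T ^ 2 - p ^ 2)`, which vanishes at the ends. -/
theorem cutMean_self (h : IsBranchSeq r p T s) (hr : 1 ≤ r) {j : ℕ} (hj : j < r) :
    cutMean r p s j p = 0 := by
  have hftc : cellIntegral s (2 * r) (2 * j + 1) (p * derivative p) =
      -√(T ^ 2 - p.eval (s (2 * j + 1)) ^ 2) - -√(T ^ 2 - p.eval (s (2 * j + 2)) ^ 2) := by
    refine intervalIntegral.integral_eq_sub_of_hasDerivAt_of_le (h.cut_lt hj).le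
      (f := fun x => -√(T ^ 2 - p.eval x ^ 2)) ?_ (fun x hx => ?_)
      (intervalIntegrable_realQuot h.anti.injOn _ _ _)
    · exact (continuous_const.sub (p.continuous.pow 2)).sqrt.neg.continuousOn
    · have hlt := h.sq_lt_of_mem_cut hr hj hx
      have hd := ((((p.hasDerivAt x).pow 2).const_sub (T ^ 2)).sqrt (by simp; linarith)).neg
      refine hd.congr_deriv ?_
      rw [realQuot, h.sqrt_abs_prod hr hj hx, eval_mul]
      have : √(T ^ 2 - p.eval x ^ 2) ≠ 0 := (Real.sqrt_pos.mpr (by linarith)).ne'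
      simp only [Pi.pow_apply]
      field_simp
      push_cast
      ring
  rw [cutMean, cutPeriod, hftc, h.val_odd hj, h.val_even hj]
  rcases neg_one_pow_eq_or ℝ j with hj | hj <;> rw [hj] <;> simp

theorem cutMean_mono (h : IsBranchSeq r p T s) (hr : 1 ≤ r) {j : ℕ} (hj : j < r) {A B : ℝ[X]}
    (hAB : ∀ x ∈ Set.Icc (s (2 * j + 2)) (s (2 * j + 1)), A.eval x ≤ B.eval x) :
    cutMean r p s j A ≤ cutMean r p s j B := by
  have h1 := h.cutMean_nonneg hr hj (N := B + C (-1) * A) fun x hx => by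
    have := hAB x hx
    simp only [eval_add, eval_mul, eval_C]
    linarith
  rw [h.cutMean_add, cutMean_C_mul] at h1
  linarith

theorem cutMean_C (h : IsBranchSeq r p T s) (hr : 1 ≤ r) {j : ℕ} (hj : j < r) (c : ℝ) :
    cutMean r p s j (C c) = c := by
  rw [← mul_one (C c), cutMean_C_mul, h.cutMean_one hr hj, mul_one]

/-- The mean of a cut lies in the cut. -/
theorem cutMean_X_mem (h : IsBranchSeq r p T s) (hr : 1 ≤ r) {j : ℕ} (hj : j < r) :
    cutMean r p s j X ∈ Set.Icc (s (2 * j + 2)) (s (2 * j + 1)) := by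
  constructor
  · rw [← h.cutMean_C hr hj (s (2 * j + 2))]
    exact h.cutMean_mono hr hj fun x hx => by simpa using hx.1
  · conv_rhs => rw [← h.cutMean_C hr hj (s (2 * j + 1))]
    exact h.cutMean_mono hr hj fun x hx => by simpa using hx.2

/-- The sum of the means of `X` over all cuts is zero. -/
theorem sum_cutMean_X (h : IsBranchSeq r p T s) (hr : 2 ≤ r) (hc : p.coeff (r - 1) = 0) :
    ∑ j ∈ Finset.range r, cutMean r p s j X = 0 := by
  unfold cutMean
  rw [← Finset.mul_sum, h.sum_cutPeriod_eq_zero _ r (by exact_mod_cast h.tendsto_mul_polyQuot_sub hr hc),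
    mul_zero]

end IsBranchSeq

end SeibergWitten

namespace SeibergWitten

/-! ### The classical limit -/

/-- Newton's identity for the second coefficient of a product of linear factors. -/
theorem coeff_prod_X_sub_C (e : ℕ → ℝ) (n : ℕ) :
    (∏ i ∈ Finset.range n, (X - C (e i))).coeff n = 1 ∧
    (∀ m, n = m + 1 → (∏ i ∈ Finset.range n, (X - C (e i))).coeff m =
      -∑ i ∈ Finset.range n, e i) ∧
    ∀ m, n = m + 2 → 2 * (∏ i ∈ Finset.range n, (X - C (e i))).coeff m =
      (∑ i ∈ Finset.range n, e i) ^ 2 - ∑ i ∈ Finset.range n, e i ^ 2 := by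
  have hdeg : ∀ n, (∏ i ∈ Finset.range n, (X - C (e i))).natDegree = n := fun n => by
    rw [natDegree_prod_of_monic _ _ fun k _ => monic_X_sub_C _]
    simp
  have hstep : ∀ n k, (∏ i ∈ Finset.range (n + 1), (X - C (e i))).coeff (k + 1) =
      (∏ i ∈ Finset.range n, (X - C (e i))).coeff k -
        (∏ i ∈ Finset.range n, (X - C (e i))).coeff (k + 1) * e n := fun n k => by
    rw [Finset.prod_range_succ, mul_sub, coeff_sub, coeff_mul_X, coeff_mul_C]
  have hzero : ∀ n, (∏ i ∈ Finset.range (n + 1), (X - C (e i))).coeff 0 =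
      -((∏ i ∈ Finset.range n, (X - C (e i))).coeff 0 * e n) := fun n => by
    rw [Finset.prod_range_succ, mul_sub, coeff_sub, coeff_mul_X_zero, coeff_mul_C, zero_sub]
  induction n with
  | zero => exact ⟨by simp, by omega, by omega⟩
  | succ n ih =>
    obtain ⟨h1, h2, h3⟩ := ih
    refine ⟨?_, ?_, ?_⟩
    · rw [hstep, h1, coeff_eq_zero_of_natDegree_lt (by rw [hdeg]; omega)]
      ring
    · rintro m hm
      obtain rfl : n = m := by omega
      rw [Finset.sum_range_succ]
      rcases n with _ | n
      · rw [hzero, h1]; simp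
      · rw [hstep, h1, h2 n rfl]
        ring
    · rintro m hm
      obtain rfl : n = m + 1 := by omega
      rw [Finset.sum_range_succ, Finset.sum_range_succ _ (m + 1)]
      rcases m with _ | m
      · rw [hzero, h2 0 rfl]; simp; ring
      · rw [hstep, mul_sub, h3 m rfl, h2 (m + 1) rfl]
        ring

namespace IsBranchSeq

variable {r : ℕ} {p : ℝ[X]} {T Λ : ℝ} {s : ℕ → ℝ}

theorem abs_eval_le_of_mem_cut (h : IsBranchSeq r p T s) (hr : 1 ≤ r) {j : ℕ} (hj : j < r) {x : ℝ}
    (hx : x ∈ Set.Icc (s (2 * j + 2)) (s (2 * j + 1))) : |p.eval x| ≤ T := by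
  have hT := h.pos
  rcases eq_or_lt_of_le hx.1 with h1 | h1
  · rw [← h1, h.val_even hj, abs_neg, abs_mul, abs_pow, abs_neg, abs_one, one_pow, one_mul,
      abs_of_pos hT]
  rcases eq_or_lt_of_le hx.2 with h2 | h2
  · rw [h2, h.val_odd hj, abs_mul, abs_pow, abs_neg, abs_one, one_pow, one_mul, abs_of_pos hT]
  · exact (abs_lt_of_sq_lt_sq (h.sq_lt_of_mem_cut hr hj ⟨h1, h2⟩) hT.le |> abs_lt.mp |>
      fun h => (abs_lt.mpr h).le)

/-- Every cut is covered by the intervals of radius `2 Λ` around the zeros of `p`. -/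
theorem cut_length_le (h : IsBranchSeq r p (2 * Λ ^ r) s) (hr : 1 ≤ r) (hΛ : 0 < Λ) {j : ℕ}
    (hj : j < r) : s (2 * j + 1) - s (2 * j + 2) ≤ 4 * r * Λ := by
  choose! e he using fun (j : ℕ) (hj : j < r) => h.exists_eval_eq (c := 0) (by simpa using h.pos.le) hj
  have hp := h.sub_C_eq_prod hr he
  rw [C_0, sub_zero] at hp
  have hcover : Set.Icc (s (2 * j + 2)) (s (2 * j + 1)) ⊆
      ⋃ i ∈ Finset.range r, Metric.closedBall (e i) (2 * Λ) := by
    intro x hx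
    have h1 := h.abs_eval_le_of_mem_cut hr hj hx
    rw [hp, eval_prod, Finset.abs_prod] at h1
    simp only [eval_sub, eval_X, eval_C] at h1
    by_contra hcon
    simp only [Set.mem_iUnion, Metric.mem_closedBall, Real.dist_eq, not_exists, not_le] at hcon
    have h2 : ∏ i ∈ Finset.range r, (2 * Λ) < ∏ i ∈ Finset.range r, |x - e i| :=
      Finset.prod_lt_prod_of_nonempty (fun i _ => by positivity) hcon ⟨0, Finset.mem_range.mpr hr⟩
    rw [Finset.prod_const, Finset.card_range, mul_pow] at h2
    have h3 : (2 : ℝ) ≤ 2 ^ r := by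
      simpa using pow_le_pow_right₀ (one_le_two (α := ℝ)) hr
    have h4 : 2 * Λ ^ r ≤ 2 ^ r * Λ ^ r := by gcongr
    linarith
  have hvol := (MeasureTheory.measure_mono hcover).trans
    (MeasureTheory.measure_biUnion_finset_le (μ := MeasureTheory.volume) _ _)
  simp only [Real.volume_Icc, Real.volume_closedBall, Finset.sum_const, Finset.card_range,
    nsmul_eq_mul] at hvol
  rw [← ENNReal.ofReal_natCast, ← ENNReal.ofReal_mul (by positivity),
    ENNReal.ofReal_le_ofReal_iff (by positivity)] at hvol
  linarith

/-- If the means of the cuts stay apart, the cuts shrink like `Λ ^ r`. -/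
theorem abs_sub_le_of_mem_cut (h : IsBranchSeq r p (2 * Λ ^ r) s) (hr : 1 ≤ r) (hΛ : 0 < Λ) {δ : ℝ}
    (hδ : 0 < δ) (hsep : ∀ i < r, ∀ j < r, i ≠ j →
      δ ≤ |cutMean r p s i X - cutMean r p s j X|) (hsmall : 4 * r * Λ ≤ δ / 4) {j : ℕ} (hj : j < r)
    {x y : ℝ} (hx : x ∈ Set.Icc (s (2 * j + 2)) (s (2 * j + 1)))
    (hy : y ∈ Set.Icc (s (2 * j + 2)) (s (2 * j + 1))) :
    |x - y| ≤ 4 / (δ / 2) ^ (r - 1) * Λ ^ r := by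
  choose! e he using fun (j : ℕ) (hj : j < r) => h.exists_eval_eq (c := 0) (by simpa using h.pos.le) hj
  have hp := h.sub_C_eq_prod hr he
  rw [C_0, sub_zero] at hp
  have hlen : ∀ i < r, ∀ x ∈ Set.Icc (s (2 * i + 2)) (s (2 * i + 1)),
      ∀ y ∈ Set.Icc (s (2 * i + 2)) (s (2 * i + 1)), |x - y| ≤ δ / 4 := by
    intro i hi x hx y hy
    have := h.cut_length_le hr hΛ hi
    rw [abs_le]
    constructor <;> linarith [hx.1, hx.2, hy.1, hy.2]
  -- Of the factors of `p = ∏ (x - e i)` all but the one with `i = j` are at least `δ / 2`.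
  have key : ∀ x ∈ Set.Icc (s (2 * j + 2)) (s (2 * j + 1)),
      |x - e j| ≤ 2 / (δ / 2) ^ (r - 1) * Λ ^ r := by
    intro x hx
    have h1 := h.abs_eval_le_of_mem_cut hr hj hx
    rw [hp, eval_prod, Finset.abs_prod, ← Finset.mul_prod_erase _ _ (Finset.mem_range.mpr hj)] at h1
    simp only [eval_sub, eval_X, eval_C] at h1
    have h2 : ∏ i ∈ (Finset.range r).erase j, (δ / 2) ≤ ∏ i ∈ (Finset.range r).erase j, |x - e i| := by
      refine Finset.prod_le_prod (fun i _ => by positivity) fun i hi => ?_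
      rw [Finset.mem_erase, Finset.mem_range] at hi
      have h3 := hsep j hj i hi.2 (Ne.symm hi.1)
      have h4 := hlen j hj x hx _ (h.cutMean_X_mem hr hj)
      have h5 := hlen i hi.2 _ (he i hi.2).1 _ (h.cutMean_X_mem hr hi.2)
      have h6 : |cutMean r p s j X - cutMean r p s i X| ≤
          |x - cutMean r p s j X| + |x - e i| + |e i - cutMean r p s i X| := by
        have := abs_sub_le (cutMean r p s j X) x (e i)
        have := abs_sub_le (cutMean r p s j X) (e i) (cutMean r p s i X)
        rw [abs_sub_comm x (cutMean r p s j X)]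
        linarith
      linarith
    rw [Finset.prod_const, Finset.card_erase_of_mem (Finset.mem_range.mpr hj),
      Finset.card_range] at h2
    have h3 : |x - e j| * (δ / 2) ^ (r - 1) ≤ 2 * Λ ^ r :=
      (mul_le_mul_of_nonneg_left h2 (abs_nonneg _)).trans h1
    rw [div_mul_eq_mul_div, le_div_iff₀ (by positivity)]
    exact h3
  have h1 := key x hx
  have h2 := key y hy
  have h3 := abs_sub_le x (e j) y
  rw [abs_sub_comm (e j) y] at h3
  have : 4 / (δ / 2) ^ (r - 1) * Λ ^ r = 2 / (δ / 2) ^ (r - 1) * Λ ^ r + 2 / (δ / 2) ^ (r - 1) * Λ ^ r := by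
    ring
  linarith

/-- For two cuts the constant coefficient is, up to sign, the second moment of the first cut. -/
theorem abs_coeff_zero_add_sq_le (h : IsBranchSeq 2 p T s) (hc : p.coeff 1 = 0) {η : ℝ}
    (hη : ∀ x ∈ Set.Icc (s 2) (s 1), |x - cutMean 2 p s 0 X| ≤ η) :
    |p.coeff 0 + cutMean 2 p s 0 X ^ 2| ≤ η ^ 2 := by
  have hp : p = X ^ 2 + C (p.coeff 0) := by
    ext n
    rcases n with _ | _ | _ | n
    · simp
    · simpa using hc
    · have := h.monic.coeff_natDegree
      rw [h.natDegree] at this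
      simpa [coeff_C] using this
    · rw [coeff_eq_zero_of_natDegree_lt (by rw [h.natDegree]; omega)]
      simp [coeff_X_pow]
  obtain ⟨m, hm⟩ : ∃ m, m = cutMean 2 p s 0 X := ⟨_, rfl⟩
  obtain ⟨q, hq⟩ : ∃ q, q = p.coeff 0 := ⟨_, rfl⟩
  rw [← hq] at hp ⊢
  rw [← hm] at hη ⊢
  -- Since `p = z ^ 2 + q` has mean zero, the variance of the cut is `-(q + m ^ 2)`.
  have hvar : cutMean 2 p s 0 ((X - C m) ^ 2) = -(q + m ^ 2) := by
    have e : (X - C m) ^ 2 = p + (C (-2 * m) * X + C (m ^ 2 - q)) := by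
      rw [hp]
      simp only [map_sub, map_mul, map_pow, map_neg, C_ofNat]
      ring
    rw [e, h.cutMean_add, h.cutMean_add, h.cutMean_self one_le_two two_pos,
      cutMean_C_mul, h.cutMean_C one_le_two two_pos, ← hm]
    ring
  have h1 := h.cutMean_nonneg one_le_two two_pos (N := (X - C m) ^ 2) fun x _ => by
    rw [eval_pow]
    exact sq_nonneg _
  have h2 : cutMean 2 p s 0 ((X - C m) ^ 2) ≤ η ^ 2 := by
    conv_rhs => rw [← h.cutMean_C one_le_two two_pos (η ^ 2)]
    refine h.cutMean_mono one_le_two two_pos fun x hx => ?_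
    simp only [eval_pow, eval_sub, eval_X, eval_C]
    have h3 := abs_le.mp (hη x hx)
    exact sq_le_sq' h3.1 h3.2
  rw [hvar] at h1 h2
  rw [abs_of_nonpos (by linarith)]
  exact h2

end IsBranchSeq

theorem exists_separation {r : ℕ} {B : ℕ → ℝ} (hB : ∀ i < r, ∀ j < r, i ≠ j → B i ≠ B j) :
    ∃ δ > 0, ∀ i < r, ∀ j < r, i ≠ j → δ ≤ |B i - B j| := by
  set S := ((Finset.range r ×ˢ Finset.range r).filter fun q => q.1 ≠ q.2) with hS
  have hmem : ∀ i < r, ∀ j < r, i ≠ j → (i, j) ∈ S := fun i hi j hj hij => by simp [hS, hi, hj, hij]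
  rcases S.eq_empty_or_nonempty with h0 | hne
  · exact ⟨1, one_pos, fun i hi j hj hij => absurd (hmem i hi j hj hij) (by simp [h0])⟩
  · obtain ⟨q, hq, hmin⟩ := S.exists_min_image (fun q => |B q.1 - B q.2|) hne
    simp only [hS, Finset.mem_filter, Finset.mem_product, Finset.mem_range] at hq
    exact ⟨|B q.1 - B q.2|, abs_pos.mpr (sub_ne_zero.mpr (hB _ hq.1.1 _ hq.1.2 hq.2)),
      fun i hi j hj hij => hmin (i, j) (hmem i hi j hj hij)⟩

/-- For fixed means of the cuts, the coefficient `u_2` differs from its classical value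
`-(1 / 2) ∑ B_j ^ 2` by `O(Λ ^ 3)`. -/
theorem exists_abs_coeff_add_le {r : ℕ} (hr : 2 ≤ r) {B : ℕ → ℝ}
    (hB : ∀ i < r, ∀ j < r, i ≠ j → B i ≠ B j) :
    ∃ K Λ₁ : ℝ, 0 < Λ₁ ∧ ∀ (Λ : ℝ) (p : ℝ[X]) (s : ℕ → ℝ), 0 < Λ → Λ < Λ₁ →
      IsBranchSeq r p (2 * Λ ^ r) s → p.coeff (r - 1) = 0 →
      (∀ j < r, cutMean r p s j X = B j) →
      |p.coeff (r - 2) + (1 / 2) * ∑ j ∈ Finset.range r, B j ^ 2| ≤ K * Λ ^ 3 := by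
  obtain ⟨δ, hδ, hsep⟩ := exists_separation hB
  obtain ⟨D, hD⟩ : ∃ D, D = 4 / (δ / 2) ^ (r - 1) := ⟨_, rfl⟩
  have hD0 : 0 < D := by rw [hD]; positivity
  have hr0 : (0 : ℝ) < r := by exact_mod_cast (by omega : 0 < r)
  refine ⟨D ^ 2 + (1 / 2) * ∑ j ∈ Finset.range r, D * (2 * |B j| + D), min 1 (δ / (16 * r)),
    by positivity, fun Λ p s hΛ hΛ1 h hc hmean => ?_⟩
  have hΛ1' : Λ ≤ 1 := (hΛ1.trans_le (min_le_left _ _)).le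
  have hsmall : 4 * r * Λ ≤ δ / 4 := by
    have := (hΛ1.trans_le (min_le_right _ _)).le
    rw [le_div_iff₀ (by positivity)] at this
    linarith
  have hclose : ∀ j < r, ∀ x ∈ Set.Icc (s (2 * j + 2)) (s (2 * j + 1)),
      |x - B j| ≤ D * Λ ^ r := by
    intro j hj x hx
    rw [hD, ← hmean j hj]
    refine h.abs_sub_le_of_mem_cut (by omega) hΛ hδ (fun i hi j hj hij => ?_) hsmall hj hx
      (h.cutMean_X_mem (by omega) hj)
    rw [hmean i hi, hmean j hj]
    exact hsep i hi j hj hij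
  have hsum := h.sum_cutMean_X hr hc
  rw [Finset.sum_congr rfl fun j hj => hmean j (Finset.mem_range.mp hj)] at hsum
  have hKn : 0 ≤ (1 / 2) * ∑ j ∈ Finset.range r, D * (2 * |B j| + D) :=
    mul_nonneg (by norm_num) (Finset.sum_nonneg fun j _ => by positivity)
  rcases Nat.eq_or_lt_of_le hr with hr2 | hr3
  · -- For `r = 2` the coefficient is the second moment of the first cut.
    subst hr2
    have h2 := h.abs_coeff_zero_add_sq_le hc (η := D * Λ ^ 2) fun x hx => by
      rw [hmean 0 two_pos]
      exact hclose 0 two_pos x hx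
    rw [hmean 0 two_pos] at h2
    have h3 : (D * Λ ^ 2) ^ 2 ≤ D ^ 2 * Λ ^ 3 := by
      have : Λ ^ 4 ≤ Λ ^ 3 := pow_le_pow_of_le_one hΛ.le hΛ1' (by norm_num)
      calc (D * Λ ^ 2) ^ 2 = D ^ 2 * Λ ^ 4 := by ring
        _ ≤ _ := by gcongr
    have h4 := mul_nonneg hKn (pow_pos hΛ 3).le
    have h5 : (1 / 2) * ∑ j ∈ Finset.range 2, B j ^ 2 = B 0 ^ 2 := by
      rw [Finset.sum_range_succ, Finset.sum_range_one] at hsum ⊢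
      rw [show B 1 = -B 0 by linarith]
      ring
    rw [h5, add_mul]
    exact (h2.trans h3).trans (le_add_of_nonneg_right h4)
  · -- For `r ≥ 3` compare `-(1 / 2) ∑ e_j ^ 2`, with `e_j` the zero of `p` in the cut, term by term.
    choose! e he using fun (j : ℕ) (hj : j < r) =>
      h.exists_eval_eq (c := 0) (by simpa using h.pos.le) hj
    have hp := h.sub_C_eq_prod (by omega) he
    rw [C_0, sub_zero] at hp
    obtain ⟨m, rfl⟩ : ∃ m, r = m + 2 := ⟨r - 2, by omega⟩
    obtain ⟨-, hc1, hc2⟩ := coeff_prod_X_sub_C e (m + 2)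
    have hc1 := hc1 (m + 1) rfl
    have hc2 := hc2 m rfl
    rw [← hp] at hc1 hc2
    rw [show m + 2 - 1 = m + 1 by omega] at hc
    rw [hc] at hc1
    rw [neg_eq_zero.mp hc1.symm] at hc2
    rw [show m + 2 - 2 = m by omega]
    have e1 : p.coeff m + 1 / 2 * ∑ j ∈ Finset.range (m + 2), B j ^ 2 =
        -((1 / 2) * ∑ j ∈ Finset.range (m + 2), (e j - B j) * (e j + B j)) := by
      have : ∀ j, (e j - B j) * (e j + B j) = e j ^ 2 - B j ^ 2 := fun j => by ring
      simp only [this, Finset.sum_sub_distrib]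
      linarith
    have hΛr : Λ ^ (m + 2) ≤ Λ ^ 3 := pow_le_pow_of_le_one hΛ.le hΛ1' (by omega)
    have hΛr1 : Λ ^ (m + 2) ≤ 1 := pow_le_one₀ hΛ.le hΛ1'
    rw [e1, abs_neg, abs_mul, abs_of_pos (show (0 : ℝ) < 1 / 2 by norm_num)]
    have h2 : |∑ j ∈ Finset.range (m + 2), (e j - B j) * (e j + B j)| ≤
        (∑ j ∈ Finset.range (m + 2), D * (2 * |B j| + D)) * Λ ^ 3 := by
      rw [Finset.sum_mul]
      refine (Finset.abs_sum_le_sum_abs _ _).trans (Finset.sum_le_sum fun j hj => ?_)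
      have h3 := hclose j (Finset.mem_range.mp hj) _ (he j (Finset.mem_range.mp hj)).1
      rw [abs_mul]
      have h4 : |e j + B j| ≤ 2 * |B j| + D := by
        have h5 : |e j + B j| ≤ |e j - B j| + 2 * |B j| := by
          have := abs_add_le (e j - B j) (2 * B j)
          rw [abs_mul, abs_two] at this
          rwa [show e j - B j + 2 * B j = e j + B j by ring] at this
        have : D * Λ ^ (m + 2) ≤ D * 1 := by gcongr
        linarith
      calc |e j - B j| * |e j + B j| ≤ (D * Λ ^ (m + 2)) * (2 * |B j| + D) := by gcongr
        _ ≤ (D * Λ ^ 3) * (2 * |B j| + D) := by gcongr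
        _ = _ := by ring
    have h3 : 0 ≤ D ^ 2 * Λ ^ 3 := by positivity
    nlinarith

end SeibergWitten

namespace SeibergWitten

variable {r : ℕ} {V : Set ((Fin (r - 1) → ℂ) × ℂ)}
  {u aD : (Fin (r - 1) → ℂ) × ℂ → Fin (r - 1) → ℂ} {b₀ : Fin (r - 1) → ℝ} {ε : ℝ}
  {F : (Fin (r - 1) → ℂ) × ℂ → ℂ}

theorem hasDerivAt_realPoint_scale {G : (Fin (r - 1) → ℂ) × ℂ → ℂ} {b : Fin (r - 1) → ℝ} {Λ : ℝ}
    (hG : DifferentiableAt ℂ G (realPoint b Λ)) :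
    HasDerivAt (fun L : ℝ => G (realPoint b L)) (partialScale G (realPoint b Λ)) Λ := by
  have h0 : (realPoint (0 : Fin (r - 1) → ℝ) 1 : (Fin (r - 1) → ℂ) × ℂ) = (0, 1) := by
    refine Prod.ext ?_ ?_
    · funext j; simp [realPoint]
    · simp [realPoint]
  have h1 := hasDerivAt_realPoint hG 0 1
  rw [h0] at h1
  simp only [smul_zero, add_zero, mul_one] at h1
  have h2 : HasDerivAt (fun L : ℝ => L - Λ) 1 Λ := (hasDerivAt_id Λ).sub_const Λ
  have h3 : HasDerivAt (fun t : ℝ => G (realPoint b (Λ + t))) (partialScale G (realPoint b Λ))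
      (Λ - Λ) := by
    rw [sub_self]
    exact h1
  have h4 := h3.comp_sub_const Λ Λ
  simpa using h4

/-- At the real points the defect is a constant multiple of `Λ ^ 2`, for fixed `a`. -/
theorem IsPrepotential.exists_defect_eq_mul_sq (hr : 2 ≤ r) (hV : IsSWBranch r V u aD b₀ ε)
    (hF : IsPrepotential r V aD b₀ ε F) {b : Fin (r - 1) → ℝ} (hb : dist b b₀ < ε) :
    ∃ k : ℂ, ∀ Λ ∈ Set.Ioo 0 ε,
      defect r ⟨0, sub_one_pos hr⟩ u aD F (realPoint b Λ) = k * (Λ : ℂ) ^ 2 := by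
  obtain ⟨G, hG⟩ : ∃ G, G = defect r ⟨0, sub_one_pos hr⟩ u aD F := ⟨_, rfl⟩
  rw [← hG]
  have hder : ∀ Λ ∈ Set.Ioo 0 ε, HasDerivAt (fun L : ℝ => G (realPoint b L) / (L : ℂ) ^ 2) 0 Λ := by
    intro Λ hΛ
    have hreg : RealRegion b₀ ε b Λ := ⟨hb, hΛ.1, hΛ.2⟩
    have hmem := hV.real_mem b hb Λ hΛ.1 hΛ.2
    have h1 := hasDerivAt_realPoint_scale
      (IsPrepotential.analyticOnNhd_defect hV hF ⟨0, sub_one_pos hr⟩ _ hmem).differentiableAt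
    have h2 := hF.fderiv_defect_ray hr hV hreg
    have h3 := hF.fderiv_defect_horizontal hr hV hreg b
    have h4 : (realPoint b Λ : (Fin (r - 1) → ℂ) × ℂ) =
        realPoint b 0 + (Λ : ℂ) • ((0, 1) : (Fin (r - 1) → ℂ) × ℂ) := by
      refine Prod.ext ?_ ?_
      · funext j; simp [realPoint]
      · simp [realPoint]
    have h5 := congrArg (fderiv ℂ (defect r ⟨0, sub_one_pos hr⟩ u aD F) (realPoint b Λ)) h4
    rw [h2, map_add, h3, zero_add, map_smul, smul_eq_mul] at h5
    rw [← hG] at h1 h5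
    have hΛ0 : (Λ : ℂ) ≠ 0 := by exact_mod_cast hΛ.1.ne'
    have hpow : HasDerivAt (fun L : ℝ => (L : ℂ) ^ 2) (2 * (Λ : ℂ)) Λ := by
      simpa using (hasDerivAt_pow 2 (Λ : ℂ)).comp_ofReal
    refine (h1.div hpow (pow_ne_zero 2 hΛ0)).congr_deriv ?_
    rw [div_eq_zero_iff]
    left
    have h6 : 2 * G (realPoint b Λ) = Λ * partialScale G (realPoint b Λ) := h5
    linear_combination (-(Λ : ℂ)) * h6
  refine ⟨G (realPoint b (ε / 2)) / ((ε / 2 : ℝ) : ℂ) ^ 2, fun Λ hΛ => ?_⟩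
  have hε := hV.radius_pos
  have hconst := isOpen_Ioo.is_const_of_deriv_eq_zero isPreconnected_Ioo
    (fun Λ hΛ => (hder Λ hΛ).differentiableAt.differentiableWithinAt)
    (fun Λ hΛ => (hder Λ hΛ).deriv) hΛ (y := ε / 2) ⟨by linarith, by linarith⟩
  have hΛ0 : (Λ : ℂ) ≠ 0 := by exact_mod_cast hΛ.1.ne'
  beta_reduce at hconst
  rw [← hconst, div_mul_cancel₀ _ (pow_ne_zero 2 hΛ0)]

/-- The `A`-periods, completed by the one over the first cut, are the means of the cuts. -/
theorem RealCurve.cutMean_eq {b : Fin (r - 1) → ℝ} {Λ : ℝ} {w d : Fin (r - 1) → ℂ} {s : ℕ → ℝ}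
    (hr : 2 ≤ r) (h : RealCurve r b Λ w d s) :
    ∀ j < r, cutMean r (realPoly r fun i => (w i).re) s j X =
      if hj : j - 1 < r - 1 ∧ 1 ≤ j then b ⟨j - 1, hj.1⟩ else -∑ i, b i := by
  have hb : ∀ i : Fin (r - 1), cutMean r (realPoly r fun i => (w i).re) s (i + 1) X = b i :=
    fun i => (h.period i).symm
  intro j hj
  rcases Nat.eq_zero_or_pos j with rfl | hj0
  · rw [dif_neg (by omega)]
    have hsum := h.branch.sum_cutMean_X hr (coeff_realPoly_sub_one hr _)
    rw [sum_range_eq_add_sum_fin (by omega), Finset.sum_congr rfl fun i _ => hb i] at hsum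
    linarith
  · rw [dif_pos ⟨by omega, hj0⟩, ← hb ⟨j - 1, by omega⟩]
    simp only [Nat.sub_add_cancel hj0]

/-- For fixed `a` the coefficient `u_2` has a limit as `Λ → 0`, up to `O(Λ ^ 3)`. -/
theorem IsSWBranch.exists_norm_coeff_sub_le (hr : 2 ≤ r) (hV : IsSWBranch r V u aD b₀ ε)
    {b : Fin (r - 1) → ℝ} (hb : dist b b₀ < ε) :
    ∃ (U : ℂ) (K : ℝ), ∀ᶠ Λ : ℝ in 𝓝[>] 0,
      ‖u (realPoint b Λ) ⟨0, sub_one_pos hr⟩ - U‖ ≤ K * Λ ^ 3 := by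
  have hε := hV.radius_pos
  let B : ℕ → ℝ := fun j => if hj : j - 1 < r - 1 ∧ 1 ≤ j then b ⟨j - 1, hj.1⟩ else -∑ i, b i
  -- The means are distinct: at one value of `Λ` they lie in disjoint cuts.
  have hB : ∀ i < r, ∀ j < r, i ≠ j → B i ≠ B j := by
    obtain ⟨s, hs⟩ := hV.exists_realCurve hr
      (show RealRegion b₀ ε b (ε / 2) from ⟨hb, by linarith, by linarith⟩)
    have hmem : ∀ j < r, B j ∈ Set.Icc (s (2 * j + 2)) (s (2 * j + 1)) := fun j hj => by
      rw [show B j = _ from (hs.cutMean_eq hr j hj).symm]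
      exact hs.branch.cutMean_X_mem (by omega) hj
    intro i hi j hj hij
    rcases lt_or_gt_of_ne hij with hlt | hlt
    · exact (hs.branch.lt_of_mem_cut hlt hj (hmem i hi) (hmem j hj)).ne'
    · exact (hs.branch.lt_of_mem_cut hlt hi (hmem j hj) (hmem i hi)).ne
  obtain ⟨K, Λ₁, hΛ₁, hK⟩ := exists_abs_coeff_add_le hr hB
  refine ⟨((-((1 / 2) * ∑ j ∈ Finset.range r, B j ^ 2) : ℝ) : ℂ), K, ?_⟩
  filter_upwards [Ioo_mem_nhdsGT hΛ₁, Ioo_mem_nhdsGT hε] with Λ h1 h2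
  obtain ⟨s, hs⟩ := hV.exists_realCurve hr (show RealRegion b₀ ε b Λ from ⟨hb, h2⟩)
  have h3 := hK Λ _ s h1.1 h1.2 hs.branch (coeff_realPoly_sub_one hr _) (hs.cutMean_eq hr)
  rw [realPoly, coeff_add, coeff_X_pow, if_neg (by omega), zero_add, coeff_lowPoly hr] at h3
  rw [hs.real ⟨0, sub_one_pos hr⟩, ← Complex.ofReal_sub, Complex.norm_real, Real.norm_eq_abs, sub_neg_eq_add]
  exact h3

/-- For fixed `a`, the expansion of `F` makes `Λ ∂F / ∂Λ` constant up to `O(Λ ^ 3)`. -/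
theorem IsPrepotential.exists_norm_scale_sub_le (hr : 2 ≤ r) (hV : IsSWBranch r V u aD b₀ ε)
    (hF : IsPrepotential r V aD b₀ ε F) {b : Fin (r - 1) → ℝ} (hb : dist b b₀ < ε) :
    ∃ (c : ℂ) (K : ℝ), ∀ᶠ Λ : ℝ in 𝓝[>] 0,
      ‖(Λ : ℂ) * partialScale F (realPoint b Λ) - c‖ ≤ K * Λ ^ 3 := by
  have hε := hV.radius_pos
  obtain ⟨c, h, hh, hexp⟩ := hF.scale_expansion b hb
  refine ⟨c, 2 * r * (‖deriv h 0‖ + 1), ?_⟩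
  have hpow : Tendsto (fun L : ℝ => (L : ℂ) ^ (2 * r)) (𝓝[>] 0) (𝓝 0) := by
    have : ContinuousAt (fun L : ℝ => (L : ℂ) ^ (2 * r)) 0 := by fun_prop
    have h1 := this.tendsto.mono_left (nhdsWithin_le_nhds (s := Set.Ioi 0))
    rwa [Complex.ofReal_zero, zero_pow (by omega)] at h1
  have hd := hpow.eventually hh.eventually_analyticAt
  have hb' : ∀ᶠ z in 𝓝 (0 : ℂ), ‖deriv h z‖ < ‖deriv h 0‖ + 1 :=
    hh.deriv.continuousAt.norm.eventually_lt_const (lt_add_one _)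
  rw [← eventually_eventually_nhdsWithin] at hexp
  filter_upwards [hexp, hd, hpow.eventually hb', Ioo_mem_nhdsGT hε, Ioo_mem_nhdsGT one_pos]
    with Λ h1 h2 h3 h4 h5
  rw [(isOpen_Ioi (a := (0 : ℝ))).nhdsWithin_eq h4.1] at h1
  have hmem := hV.real_mem b hb Λ h4.1 h4.2
  have hΛ0 : (Λ : ℂ) ≠ 0 := by exact_mod_cast h4.1.ne'
  have e1 := hasDerivAt_realPoint_scale (hF.analytic _ hmem).differentiableAt
  have e2 : HasDerivAt (fun L : ℝ => c * (Real.log L : ℂ) + h ((L : ℂ) ^ (2 * r)))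
      (c * ((Λ⁻¹ : ℝ) : ℂ) + deriv h ((Λ : ℂ) ^ (2 * r)) * ((2 * r : ℕ) * (Λ : ℂ) ^ (2 * r - 1))) Λ := by
    refine ((Real.hasDerivAt_log h4.1.ne').ofReal_comp.const_mul c).add ?_
    have hp : HasDerivAt (fun L : ℝ => (L : ℂ) ^ (2 * r)) ((2 * r : ℕ) * (Λ : ℂ) ^ (2 * r - 1)) Λ :=
      (hasDerivAt_pow (2 * r) (Λ : ℂ)).comp_ofReal
    exact HasDerivAt.comp (h := fun L : ℝ => (L : ℂ) ^ (2 * r)) Λ h2.differentiableAt.hasDerivAt hp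
  have e3 := e1.unique (e2.congr_of_eventuallyEq h1)
  have e4 : (Λ : ℂ) * partialScale F (realPoint b Λ) - c =
      2 * r * deriv h ((Λ : ℂ) ^ (2 * r)) * (Λ : ℂ) ^ (2 * r) := by
    rw [e3, show 2 * r = (2 * r - 1) + 1 by omega, pow_succ, Nat.add_sub_cancel,
      show 2 * r - 1 + 1 = 2 * r by omega]
    push_cast
    field_simp
    ring
  rw [e4, norm_mul, norm_mul, norm_mul, norm_pow, Complex.norm_real, Real.norm_eq_abs,
    abs_of_pos h4.1, Complex.norm_natCast, Complex.norm_ofNat]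
  have h6 : Λ ^ (2 * r) ≤ Λ ^ 3 := pow_le_pow_of_le_one h4.1.le h5.2.le (by omega)
  have h7 := h4.1.le
  gcongr

theorem eq_zero_of_norm_mul_sq_sub_le {k M : ℂ} {K : ℝ}
    (h : ∀ᶠ Λ : ℝ in 𝓝[>] 0, ‖k * (Λ : ℂ) ^ 2 - M‖ ≤ K * Λ ^ 3) : k = 0 := by
  have h1 : Tendsto (fun Λ : ℝ => ‖k * (Λ : ℂ) ^ 2 - M‖) (𝓝[>] 0) (𝓝 ‖k * ((0 : ℝ) : ℂ) ^ 2 - M‖) := by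
    have : ContinuousAt (fun Λ : ℝ => ‖k * (Λ : ℂ) ^ 2 - M‖) 0 := by fun_prop
    exact this.tendsto.mono_left nhdsWithin_le_nhds
  have h2 : Tendsto (fun Λ : ℝ => K * Λ ^ 3) (𝓝[>] 0) (𝓝 (K * 0 ^ 3)) := by
    have : ContinuousAt (fun Λ : ℝ => K * Λ ^ 3) 0 := by fun_prop
    exact this.tendsto.mono_left nhdsWithin_le_nhds
  have hM : M = 0 := by simpa using le_of_tendsto_of_tendsto h1 h2 h
  have h3 : Tendsto (fun Λ : ℝ => K * Λ) (𝓝[>] 0) (𝓝 (K * 0)) := by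
    have : ContinuousAt (fun Λ : ℝ => K * Λ) 0 := by fun_prop
    exact this.tendsto.mono_left nhdsWithin_le_nhds
  have h4 : ‖k‖ ≤ K * 0 := by
    refine ge_of_tendsto h3 ?_
    filter_upwards [h, self_mem_nhdsWithin] with Λ hΛ hpos
    have hpos' : 0 < Λ := hpos
    rw [hM, sub_zero, norm_mul, norm_pow, Complex.norm_real, Real.norm_eq_abs, abs_of_pos hpos'] at hΛ
    have : 0 < Λ ^ 2 := by positivity
    nlinarith
  simpa using h4

/-- Both terms of the defect are constant up to `O(Λ ^ 3)`, which excludes a term `k Λ ^ 2`. -/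
theorem IsPrepotential.defect_realPoint_eq_zero (hr : 2 ≤ r) (hV : IsSWBranch r V u aD b₀ ε)
    (hF : IsPrepotential r V aD b₀ ε F) {b : Fin (r - 1) → ℝ} (hb : dist b b₀ < ε) {Λ : ℝ}
    (hΛ : Λ ∈ Set.Ioo 0 ε) : defect r ⟨0, sub_one_pos hr⟩ u aD F (realPoint b Λ) = 0 := by
  obtain ⟨k, hk⟩ := hF.exists_defect_eq_mul_sq hr hV hb
  obtain ⟨U, K₁, h1⟩ := hV.exists_norm_coeff_sub_le hr hb
  obtain ⟨c, K₂, h2⟩ := hF.exists_norm_scale_sub_le hr hV hb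
  have hk0 : k = 0 := by
    refine eq_zero_of_norm_mul_sq_sub_le (M := c + 2 * r * U) (K := K₂ + 2 * r * K₁) ?_
    filter_upwards [h1, h2, Ioo_mem_nhdsGT hV.radius_pos] with L h1 h2 hL
    rw [← hk L hL, hF.defect_eq _ (hV.real_mem b hb L hL.1 hL.2)]
    have e : (realPoint b L).2 * partialScale F (realPoint b L) +
        2 * r * u (realPoint b L) ⟨0, sub_one_pos hr⟩ - (c + 2 * r * U) =
        ((L : ℂ) * partialScale F (realPoint b L) - c) +
          2 * r * (u (realPoint b L) ⟨0, sub_one_pos hr⟩ - U) := by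
      simp only [realPoint]
      ring
    rw [e]
    refine (norm_add_le _ _).trans ?_
    rw [norm_mul, norm_mul, Complex.norm_natCast, Complex.norm_ofNat, add_mul, mul_assoc (2 * (r : ℝ))]
    gcongr
  rw [hk Λ hΛ, hk0, zero_mul]

end SeibergWitten

namespace SeibergWitten

/-! ### Analytic continuation from the real points -/

variable {r : ℕ} {V : Set ((Fin (r - 1) → ℂ) × ℂ)} {b₀ : Fin (r - 1) → ℝ} {ε : ℝ}

/-- The real points form a real form of the space of all `(a, Λ)`. -/
theorem exists_eq_realPoint_add (w : (Fin (r - 1) → ℂ) × ℂ) :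
    ∃ (x y : Fin (r - 1) → ℝ) (l m : ℝ),
      w = realPoint x l + Complex.I • realPoint y m ∧
        ‖x‖ ≤ ‖w‖ ∧ ‖y‖ ≤ ‖w‖ ∧ |l| ≤ ‖w‖ ∧ |m| ≤ ‖w‖ := by
  refine ⟨fun j => -(w.1 j).im, fun j => (w.1 j).re, w.2.re, w.2.im, ?_, ?_, ?_, ?_, ?_⟩
  · refine Prod.ext ?_ ?_
    · funext j
      apply Complex.ext <;> simp [realPoint]
    · apply Complex.ext <;> simp [realPoint]
  · refine (pi_norm_le_iff_of_nonneg (norm_nonneg _)).mpr fun j => ?_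
    rw [norm_neg, Real.norm_eq_abs]
    exact (Complex.abs_im_le_norm _).trans ((norm_le_pi_norm w.1 j).trans (norm_fst_le w))
  · refine (pi_norm_le_iff_of_nonneg (norm_nonneg _)).mpr fun j => ?_
    rw [Real.norm_eq_abs]
    exact (Complex.abs_re_le_norm _).trans ((norm_le_pi_norm w.1 j).trans (norm_fst_le w))
  · exact (Complex.abs_re_le_norm _).trans (norm_snd_le w)
  · exact (Complex.abs_im_le_norm _).trans (norm_snd_le w)

theorem norm_realPoint_le (x : Fin (r - 1) → ℝ) (l : ℝ) :
    ‖(realPoint x l : (Fin (r - 1) → ℂ) × ℂ)‖ ≤ max ‖x‖ |l| := by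
  refine max_le_max ?_ (by simp [realPoint])
  refine (pi_norm_le_iff_of_nonneg (norm_nonneg _)).mpr fun j => ?_
  simpa [realPoint] using norm_le_pi_norm x j

/-- An analytic function on `V` that vanishes at the real points vanishes on `V`. -/
theorem eqOn_zero_of_realPoint {G : (Fin (r - 1) → ℂ) × ℂ → ℂ} (hopen : IsOpen V)
    (hconn : IsPreconnected V) (hG : AnalyticOnNhd ℂ G V) (hε : 0 < ε)
    (hmem : ∀ b : Fin (r - 1) → ℝ, dist b b₀ < ε → ∀ Λ : ℝ, 0 < Λ → Λ < ε → realPoint b Λ ∈ V)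
    (h0 : ∀ b : Fin (r - 1) → ℝ, dist b b₀ < ε → ∀ Λ : ℝ, 0 < Λ → Λ < ε → G (realPoint b Λ) = 0) :
    Set.EqOn G 0 V := by
  obtain ⟨p₀, hp₀⟩ : ∃ p₀ : (Fin (r - 1) → ℂ) × ℂ, p₀ = realPoint b₀ (ε / 2) := ⟨_, rfl⟩
  have hp₀V : p₀ ∈ V := hp₀ ▸ hmem b₀ (by simpa using hε) (ε / 2) (by linarith) (by linarith)
  refine hG.eqOn_zero_of_preconnected_of_eventuallyEq_zero hconn hp₀V ?_
  obtain ⟨R, hR, hball⟩ := Metric.isOpen_iff.mp hopen p₀ hp₀V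
  set η := min (R / 4) (ε / 4) with hη
  have hη0 : 0 < η := by positivity
  have hηR : 4 * η ≤ R := by have := min_le_left (R / 4) (ε / 4); rw [← hη] at this; linarith
  have hηε : 4 * η ≤ ε := by have := min_le_right (R / 4) (ε / 4); rw [← hη] at this; linarith
  filter_upwards [Metric.ball_mem_nhds p₀ hη0] with q hq
  obtain ⟨x, y, l, m, hw, hx, hy, hl, hm⟩ := exists_eq_realPoint_add (q - p₀)
  rw [Metric.mem_ball, dist_eq_norm] at hq
  -- Restrict `G` to the complex line through the real direction `(y, m)`.
  let φ : ℂ → (Fin (r - 1) → ℂ) × ℂ := fun z => p₀ + realPoint x l + z • realPoint y m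
  have hφV : ∀ z ∈ Metric.ball (0 : ℂ) 2, φ z ∈ V := by
    intro z hz
    rw [mem_ball_zero_iff] at hz
    refine hball ?_
    rw [Metric.mem_ball, dist_eq_norm]
    have h1 : φ z - p₀ = realPoint x l + z • realPoint y m := by simp only [φ]; abel
    have h2 := (norm_realPoint_le x l).trans (max_le hx hl)
    have h3 := (norm_realPoint_le y m).trans (max_le hy hm)
    rw [h1]
    refine (norm_add_le _ _).trans_lt ?_
    rw [norm_smul]
    have h4 : ‖z‖ * ‖(realPoint y m : (Fin (r - 1) → ℂ) × ℂ)‖ ≤ 2 * ‖q - p₀‖ := by gcongr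
    linarith
  have hφ : ∀ z, AnalyticAt ℂ φ z := fun z => by
    refine analyticAt_const.add ?_
    exact analyticAt_id.smul analyticAt_const
  have han : AnalyticOnNhd ℂ (G ∘ φ) (Metric.ball 0 2) := fun z hz =>
    (hG _ (hφV z hz)).comp (hφ z)
  have hreal : ∀ t : ℝ, |t| < 1 → (G ∘ φ) t = 0 := by
    intro t ht
    have h1 : φ t = realPoint (b₀ + x + t • y) (ε / 2 + l + t * m) := by
      simp only [φ]
      rw [realPoint_add_smul, hp₀]
      congr 1
      have := realPoint_add_smul b₀ x (ε / 2) l 1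
      rw [one_smul, one_mul, one_smul] at this
      exact this.symm
    have h2 : |t * m| ≤ η := by
      rw [abs_mul]
      nlinarith [abs_nonneg t, abs_nonneg m]
    have h3 := abs_le.mp h2
    have h4 := abs_lt.mp (hl.trans_lt hq)
    rw [Function.comp, h1]
    refine h0 _ ?_ _ (by linarith) (by linarith)
    rw [dist_eq_norm, show b₀ + x + t • y - b₀ = x + t • y by abel]
    refine (norm_add_le _ _).trans_lt ?_
    rw [norm_smul, Real.norm_eq_abs]
    nlinarith [abs_nonneg t, norm_nonneg y]
  have hfreq : ∃ᶠ z in 𝓝[≠] (0 : ℂ), (G ∘ φ) z = 0 := by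
    have h1 : Tendsto (fun t : ℝ => (t : ℂ)) (𝓝[>] 0) (𝓝[≠] 0) := by
      refine tendsto_nhdsWithin_iff.mpr ⟨?_, ?_⟩
      · have := Complex.continuous_ofReal.tendsto (0 : ℝ)
        rw [Complex.ofReal_zero] at this
        exact this.mono_left nhdsWithin_le_nhds
      · filter_upwards [self_mem_nhdsWithin] with t ht
        have ht' : 0 < t := ht
        simpa using ht'.ne'
    refine h1.frequently (Eventually.frequently ?_)
    filter_upwards [Ioo_mem_nhdsGT one_pos] with t ht
    exact hreal t (abs_lt.mpr ⟨by linarith [ht.1], ht.2⟩)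
  have hI : (G ∘ φ) Complex.I = 0 :=
    han.eqOn_zero_of_preconnected_of_frequently_eq_zero (convex_ball 0 2).isPreconnected
      (by simp) hfreq (by simp)
  have hq' : φ Complex.I = q := by
    simp only [φ]
    rw [add_assoc, ← hw]
    abel
  rw [Function.comp, hq'] at hI
  exact hI

end SeibergWitten

theorem mainTheorem8 (r : ℕ) (hr : 2 ≤ r)
    (V : Set ((Fin (r - 1) → ℂ) × ℂ))
    (u aD : (Fin (r - 1) → ℂ) × ℂ → Fin (r - 1) → ℂ)
    (b₀ : Fin (r - 1) → ℝ) (ε : ℝ)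
    (hV : SeibergWitten.IsSWBranch r V u aD b₀ ε)
    (F : (Fin (r - 1) → ℂ) × ℂ → ℂ)
    (hF : SeibergWitten.IsPrepotential r V aD b₀ ε F) :
    ∀ p ∈ V, p.2 * SeibergWitten.partialScale F p =
      -2 * (r : ℂ) * u p ⟨0, by omega⟩ := by
  intro p hp
  have h := SeibergWitten.eqOn_zero_of_realPoint hV.isOpen hV.isConnected.isPreconnected
    (hF.analyticOnNhd_defect hV ⟨0, SeibergWitten.sub_one_pos hr⟩) hV.radius_pos hV.real_mem
    (fun b hb Λ h1 h2 => hF.defect_realPoint_eq_zero hr hV hb ⟨h1, h2⟩) hp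
  rw [hF.defect_eq ⟨0, SeibergWitten.sub_one_pos hr⟩ hp, Pi.zero_apply] at h
  linear_combination h
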